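/- Let $k$ be a field of characteristic $0$. Chain complexes over $k$ are graded homologically, $V[n]_i=V_{i+n}$, $\Sigma V=V[-1]$, $(V^*)_i=(V_{-i})^*$. A cyclic operad $\mathcal A$ is understood without unit and in chain complexes over $k$: chain complexes $\mathcal A(I)$, functorial in bijections of finite sets $I$, with $\mathcal A(I)=0$ for $|I|<3$, and equivariant, symmetric, associative compositions $\mathcal A(I\sqcup\{*\})\otimes\mathcal A(J\sqcup\{*\})\to\mathcal A(I\sqcup J)$. A cyclic operad twisted by the dualizing cocycle $\mathrm{Det}(\mathrm{Edge})$ is the analogue with compositions of degree $-1$. Let $\tilde{\mathcal A}$ be the modular operad with $\tilde{\mathcal A}(0,I)=\mathcal A(I)$ and $\tilde{\mathcal A}(g,I)=0$ for $g\ge 1$. Its Feynman transform (for the trivial cocycle) is $$F(\tilde{\mathcal A})(g,I)=\bigoplus_{G}\Bigl(\mathrm{Det}(E(G))\otimes\tilde{\mathcal A}((G))^*\Bigr)_{\mathrm{Aut}(G)},\qquad \tilde{\mathcal A}((G))=\bigotimes_{v\in V(G)}\tilde{\mathcal A}(g(v),H(v)),$$ where $G$ runs over the isomorphism classes of stable graphs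 of genus $g$ with legs labelled by $I$, $H(v)$ is the set of half-edges at $v$, and $\mathrm{Det}(E)$ is the top exterior power of $k^E$, placed in homological degree $-|E|$. Its differential is the sum of the transpose of the differential of $\tilde{\mathcal A}$ and of the transposes of the structure maps $\tilde{\mathcal A}((G))\to\tilde{\mathcal A}((G/e))$ that contract one edge $e$, tensored with $\mathrm{Det}(E(G/e))\to\mathrm{Det}(E(G))$, $\omega\mapsto e\wedge\omega$; its composition grafts two graphs along a new edge. Let $\mathrm{Cyc}(F(\tilde{\mathcal A}))$ be its part of genus $0$, which is a cyclic operad twisted by the dualizing cocycle. The suspension of a cyclic operad $\mathcal O$ is $(s\mathcal O)(I)=\Sigma^2\,\mathrm{Det}^{-1}(k^I)\otimes\mathcal O(I)$ (a shift by $2-|I|$, twisted by the sign representation), and $\Sigma s\mathcal O=s\mathcal O[-1]$, with the induced compositions, is a cyclic operad twisted by the dualizing cocycle. The dg dual of $\mathcal A$ is the cyclic operad $$D\mathcal A(I)=\bigoplus_{T}\bigl((s\mathcal A[-1])((T))\bigr)^*,$$ where $T$ runs over the isomorphism classes of stable trees with legs labelled by $I$; its differential is the sum of the transposes of the differential and of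 the edge contractions, and its composition is grafting. Then for every cyclic operad $\mathcal A$ there is an isomorphism $$\mathrm{Cyc}(F(\tilde{\mathcal A}))\;\cong\;\Sigma s D\mathcal A$$ of cyclic operads in chain complexes twisted by the dualizing cocycle; that is, there are isomorphisms of the vector spaces in every degree and for every finite label set $I$ that are compatible with the differentials, with relabelling along bijections and with the operadic compositions. -/

import Mathlib

universe u w

namespace CycFeyn

open Function

/-! ### Koszul signs -/

/-- The Koszul sign of reordering graded symbols `X` of degrees `p`, from the order given by the rank
function `r` to the order given by `r'`: every inverted pair contributes the product of its degrees. -/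
noncomputable def koszul {X : Type} (r r' : X → ℕ) (p : X → ℤ) : ℤˣ :=
  ∏ᶠ x : X × X, if r x.1 < r x.2 ∧ r' x.2 < r' x.1 then (p x.1 * p x.2).negOnePow else 1

/-- The Koszul sign of moving all the symbols in `U` to the left of all the others,
without changing the order inside `U` or inside its complement. -/
noncomputable def shuffle {X : Type} (U : X → Prop) (r : X → ℕ) (p : X → ℤ) : ℤˣ :=
  ∏ᶠ x : {a // U a} × {b // ¬ U b},
    if r x.2.1 < r x.1.1 then (p x.1.1 * p x.2.1).negOnePow else 1

theorem koszul_sum_aux {X Y : Type} [Finite X] [Finite Y] (r r' : X ⊕ Y → ℕ)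
    (hr : Injective r) (hr' : Injective r') (p : X ⊕ Y → ℤ) :
    koszul r r' p * (∏ᶠ x : X × Y, if r' (.inr x.2) < r' (.inl x.1) then
        (p (.inl x.1) * p (.inr x.2)).negOnePow else 1) =
      (∏ᶠ x : X × Y, if r (.inr x.2) < r (.inl x.1) then
        (p (.inl x.1) * p (.inr x.2)).negOnePow else 1) *
      koszul (r ∘ Sum.inl) (r' ∘ Sum.inl) (p ∘ Sum.inl) *
      koszul (r ∘ Sum.inr) (r' ∘ Sum.inr) (p ∘ Sum.inr) := by
  classical
  have := Fintype.ofFinite X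
  have := Fintype.ofFinite Y
  simp only [koszul, finprod_eq_prod_of_fintype, Fintype.prod_prod_type, Fintype.prod_sum_type,
    Finset.prod_mul_distrib, comp_apply]
  have key : (∏ a : X, ∏ b : Y, (if r (.inl a) < r (.inr b) ∧ r' (.inr b) < r' (.inl a) then
        (p (.inl a) * p (.inr b)).negOnePow else 1)) *
      (∏ b : Y, ∏ a : X, (if r (.inr b) < r (.inl a) ∧ r' (.inl a) < r' (.inr b) then
        (p (.inr b) * p (.inl a)).negOnePow else 1)) *
      (∏ a : X, ∏ b : Y, if r' (.inr b) < r' (.inl a) then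
        (p (.inl a) * p (.inr b)).negOnePow else 1) =
      ∏ a : X, ∏ b : Y, if r (.inr b) < r (.inl a) then
        (p (.inl a) * p (.inr b)).negOnePow else 1 := by
    rw [Finset.prod_comm (s := (Finset.univ : Finset Y)), ← Finset.prod_mul_distrib,
      ← Finset.prod_mul_distrib]
    refine Finset.prod_congr rfl fun a _ => ?_
    rw [← Finset.prod_mul_distrib, ← Finset.prod_mul_distrib]
    refine Finset.prod_congr rfl fun b _ => ?_
    have h1 : r (.inl a) ≠ r (.inr b) := fun h => by cases hr h
    have h2 : r' (.inl a) ≠ r' (.inr b) := fun h => by cases hr' h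
    rw [mul_comm (p (.inr b))]
    rcases lt_or_gt_of_ne h1 with h1 | h1 <;> rcases lt_or_gt_of_ne h2 with h2 | h2 <;>
      simp [h1, h2, h1.not_gt, h2.not_gt]
  rw [← key]
  generalize (∏ a : X, ∏ b : Y, (if r (.inl a) < r (.inr b) ∧ r' (.inr b) < r' (.inl a) then
        (p (.inl a) * p (.inr b)).negOnePow else 1)) = t1
  generalize (∏ b : Y, ∏ a : X, (if r (.inr b) < r (.inl a) ∧ r' (.inl a) < r' (.inr b) then
        (p (.inr b) * p (.inl a)).negOnePow else 1)) = t2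
  generalize (∏ a : X, ∏ b : Y, if r' (.inr b) < r' (.inl a) then
        (p (.inl a) * p (.inr b)).negOnePow else 1) = t3
  generalize (∏ a : X, ∏ b : X, _ : ℤˣ) = t4
  generalize (∏ a : Y, ∏ b : Y, _ : ℤˣ) = t5
  ac_rfl

theorem koszul_equiv {X Y : Type} (e : X ≃ Y) (r r' : Y → ℕ) (p : Y → ℤ) :
    koszul (r ∘ e) (r' ∘ e) (p ∘ e) = koszul r r' p :=
  finprod_eq_of_bijective _ (e.prodCongr e).bijective fun _ => rfl

theorem koszul_shuffle {X : Type} [Finite X] (U : X → Prop) (r r' : X → ℕ)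
    (hr : Injective r) (hr' : Injective r') (p : X → ℤ) :
    koszul r r' p * shuffle U r' p =
      shuffle U r p * koszul (fun a : {a // U a} => r a) (fun a => r' a) (fun a => p a) *
        koszul (fun a : {a // ¬ U a} => r a) (fun a => r' a) (fun a => p a) := by
  classical
  have := koszul_sum_aux (r ∘ Equiv.sumCompl U) (r' ∘ Equiv.sumCompl U)
    (hr.comp (Equiv.injective _)) (hr'.comp (Equiv.injective _)) (p ∘ Equiv.sumCompl U)
  rw [koszul_equiv] at this
  exact this

theorem shuffle_equiv {X Y : Type} (e : X ≃ Y) (U : X → Prop) (U' : Y → Prop)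
    (hU : ∀ x, U x ↔ U' (e x)) (r : Y → ℕ) (p : Y → ℤ) :
    shuffle U (r ∘ e) (p ∘ e) = shuffle U' r p :=
  finprod_eq_of_bijective _ ((e.subtypeEquiv hU).prodCongr
    (e.subtypeEquiv fun a => not_congr (hU a))).bijective fun _ => rfl

/-- The order on `Option X` in which `none` comes first. -/
def consRank {X : Type} (r : X ↪ ℕ) : Option X ↪ ℕ where
  toFun o := o.elim 0 fun x => r x + 1
  inj' := by
    rintro (_ | x) (_ | y) h
    · rfl
    · simp at h
    · simp at h
    · simpa using h

@[simp] theorem consRank_none {X : Type} (r : X ↪ ℕ) : consRank r none = 0 := rfl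

@[simp] theorem consRank_some {X : Type} (r : X ↪ ℕ) (x : X) : consRank r (some x) = r x + 1 := rfl

theorem koszul_consRank {X : Type} [Finite X] (r r' : X ↪ ℕ) (p : Option X → ℤ) :
    koszul (consRank r) (consRank r') p = koszul r r' (fun x => p (some x)) := by
  classical
  have := Fintype.ofFinite X
  simp [koszul, finprod_eq_prod_of_fintype, Fintype.prod_prod_type, Fintype.prod_option]

theorem koszul_congr_deg {X : Type} (r r' : X → ℕ) (p p' : X → ℤ) (h : ∀ x, p x = p' x) :
    koszul r r' p = koszul r r' p' := by rw [funext h]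

theorem koszul_subsingleton {X : Type} [Subsingleton X] (r r' : X → ℕ) (p : X → ℤ) :
    koszul r r' p = 1 := by
  refine finprod_eq_one_of_forall_eq_one fun x => ?_
  rw [Subsingleton.elim x.1 x.2]
  simp

theorem koszul_self {X : Type} (r : X → ℕ) (p : X → ℤ) : koszul r r p = 1 :=
  finprod_eq_one_of_forall_eq_one fun _ => if_neg fun h => (h.1.trans h.2).false

/-! ### Bijections used to relabel -/

/-- Exchange the two outermost points of `Option (Option I)`. -/
def swapPts (I : Type) : Option (Option I) ≃ Option (Option I) where
  toFun | none => some none | some none => none | some (some i) => some (some i)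
  invFun | none => some none | some none => none | some (some i) => some (some i)
  left_inv := by rintro (_ | _ | i) <;> rfl
  right_inv := by rintro (_ | _ | i) <;> rfl

/-- Move the third point of `Option (Option (Option I))` to the outermost place. -/
def rotPts (I : Type) : Option (Option (Option I)) ≃ Option (Option (Option I)) where
  toFun | none => some none | some none => some (some none) | some (some none) => none
        | some (some (some i)) => some (some (some i))
  invFun | some none => none | some (some none) => some none | none => some (some none)
         | some (some (some i)) => some (some (some i))
  left_inv := by rintro (_ | _ | _ | i) <;> rfl
  right_inv := by rintro (_ | _ | _ | i) <;> rfl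

/-- Exchange the first two points of `Option⁴ I` with the third and fourth ones. -/
def swapPairs (I : Type) : Option (Option (Option (Option I))) ≃
    Option (Option (Option (Option I))) where
  toFun | none => some (some none) | some none => some (some (some none))
        | some (some none) => none | some (some (some none)) => some none
        | some (some (some (some i))) => some (some (some (some i)))
  invFun | none => some (some none) | some none => some (some (some none))
         | some (some none) => none | some (some (some none)) => some none
         | some (some (some (some i))) => some (some (some (some i)))
  left_inv := by rintro (_ | _ | _ | _ | i) <;> rfl
  right_inv := by rintro (_ | _ | _ | _ | i) <;> rfl

/-- `I ⊔ (J ∪ {*}) ≃ (I ⊔ J) ∪ {*}`. -/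
def pullRight (I J : Type) : I ⊕ Option J ≃ Option (I ⊕ J) where
  toFun | .inl i => some (.inl i) | .inr none => none | .inr (some j) => some (.inr j)
  invFun | some (.inl i) => .inl i | none => .inr none | some (.inr j) => .inr (some j)
  left_inv := by rintro (_ | _ | _) <;> rfl
  right_inv := by rintro (_ | _ | _) <;> rfl

/-- `(I ∪ {*}) ⊔ J ≃ (I ⊔ J) ∪ {*}`. -/
def pullLeft (I J : Type) : Option I ⊕ J ≃ Option (I ⊕ J) where
  toFun | .inl (some i) => some (.inl i) | .inl none => none | .inr j => some (.inr j)
  invFun | some (.inl i) => .inl (some i) | none => .inl none | some (.inr j) => .inr j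
  left_inv := by rintro ((_ | _) | _) <;> rfl
  right_inv := by rintro (_ | _ | _) <;> rfl

/-! ### Cyclic operads -/

/-- The underlying data of a cyclic operad in chain complexes over `k`, twisted by the `δ`-th power
of the dualizing cocycle (`δ = 0`: no twist; `δ = 1`: twisted by `Det(Edge)`, an edge having
homological degree `-1`): graded vector spaces `obj I n` (labels of the inputs and output in the
finite set `I`, homological degree `n`), differentials, relabelling along bijections,
and the composition gluing the distinguished elements `none` of `Option I` and `Option J`. -/
structure CyclicData (k : Type u) [Field k] (δ : ℤ) where
  obj : Type → ℤ → Type w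
  [acg : ∀ I n, AddCommGroup (obj I n)]
  [mod : ∀ I n, Module k (obj I n)]
  d : ∀ {I : Type} {n m : ℤ}, m + 1 = n → (obj I n →ₗ[k] obj I m)
  map : ∀ {I J : Type} {n : ℤ}, I ≃ J → (obj I n →ₗ[k] obj J n)
  comp : ∀ {I J : Type} [Finite I] [Finite J] {p q r : ℤ}, r + δ = p + q →
    (obj (Option I) p →ₗ[k] obj (Option J) q →ₗ[k] obj (I ⊕ J) r)

attribute [instance] CyclicData.acg CyclicData.mod

/-- Functoriality in the label set, and equivariance and (graded) symmetry of the composition. -/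
structure CyclicData.Equivariant {k : Type u} [Field k] {δ : ℤ} (O : CyclicData.{u, w} k δ) :
    Prop where
  map_refl : ∀ {I : Type} {n : ℤ} (x : O.obj I n), O.map (Equiv.refl I) x = x
  map_trans : ∀ {I J K : Type} {n : ℤ} (f : I ≃ J) (g : J ≃ K) (x : O.obj I n),
    O.map (f.trans g) x = O.map g (O.map f x)
  d_map : ∀ {I J : Type} {n m : ℤ} (h : m + 1 = n) (f : I ≃ J) (x : O.obj I n),
    O.d h (O.map f x) = O.map f (O.d h x)
  comp_map : ∀ {I I' J J' : Type} [Finite I] [Finite I'] [Finite J] [Finite J'] {p q r : ℤ}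
    (h : r + δ = p + q) (f : I ≃ I') (g : J ≃ J') (x : O.obj (Option I) p)
    (y : O.obj (Option J) q),
    O.comp h (O.map f.optionCongr x) (O.map g.optionCongr y) =
      O.map (Equiv.sumCongr f g) (O.comp h x y)
  comp_symm : ∀ {I J : Type} [Finite I] [Finite J] {p q r : ℤ} (h : r + δ = p + q)
    (h' : r + δ = q + p) (x : O.obj (Option I) p) (y : O.obj (Option J) q),
    O.comp h x y = (p * q).negOnePow • O.map (Equiv.sumComm J I) (O.comp h' y x)

/-- A cyclic operad in chain complexes over `k` (without unit, and with `A(I) = 0` unless `I` has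
at least three elements). -/
structure CyclicOperad (k : Type u) [Field k] extends CyclicData.{u, w} k 0 where
  equivariant : toCyclicData.Equivariant
  d_d : ∀ {I : Type} {n m l : ℤ} (h : m + 1 = n) (h' : l + 1 = m) (x : obj I n),
    d h' (d h x) = 0
  d_comp : ∀ {I J : Type} [Finite I] [Finite J] {p q r p' q' r' : ℤ} (h : r + 0 = p + q)
    (hp : p' + 1 = p) (hq : q' + 1 = q) (hr : r' + 1 = r) (h₁ : r' + 0 = p' + q)
    (h₂ : r' + 0 = p + q') (x : obj (Option I) p) (y : obj (Option J) q),
    d hr (comp h x y) = comp h₁ (d hp x) y + p.negOnePow • comp h₂ x (d hq y)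
  assoc : ∀ {I J K : Type} [Finite I] [Finite J] [Finite K] {p q r s t v : ℤ}
    (h₁ : s + 0 = p + q) (h₂ : v + 0 = s + r) (h₃ : t + 0 = q + r) (h₄ : v + 0 = p + t)
    (x : obj (Option I) p) (y : obj (Option (Option J)) q) (z : obj (Option K) r),
    map (Equiv.sumAssoc I J K) (comp h₂ (map (pullRight I J) (comp h₁ x y)) z) =
      comp h₄ x (map (pullLeft J K) (comp h₃ (map (swapPts J) y) z))
  stable : ∀ {I : Type} [Finite I] (n : ℤ), Nat.card I < 3 → Subsingleton (obj I n)

/-! ### Modular operads -/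

/-- A dg stable `S`-module `P(g, I)` with the equivariant gluing operations of a modular operad
twisted by the `ε`-th power of the dualizing cocycle; `comp` glues two operations,
`loop` glues two legs of the same operation. The genus and degree of the result of a gluing are
given up to a propositional equality. -/
structure ModularData (k : Type u) [Field k] (ε : ℤ) where
  obj : ℕ → Type → ℤ → Type w
  [acg : ∀ g I n, AddCommGroup (obj g I n)]
  [mod : ∀ g I n, Module k (obj g I n)]
  d : ∀ {g : ℕ} {I : Type} {n m : ℤ}, m + 1 = n → (obj g I n →ₗ[k] obj g I m)
  map : ∀ {g : ℕ} {I J : Type} {n : ℤ}, I ≃ J → (obj g I n →ₗ[k] obj g J n)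
  comp : ∀ {g₁ g₂ g : ℕ} {I J : Type} [Finite I] [Finite J] {p q r : ℤ}, g₁ + g₂ = g →
    r + ε = p + q →
    (obj g₁ (Option I) p →ₗ[k] obj g₂ (Option J) q →ₗ[k] obj g (I ⊕ J) r)
  loop : ∀ {g g' : ℕ} {I : Type} [Finite I] {p r : ℤ}, g + 1 = g' → r + ε = p →
    (obj g (Option (Option I)) p →ₗ[k] obj g' I r)
  map_refl : ∀ {g : ℕ} {I : Type} {n : ℤ} (x : obj g I n), map (Equiv.refl I) x = x
  map_trans : ∀ {g : ℕ} {I J K : Type} {n : ℤ} (f : I ≃ J) (f' : J ≃ K) (x : obj g I n),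
    map (f.trans f') x = map f' (map f x)
  d_map : ∀ {g : ℕ} {I J : Type} {n m : ℤ} (h : m + 1 = n) (f : I ≃ J) (x : obj g I n),
    d h (map f x) = map f (d h x)
  comp_map : ∀ {g₁ g₂ g : ℕ} {I I' J J' : Type} [Finite I] [Finite I'] [Finite J] [Finite J']
    {p q r : ℤ} (hg : g₁ + g₂ = g) (h : r + ε = p + q) (f : I ≃ I') (f' : J ≃ J')
    (x : obj g₁ (Option I) p) (y : obj g₂ (Option J) q),
    comp hg h (map f.optionCongr x) (map f'.optionCongr y) =
      map (Equiv.sumCongr f f') (comp hg h x y)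
  comp_symm : ∀ {g₁ g₂ g : ℕ} {I J : Type} [Finite I] [Finite J] {p q r : ℤ}
    (hg : g₁ + g₂ = g) (hg' : g₂ + g₁ = g) (h : r + ε = p + q) (h' : r + ε = q + p)
    (x : obj g₁ (Option I) p) (y : obj g₂ (Option J) q),
    comp hg h x y = (p * q).negOnePow • map (Equiv.sumComm J I) (comp hg' h' y x)
  loop_map : ∀ {g g' : ℕ} {I J : Type} [Finite I] [Finite J] {p r : ℤ} (hg : g + 1 = g')
    (h : r + ε = p) (f : I ≃ J) (x : obj g (Option (Option I)) p),
    loop hg h (map f.optionCongr.optionCongr x) = map f (loop hg h x)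
  loop_symm : ∀ {g g' : ℕ} {I : Type} [Finite I] {p r : ℤ} (hg : g + 1 = g') (h : r + ε = p)
    (x : obj g (Option (Option I)) p), loop hg h (map (swapPts I) x) = loop hg h x

attribute [instance] ModularData.acg ModularData.mod

/-- A modular operad in chain complexes over `k` (trivial cocycle). -/
structure ModularOperad (k : Type u) [Field k] extends ModularData.{u, w} k 0 where
  d_d : ∀ {g : ℕ} {I : Type} {n m l : ℤ} (h : m + 1 = n) (h' : l + 1 = m) (x : obj g I n),
    d h' (d h x) = 0
  d_comp : ∀ {g₁ g₂ g : ℕ} {I J : Type} [Finite I] [Finite J] {p q r p' q' r' : ℤ}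
    (hg : g₁ + g₂ = g) (h : r + 0 = p + q)
    (hp : p' + 1 = p) (hq : q' + 1 = q) (hr : r' + 1 = r) (h₁ : r' + 0 = p' + q)
    (h₂ : r' + 0 = p + q') (x : obj g₁ (Option I) p) (y : obj g₂ (Option J) q),
    d hr (comp hg h x y) = comp hg h₁ (d hp x) y + p.negOnePow • comp hg h₂ x (d hq y)
  d_loop : ∀ {g g' : ℕ} {I : Type} [Finite I] {p r p' r' : ℤ} (hg : g + 1 = g')
    (h : r + 0 = p) (h' : r' + 0 = p') (hp : p' + 1 = p) (hr : r' + 1 = r)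
    (x : obj g (Option (Option I)) p), d hr (loop hg h x) = loop hg h' (d hp x)
  assoc : ∀ {g₁ g₂ g₃ g₁₂ g₂₃ g : ℕ} {I J K : Type} [Finite I] [Finite J] [Finite K]
    {p q r s t v : ℤ} (k₁ : g₁ + g₂ = g₁₂) (k₂ : g₁₂ + g₃ = g) (k₃ : g₂ + g₃ = g₂₃)
    (k₄ : g₁ + g₂₃ = g)
    (h₁ : s + 0 = p + q) (h₂ : v + 0 = s + r) (h₃ : t + 0 = q + r) (h₄ : v + 0 = p + t)
    (x : obj g₁ (Option I) p) (y : obj g₂ (Option (Option J)) q) (z : obj g₃ (Option K) r),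
    map (Equiv.sumAssoc I J K) (comp k₂ h₂ (map (pullRight I J) (comp k₁ h₁ x y)) z) =
      comp k₄ h₄ x (map (pullLeft J K) (comp k₃ h₃ (map (swapPts J) y) z))
  loop_loop : ∀ {g g' g'' : ℕ} {I : Type} [Finite I] {p q r : ℤ} (k₁ : g + 1 = g')
    (k₂ : g' + 1 = g'') (h₁ : q + 0 = p) (h₂ : r + 0 = q)
    (x : obj g (Option (Option (Option (Option I)))) p),
    loop k₂ h₂ (loop k₁ h₁ (map (swapPairs I) x)) = loop k₂ h₂ (loop k₁ h₁ x)
  loop_comp : ∀ {g₁ g₁' g₂ g g' : ℕ} {I J : Type} [Finite I] [Finite J] {p p' q r r' : ℤ}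
    (k₁ : g₁ + g₂ = g) (k₂ : g + 1 = g') (k₃ : g₁ + 1 = g₁') (k₄ : g₁' + g₂ = g')
    (h₁ : r + 0 = p + q) (h₂ : r' + 0 = r) (h₃ : p' + 0 = p) (h₄ : r' + 0 = p' + q)
    (x : obj g₁ (Option (Option (Option I))) p) (y : obj g₂ (Option J) q),
    loop k₂ h₂ (map ((pullLeft (Option I) J).trans (pullLeft I J).optionCongr)
        (comp k₁ h₁ (map (rotPts I) x) y)) =
      comp k₄ h₄ (loop k₃ h₃ x) y
  loop_comp' : ∀ {g₁ g₂ g g' : ℕ} {I J : Type} [Finite I] [Finite J] {p q r r' : ℤ}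
    (k₁ : g₁ + g₂ = g) (k₂ : g + 1 = g') (h₁ : r + 0 = p + q) (h₂ : r' + 0 = r)
    (x : obj g₁ (Option (Option I)) p) (y : obj g₂ (Option (Option J)) q),
    loop k₂ h₂ (map ((pullLeft I (Option J)).trans (pullRight I J).optionCongr)
        (comp k₁ h₁ (map (swapPts I) x) (map (swapPts J) y))) =
      loop k₂ h₂ (map ((pullLeft I (Option J)).trans (pullRight I J).optionCongr)
        (comp k₁ h₁ x y))
  stable : ∀ {g : ℕ} {I : Type} [Finite I] (n : ℤ), 2 * g + Nat.card I < 3 →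
    Subsingleton (obj g I n)

/-! ### A cyclic operad as a modular operad concentrated in genus `0` -/

namespace CyclicOperad

variable {k : Type u} [Field k] (A : CyclicOperad.{u, w} k)

/-- `Ã(0, I) = A(I)` and `Ã(g, I) = 0` for `g ≥ 1`. -/
def extObj : ℕ → Type → ℤ → Type w
  | 0, I, n => A.obj I n
  | _ + 1, _, _ => PUnit

instance extAcg : ∀ g I n, AddCommGroup (A.extObj g I n)
  | 0, I, n => A.acg I n
  | _ + 1, _, _ => PUnit.addCommGroup

instance extMod : ∀ g I n, Module k (A.extObj g I n)
  | 0, I, n => A.mod I n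
  | _ + 1, _, _ => PUnit.module

/-- The projection of `Ã(g, I)` to `A(I)`: the identity for `g = 0`, zero otherwise. -/
def proj : ∀ (g : ℕ) {I : Type} {n : ℤ}, A.extObj g I n →ₗ[k] A.obj I n
  | 0, _, _ => LinearMap.id
  | _ + 1, _, _ => 0

/-- The map of `A(I)` to `Ã(g, I)`: the identity for `g = 0`, zero otherwise. -/
def incl : ∀ (g : ℕ) {I : Type} {n : ℤ}, A.obj I n →ₗ[k] A.extObj g I n
  | 0, _, _ => LinearMap.id
  | _ + 1, _, _ => 0

theorem incl_proj {g : ℕ} {I : Type} {n : ℤ} (x : A.extObj g I n) :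
    A.incl g (A.proj g x) = x := by
  cases g with
  | zero => rfl
  | succ g => exact Subsingleton.elim (α := PUnit) _ _

theorem incl_eq_zero {g : ℕ} (hg : g ≠ 0) {I : Type} {n : ℤ} (x : A.obj I n) :
    A.incl g x = 0 := by
  cases g with
  | zero => exact absurd rfl hg
  | succ g => rfl

theorem proj_incl {g : ℕ} (hg : g = 0) {I : Type} {n : ℤ} (x : A.obj I n) :
    A.proj g (A.incl g x) = x := by
  subst hg; rfl

theorem extObj_ext {g : ℕ} {I : Type} {n : ℤ} {x y : A.extObj g I n} (h : g = 0 → x = y) :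
    x = y := by
  cases g with
  | zero => exact h rfl
  | succ g => exact Subsingleton.elim (α := PUnit) _ _

/-- A cyclic operad `A`, regarded as a modular operad `Ã` concentrated in genus `0`. -/
def toModular : ModularOperad.{u, w} k where
  obj := A.extObj
  d {g} _ _ _ h := A.incl g ∘ₗ A.d h ∘ₗ A.proj g
  map {g} _ _ _ f := A.incl g ∘ₗ A.map f ∘ₗ A.proj g
  comp {g₁ g₂ g} _ _ _ _ _ _ _ _ h := ((A.comp h).compl₁₂ (A.proj g₁) (A.proj g₂)).compr₂ (A.incl g)
  loop _ _ := 0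
  map_refl x := by simp [A.equivariant.map_refl, incl_proj]
  map_trans {g} _ _ _ _ f f' x := A.extObj_ext fun hg => by
    simp [A.equivariant.map_trans, A.proj_incl hg]
  d_map {g} _ _ _ _ h f x := A.extObj_ext fun hg => by
    simp [A.equivariant.d_map, A.proj_incl hg]
  comp_map {g₁ g₂ g} _ _ _ _ _ _ _ _ _ _ _ hg h f f' x y := A.extObj_ext fun h0 => by
    have h1 : g₁ = 0 := by omega
    have h2 : g₂ = 0 := by omega
    simp [A.equivariant.comp_map, A.proj_incl h0, A.proj_incl h1, A.proj_incl h2]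
  comp_symm {g₁ g₂ g} I J _ _ p q r hg hg' h h' x y := A.extObj_ext fun h0 => by
    simp only [LinearMap.compr₂_apply, LinearMap.compl₁₂_apply, LinearMap.comp_apply,
      A.proj_incl h0]
    rw [A.equivariant.comp_symm h h', Units.smul_def, map_zsmul, ← Units.smul_def]
  loop_map _ _ _ _ := by simp
  loop_symm _ _ _ := by simp
  d_d {g} _ _ _ _ h h' x := A.extObj_ext fun hg => by
    simp [A.d_d, A.proj_incl hg]
  d_comp {g₁ g₂ g} _ _ _ _ _ _ _ _ _ _ hg h hp hq hr h₁ h₂ x y := A.extObj_ext fun h0 => by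
    have e1 : g₁ = 0 := by omega
    have e2 : g₂ = 0 := by omega
    simp only [LinearMap.compr₂_apply, LinearMap.compl₁₂_apply, LinearMap.comp_apply,
      A.proj_incl h0, A.proj_incl e1, A.proj_incl e2]
    rw [A.d_comp h hp hq hr h₁ h₂, map_add, Units.smul_def, map_zsmul, ← Units.smul_def]
  d_loop _ _ _ _ _ _ := by simp
  assoc {g₁ g₂ g₃ g₁₂ g₂₃ g} I J K _ _ _ _ _ _ _ _ _ k₁ k₂ k₃ k₄ h₁ h₂ h₃ h₄ x y z :=
      A.extObj_ext fun h0 => by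
    have e1 : g₁₂ = 0 := by omega
    have e2 : g₂₃ = 0 := by omega
    have e3 : g₂ = 0 := by omega
    simp only [LinearMap.compr₂_apply, LinearMap.compl₁₂_apply, LinearMap.comp_apply,
      A.proj_incl h0, A.proj_incl e1, A.proj_incl e2, A.proj_incl e3]
    rw [A.assoc h₁ h₂ h₃ h₄]
  loop_loop _ _ _ _ _ := by simp
  loop_comp _ _ _ _ _ _ _ _ _ _ := by simp
  loop_comp' _ _ _ _ _ _ := by simp
  stable {g I} _ n h := by
    cases g with
    | zero => exact A.stable (I := I) n (by simpa using h)
    | succ g => exact inferInstanceAs (Subsingleton PUnit)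

end CyclicOperad

/-! ### The suspension -/

namespace CyclicData

variable {k : Type u} [Field k]

/-- The alternating functions from the orders of `I` to a vector space `M`,
that is, `Hom(Det(k^I), M) = Det⁻¹(k^I) ⊗ M` up to the degree. -/
def alternating (k : Type u) [Field k] (I : Type) (M : Type w) [AddCommGroup M] [Module k M] :
    Submodule k ((I ↪ ℕ) → M) where
  carrier := {ω | ∀ r r' : I ↪ ℕ, ω r' = koszul r r' (fun _ => 1) • ω r}
  zero_mem' := by intro r r'; simp
  add_mem' := by
    intro a b ha hb r r'
    simp only [Pi.add_apply, ha r r', hb r r', smul_add]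
  smul_mem' := by
    intro c a ha r r'
    simp only [Pi.smul_apply, ha r r', smul_comm c]

/-- The sign of reordering `I ⊔ J` into first `I`, then `J`. -/
noncomputable def blockSign {I J : Type} (r : I ⊕ J ↪ ℕ) : ℤˣ :=
  ∏ᶠ x : I × J, if r (.inr x.2) < r (.inl x.1) then -1 else 1

theorem koszul_block {I J : Type} [Finite I] [Finite J] (r r' : I ⊕ J ↪ ℕ) :
    koszul r r' (fun _ => 1) * blockSign r' = blockSign r *
      koszul (Embedding.inl.trans r) (Embedding.inl.trans r') (fun _ => 1) *
      koszul (Embedding.inr.trans r) (Embedding.inr.trans r') (fun _ => 1) := by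
  have := koszul_sum_aux r r' r.injective r'.injective fun _ => 1
  simp only [one_mul, Int.negOnePow_one] at this
  exact this

/-- Relabelling, with the degree changed along an equality. -/
def mapCast {δ : ℤ} (O : CyclicData.{u, w} k δ) {I J : Type} {n m : ℤ} (h : n = m) (f : I ≃ J) :
    O.obj I n →ₗ[k] O.obj J m := by
  subst h
  exact O.map f

/-- The suspension `ΣsO` of a cyclic operad `O`, as a cyclic operad twisted by the dualizing
cocycle: `(ΣsO)(I) = Σ(Σ² ⊗ Det⁻¹(k^I) ⊗ O(I))`, a shift by `3 - |I|`. With `ℓ_r` the basis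
element of `Det⁻¹(k^I)[-3]` that belongs to the order `r` of `I`, an element is written as
`ℓ_r ⊗ ω(r)`; the differential is `d(ℓ_r ⊗ x) = (-1)^(3 - |I|) ℓ_r ⊗ dx` and the composition is
`(ℓ_(*,r) ⊗ x) ∘ (ℓ_(*,s) ⊗ y) = (-1)^(|x| |ℓ_(*,s)|) ℓ_(r,s) ⊗ (x ∘ y)`. -/
noncomputable def suspension (O : CyclicData.{u, w} k 0) : CyclicData.{u, w} k 1 where
  obj I n := alternating k I (O.obj I (n + Nat.card I - 3))
  d {I n m} h :=
    { toFun := fun ω => ⟨fun r => (3 - Nat.card I : ℤ).negOnePow • O.d (by omega) (ω.1 r), by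
        intro r r'
        simp only [ω.2 r r', Units.smul_def, map_zsmul]
        rw [smul_comm]⟩
      map_add' := by intro x y; ext r; simp
      map_smul' := by intro c x; ext r; simp [smul_comm c] }
  map {I J n} f :=
    { toFun := fun ω => ⟨fun r => O.mapCast (by rw [Nat.card_congr f]) f
          (ω.1 (f.toEmbedding.trans r)), by
        intro r r'
        have : koszul (f.toEmbedding.trans r) (f.toEmbedding.trans r') (fun _ => 1) =
          koszul r r' (fun _ => 1) := koszul_equiv f r r' fun _ => 1
        simp only [ω.2 (f.toEmbedding.trans r) (f.toEmbedding.trans r'), Units.smul_def,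
          map_zsmul, this]⟩
      map_add' := by intro x y; ext r; simp
      map_smul' := by intro c x; ext r; simp }
  comp {I J _ _ p q r} h :=
    LinearMap.mk₂ k
      (fun ω η => ⟨fun s => (blockSign s *
          ((p + Nat.card I - 2) * (2 - Nat.card J)).negOnePow) •
        O.comp (by
            simp only [Nat.card_sum, Finite.card_option, Nat.cast_add, Nat.cast_one]
            omega)
          (ω.1 (consRank (Embedding.inl.trans s))) (η.1 (consRank (Embedding.inr.trans s))), by
        intro s s'
        simp only [ω.2 (consRank (Embedding.inl.trans s)) (consRank (Embedding.inl.trans s')),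
          η.2 (consRank (Embedding.inr.trans s)) (consRank (Embedding.inr.trans s')),
          koszul_consRank, Units.smul_def, map_zsmul, LinearMap.smul_apply]
        simp only [smul_smul]
        congr 1
        have := koszul_block s s'
        have e : blockSign s' = koszul s s' (fun _ => 1) * (blockSign s *
            koszul (Embedding.inl.trans s) (Embedding.inl.trans s') (fun _ => 1) *
            koszul (Embedding.inr.trans s) (Embedding.inr.trans s') (fun _ => 1)) := by
          rw [← this, ← mul_assoc, Int.units_mul_self, one_mul]
        rw [e]
        simp only [Units.val_mul]
        have h1 := Int.units_mul_self
          (koszul (Embedding.inl.trans s) (Embedding.inl.trans s') (fun _ => 1))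
        have h2 := Int.units_mul_self
          (koszul (Embedding.inr.trans s) (Embedding.inr.trans s') (fun _ => 1))
        rw [Units.ext_iff, Units.val_mul, Units.val_one] at h1 h2
        generalize ((koszul (Embedding.inl.trans s) (Embedding.inl.trans s') (fun _ => 1) : ℤˣ) : ℤ)
          = a at *
        generalize ((koszul (Embedding.inr.trans s) (Embedding.inr.trans s') (fun _ => 1) : ℤˣ) : ℤ)
          = b at *
        grind⟩)
      (by intro x y z; ext s; simp)
      (by intro c x y; ext s; simp [smul_comm c])
      (by intro x y z; ext s; simp)
      (by intro c x y; ext s; simp [smul_comm c])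

theorem mapCast_rfl {δ : ℤ} (O : CyclicData.{u, w} k δ) {I J : Type} {n : ℤ} (f : I ≃ J) :
    O.mapCast (rfl : n = n) f = O.map f := rfl

theorem mapCast_refl {δ : ℤ} {O : CyclicData.{u, w} k δ} (hO : O.Equivariant) {I : Type}
    {n : ℤ} (h : n = n) (x : O.obj I n) : O.mapCast h (Equiv.refl I) x = x := hO.map_refl x

theorem mapCast_trans {δ : ℤ} {O : CyclicData.{u, w} k δ} (hO : O.Equivariant) {I J K : Type}
    {n m l : ℤ} (h : n = m) (h' : m = l) (f : I ≃ J) (g : J ≃ K) (x : O.obj I n) :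
    O.mapCast (h.trans h') (f.trans g) x = O.mapCast h' g (O.mapCast h f x) := by
  subst h h'; exact hO.map_trans f g x

theorem d_mapCast {δ : ℤ} {O : CyclicData.{u, w} k δ} (hO : O.Equivariant) {I J : Type}
    {n m n' m' : ℤ} (h : m + 1 = n) (h' : m' + 1 = n') (e : n = n') (e' : m = m') (f : I ≃ J)
    (x : O.obj I n) : O.d h' (O.mapCast e f x) = O.mapCast e' f (O.d h x) := by
  subst e e'; exact hO.d_map h f x

theorem comp_mapCast {δ : ℤ} {O : CyclicData.{u, w} k δ} (hO : O.Equivariant)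
    {I I' J J' : Type} [Finite I] [Finite I'] [Finite J] [Finite J'] {p q r p' q' r' : ℤ}
    (h : r + δ = p + q) (h' : r' + δ = p' + q') (ep : p = p') (eq : q = q') (er : r = r')
    (f : I ≃ I') (g : J ≃ J') (x : O.obj (Option I) p) (y : O.obj (Option J) q) :
    O.comp h' (O.mapCast ep f.optionCongr x) (O.mapCast eq g.optionCongr y) =
      O.mapCast er (Equiv.sumCongr f g) (O.comp h x y) := by
  subst ep eq er; exact hO.comp_map h f g x y

theorem comp_symm_mapCast {δ : ℤ} {O : CyclicData.{u, w} k δ} (hO : O.Equivariant)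
    {I J : Type} [Finite I] [Finite J] {p q r r' : ℤ}
    (h : r + δ = p + q) (h' : r' + δ = q + p) (er : r' = r)
    (x : O.obj (Option I) p) (y : O.obj (Option J) q) :
    O.comp h x y =
      (p * q).negOnePow • O.mapCast er (Equiv.sumComm J I) (O.comp h' y x) := by
  subst er; exact hO.comp_symm h h' x y

theorem blockSign_equiv {I I' J J' : Type} (f : I ≃ I') (g : J ≃ J') (r : I' ⊕ J' ↪ ℕ) :
    blockSign ((Equiv.sumCongr f g).toEmbedding.trans r) = blockSign r :=
  finprod_eq_of_bijective _ (f.prodCongr g).bijective fun _ => rfl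

theorem blockSign_swap {I J : Type} [Finite I] [Finite J] (r : I ⊕ J ↪ ℕ) :
    blockSign ((Equiv.sumComm J I).toEmbedding.trans r) =
      blockSign r * ((Nat.card I : ℤ) * Nat.card J).negOnePow := by
  classical
  have := Fintype.ofFinite I
  have := Fintype.ofFinite J
  have e : ((Nat.card I : ℤ) * Nat.card J).negOnePow = ∏ _x : I × J, (-1 : ℤˣ) := by
    rw [Finset.prod_const, Finset.card_univ, Fintype.card_prod, ← Nat.card_eq_fintype_card,
      ← Nat.card_eq_fintype_card, ← Nat.cast_mul, Int.negOnePow_def, zpow_natCast]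
  rw [e, blockSign, blockSign, finprod_eq_prod_of_fintype, finprod_eq_prod_of_fintype,
    ← Finset.prod_mul_distrib]
  refine Fintype.prod_equiv (Equiv.prodComm J I) _ _ fun x => ?_
  have h1 : r (.inl x.2) ≠ r (.inr x.1) := fun h => by cases r.injective h
  rcases lt_or_gt_of_ne h1 with h1 | h1 <;> simp [h1, h1.not_gt]

theorem suspension_equivariant {O : CyclicData.{u, w} k 0} (hO : O.Equivariant) :
    O.suspension.Equivariant where
  map_refl := by
    intro I n x
    refine Subtype.ext (funext fun r => ?_)
    exact mapCast_refl hO _ _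
  map_trans := by
    intro I J K n f g x
    refine Subtype.ext (funext fun r => ?_)
    exact mapCast_trans hO _ _ f g _
  d_map := by
    intro I J n m h f x
    refine Subtype.ext (funext fun r => ?_)
    change _ • O.d _ (O.mapCast _ f _) = O.mapCast _ f (_ • O.d _ _)
    rw [Units.smul_def, Units.smul_def, map_zsmul]
    exact congrArg₂ (fun (a : ℤ) b => a • b) (by rw [Nat.card_congr f])
      (d_mapCast hO _ _ _ _ f _)
  comp_map := by
    intro I I' J J' _ _ _ _ p q r h f g x y
    refine Subtype.ext (funext fun s => ?_)
    change (_ * _) • O.comp _ (O.mapCast _ _ _) (O.mapCast _ _ _) =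
      O.mapCast _ _ ((_ * _) • O.comp _ _ _)
    rw [Units.smul_def, Units.smul_def, map_zsmul]
    refine congrArg₂ (fun (a : ℤ) b => a • b)
      (by rw [Nat.card_congr f, Nat.card_congr g, blockSign_equiv]) ?_
    rw [← comp_mapCast hO (p' := p + Nat.card (Option I') - 3)
      (q' := q + Nat.card (Option J') - 3) (h := by
        simp only [Nat.card_sum, Finite.card_option, Nat.cast_add, Nat.cast_one]; omega)
      (h' := by simp only [Nat.card_sum, Finite.card_option, Nat.cast_add, Nat.cast_one]; omega)
      (ep := by rw [Nat.card_congr f.optionCongr]) (eq := by rw [Nat.card_congr g.optionCongr])]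
    have e1 : f.optionCongr.toEmbedding.trans (consRank (Embedding.inl.trans s)) =
        consRank (Embedding.inl.trans ((Equiv.sumCongr f g).toEmbedding.trans s)) := by
      ext (_ | i) <;> rfl
    have e2 : g.optionCongr.toEmbedding.trans (consRank (Embedding.inr.trans s)) =
        consRank (Embedding.inr.trans ((Equiv.sumCongr f g).toEmbedding.trans s)) := by
      ext (_ | i) <;> rfl
    rw [e1, e2]
  comp_symm := by
    intro I J _ _ p q r h h' x y
    refine Subtype.ext (funext fun s => ?_)
    change (_ * _) • O.comp _ _ _ = ((p * q).negOnePow • fun r => O.mapCast _ _ ((_ * _) •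
      O.comp _ (y.1 _) (x.1 _))) s
    rw [Pi.smul_apply, blockSign_swap,
      comp_symm_mapCast hO (r' := r + Nat.card (J ⊕ I) - 3)
        (h' := by
          simp only [Nat.card_sum, Finite.card_option, Nat.cast_add, Nat.cast_one]; omega)
        (er := by rw [Nat.card_congr (Equiv.sumComm J I)])]
    simp only [Units.smul_def, map_zsmul, smul_smul]
    have key : blockSign s * ((p + Nat.card I - 2) * (2 - Nat.card J)).negOnePow *
        ((p + Nat.card (Option I) - 3) * (q + Nat.card (Option J) - 3)).negOnePow =
        (p * q).negOnePow * (blockSign s * ((Nat.card I : ℤ) * Nat.card J).negOnePow *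
          ((q + Nat.card J - 2) * (2 - Nat.card I)).negOnePow) := by
      simp only [Finite.card_option, Nat.cast_add, Nat.cast_one]
      rw [mul_left_comm, mul_assoc, mul_assoc]
      congr 1
      simp only [← Int.negOnePow_add]
      rw [Int.negOnePow_eq_iff]
      exact ⟨q * Nat.card I - 2 * q - Nat.card J - Nat.card I + 2, by ring⟩
    refine congrArg₂ (fun (a : ℤ) b => a • b) ?_ rfl
    rw [← Units.val_mul, key, Units.val_mul]

end CyclicData

/-! ### Gluing along arbitrary labels -/

/-- A twisted cyclic operad as decorations of the vertices of graphs; the genus label of a vertex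
is ignored. -/
def CyclicData.toDecoration {k : Type u} [Field k] {ε : ℤ} (O : CyclicData.{u, w} k ε)
    (hO : O.Equivariant) : ModularData.{u, w} k ε where
  obj _ := O.obj
  d := O.d
  map := O.map
  comp _ h := O.comp h
  loop _ _ := 0
  map_refl := hO.map_refl
  map_trans := hO.map_trans
  d_map := hO.d_map
  comp_map _ h := hO.comp_map h
  comp_symm _ _ h h' := hO.comp_symm h h'
  loop_map _ _ _ _ := by simp
  loop_symm _ _ _ := rfl

namespace ModularData

variable {k : Type u} [Field k] {ε : ℤ} (P : ModularData.{u, w} k ε)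

/-- Relabelling, with the genus and the degree changed along equalities. -/
def cast {g g' : ℕ} {I J : Type} {n n' : ℤ} (hg : g = g') (hn : n = n') (f : I ≃ J) :
    P.obj g I n →ₗ[k] P.obj g' J n' := by
  subst hg hn
  exact P.map f

/-- The composition gluing the element `α none` of `A` to the element `β none` of `B`. -/
def glue {g₁ g₂ g : ℕ} {A B X Y M : Type} [Finite X] [Finite Y] {p q r : ℤ} (hg : g₁ + g₂ = g)
    (h : r + ε = p + q) (α : Option X ≃ A) (β : Option Y ≃ B) (γ : X ⊕ Y ≃ M) :
    P.obj g₁ A p →ₗ[k] P.obj g₂ B q →ₗ[k] P.obj g M r :=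
  ((P.comp hg h).compl₁₂ (P.map α.symm) (P.map β.symm)).compr₂ (P.map γ)

/-- The self-gluing of the elements `ψ none` and `ψ (some none)` of `A`. -/
def selfGlue {g g' : ℕ} {A M : Type} [Finite M] {p r : ℤ} (hg : g + 1 = g') (h : r + ε = p)
    (ψ : Option (Option M) ≃ A) : P.obj g A p →ₗ[k] P.obj g' M r :=
  P.loop hg h ∘ₗ P.map ψ.symm

theorem cast_refl {g : ℕ} {I : Type} {n : ℤ} (hg : g = g) (hn : n = n) (x : P.obj g I n) :
    P.cast hg hn (Equiv.refl I) x = x := P.map_refl x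

theorem cast_trans {g g' g'' : ℕ} {I J K : Type} {n n' n'' : ℤ} (hg : g = g') (hn : n = n')
    (hg' : g' = g'') (hn' : n' = n'') (f : I ≃ J) (f' : J ≃ K) (x : P.obj g I n) :
    P.cast hg' hn' f' (P.cast hg hn f x) = P.cast (hg.trans hg') (hn.trans hn') (f.trans f') x := by
  subst hg hn hg' hn'; exact (P.map_trans f f' x).symm

theorem d_cast {g g' : ℕ} {I J : Type} {n n' m m' : ℤ} (h : m + 1 = n) (h' : m' + 1 = n')
    (hg : g = g') (hn : n = n') (hm : m = m') (f : I ≃ J) (x : P.obj g I n) :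
    P.d h' (P.cast hg hn f x) = P.cast hg hm f (P.d h x) := by
  subst hg hn hm; exact P.d_map h f x

theorem glue_cast {g₁ g₂ g g₁' g₂' g' : ℕ} {A B X Y M A' B' X' Y' M' : Type}
    [Finite X] [Finite Y] [Finite X'] [Finite Y'] {p q r p' q' r' : ℤ}
    {hg : g₁ + g₂ = g} {h : r + ε = p + q} {hg' : g₁' + g₂' = g'} {h' : r' + ε = p' + q'}
    {α : Option X ≃ A} {β : Option Y ≃ B} {γ : X ⊕ Y ≃ M}
    {α' : Option X' ≃ A'} {β' : Option Y' ≃ B'} {γ' : X' ⊕ Y' ≃ M'}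
    (e₁ : g₁ = g₁') (e₂ : g₂ = g₂') (e : g = g') (ep : p = p') (eq : q = q') (er : r = r')
    (fA : A ≃ A') (fB : B ≃ B') (fM : M ≃ M') (fX : X ≃ X') (fY : Y ≃ Y')
    (hA : ∀ o, fA (α o) = α' (fX.optionCongr o)) (hB : ∀ o, fB (β o) = β' (fY.optionCongr o))
    (hM : ∀ o, fM (γ o) = γ' (Equiv.sumCongr fX fY o)) (x : P.obj g₁ A p) (y : P.obj g₂ B q) :
    P.glue hg' h' α' β' γ' (P.cast e₁ ep fA x) (P.cast e₂ eq fB y) =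
      P.cast e er fM (P.glue hg h α β γ x y) := by
  subst e₁ e₂ e ep eq er
  change P.map γ' (P.comp hg h (P.map α'.symm (P.map fA x)) (P.map β'.symm (P.map fB y))) =
    P.map fM (P.map γ (P.comp hg h (P.map α.symm x) (P.map β.symm y)))
  have e1 : fA.trans α'.symm = α.symm.trans fX.optionCongr := by
    ext o : 1
    obtain ⟨o, rfl⟩ := α.surjective o
    simp [hA]
  have e2 : fB.trans β'.symm = β.symm.trans fY.optionCongr := by
    ext o : 1
    obtain ⟨o, rfl⟩ := β.surjective o
    simp [hB]
  have e3 : γ.trans fM = (Equiv.sumCongr fX fY).trans γ' := Equiv.ext hM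
  rw [← P.map_trans, ← P.map_trans, e1, e2, P.map_trans, P.map_trans, P.comp_map, ← P.map_trans,
    ← e3, P.map_trans]

theorem glue_symm {g₁ g₂ g : ℕ} {A B X Y M : Type} [Finite X] [Finite Y] {p q r : ℤ}
    {hg : g₁ + g₂ = g} {h : r + ε = p + q} {hg' : g₂ + g₁ = g} {h' : r + ε = q + p}
    {α : Option X ≃ A} {β : Option Y ≃ B} {γ : X ⊕ Y ≃ M} {γ' : Y ⊕ X ≃ M}
    (hγ : ∀ o, γ' o = γ (Equiv.sumComm Y X o)) (x : P.obj g₁ A p) (y : P.obj g₂ B q) :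
    P.glue hg h α β γ x y = (p * q).negOnePow • P.glue hg' h' β α γ' y x := by
  change P.map γ (P.comp hg h (P.map α.symm x) (P.map β.symm y)) =
    _ • P.map γ' (P.comp hg' h' (P.map β.symm y) (P.map α.symm x))
  rw [P.comp_symm hg hg' h h', show γ' = (Equiv.sumComm Y X).trans γ from Equiv.ext hγ,
    P.map_trans, Units.smul_def, Units.smul_def, map_zsmul]

theorem selfGlue_cast {g g' g₁ g₁' : ℕ} {A M A' M' : Type} [Finite M] [Finite M']
    {p r p' r' : ℤ} {hg : g + 1 = g₁} {h : r + ε = p} {hg' : g' + 1 = g₁'} {h' : r' + ε = p'}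
    {ψ : Option (Option M) ≃ A} {ψ' : Option (Option M') ≃ A'}
    (e : g = g') (e₁ : g₁ = g₁') (ep : p = p') (er : r = r') (fA : A ≃ A') (fM : M ≃ M')
    (hA : ∀ o, fA (ψ o) = ψ' (fM.optionCongr.optionCongr o)) (x : P.obj g A p) :
    P.selfGlue hg' h' ψ' (P.cast e ep fA x) = P.cast e₁ er fM (P.selfGlue hg h ψ x) := by
  subst e e₁ ep er
  change P.loop hg h (P.map ψ'.symm (P.map fA x)) = P.map fM (P.loop hg h (P.map ψ.symm x))
  have e1 : fA.trans ψ'.symm = ψ.symm.trans fM.optionCongr.optionCongr := by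
    ext o : 1
    obtain ⟨o, rfl⟩ := ψ.surjective o
    simp [hA]
  rw [← P.map_trans, e1, P.map_trans, P.loop_map]

theorem selfGlue_symm {g g₁ : ℕ} {A M : Type} [Finite M]
    {p r : ℤ} {hg : g + 1 = g₁} {h : r + ε = p}
    {ψ ψ' : Option (Option M) ≃ A} (hψ : ∀ o, ψ' o = ψ (swapPts M o)) (x : P.obj g A p) :
    P.selfGlue hg h ψ' x = P.selfGlue hg h ψ x := by
  change P.loop hg h (P.map ψ'.symm x) = P.loop hg h (P.map ψ.symm x)
  have e1 : ψ'.symm = ψ.symm.trans (swapPts M) := by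
    ext o : 1
    obtain ⟨o, rfl⟩ := ψ'.surjective o
    rw [Equiv.symm_apply_apply, hψ]
    simp only [Equiv.trans_apply, Equiv.symm_apply_apply]
    rcases o with _ | _ | o <;> rfl
  rw [e1, P.map_trans, P.loop_symm]

end ModularData

/-! ### Graphs -/

/-- A finite graph whose legs are labelled by `I`: vertices `V` with genus labels, a set `H v` of
half-edges at every vertex `v`, edges `E`, and a bijection that identifies every half-edge either
with a leg (an element of `I`) or with one of the two halves of an edge. (Thus the involution on the
half-edges fixes the legs and exchanges the halves `(e, false)` and `(e, true)` of every edge.)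
The vertices and the edges are ordered by rank functions, and the edges carry a direction;
isomorphisms do not have to respect these. -/
structure Graph (I : Type) where
  V : Type
  E : Type
  H : V → Type
  [finV : Fintype V]
  [finE : Fintype E]
  [finH : ∀ v, Finite (H v)]
  genus : V → ℕ
  inc : (Σ v, H v) ≃ I ⊕ E × Bool
  rV : V ↪ ℕ
  rE : E ↪ ℕ

attribute [instance] Graph.finV Graph.finE Graph.finH

/-- Two injections into sets in bijection, with corresponding ranges. -/
noncomputable def liftEquiv {A B S T : Type} (τ : A → S) (j : B → T) (f : S ≃ T)
    (hτ : Injective τ) (hj : Injective j) (h : ∀ s, s ∈ Set.range τ ↔ f s ∈ Set.range j) :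
    A ≃ B :=
  (Equiv.ofInjective τ hτ).trans ((f.subtypeEquiv h).trans (Equiv.ofInjective j hj).symm)

theorem liftEquiv_spec {A B S T : Type} (τ : A → S) (j : B → T) (f : S ≃ T)
    (hτ : Injective τ) (hj : Injective j) (h : ∀ s, s ∈ Set.range τ ↔ f s ∈ Set.range j) (a : A) :
    j (liftEquiv τ j f hτ hj h a) = f (τ a) := by
  unfold liftEquiv
  simp only [Equiv.trans_apply]
  rw [Equiv.apply_ofInjective_symm hj]
  rfl

namespace Graph

variable {I J : Type}

/-- The half-edge `(e, c)`. -/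
def att (G : Graph I) (e : G.E) (c : Bool) : Σ v, G.H v := G.inc.symm (.inr (e, c))

/-- The leg labelled by `i`. -/
def leg (G : Graph I) (i : I) : Σ v, G.H v := G.inc.symm (.inl i)

/-- Two vertices are joined by an edge. -/
def Joined (G : Graph I) (v v' : G.V) : Prop :=
  ∃ e c, (G.att e c).1 = v ∧ (G.att e (!c)).1 = v'

/-- A stable graph of genus `g`: it is connected, `2 g(v) - 2 + n(v) > 0` for every vertex, and
the genera of the vertices and the first Betti number `|E| - |V| + 1` add up to `g`. -/
def IsStable (G : Graph I) (g : ℕ) : Prop :=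
  Nonempty G.V ∧ (∀ v v', Relation.ReflTransGen G.Joined v v') ∧
    (∀ v, 2 < 2 * G.genus v + Nat.card (G.H v)) ∧
    ∑ v, G.genus v + Fintype.card G.E + 1 = g + Fintype.card G.V

/-- Isomorphisms of graphs, fixing the labels of the legs. Edges may be reversed (`flip`). -/
structure Iso (G G' : Graph I) where
  v : G.V ≃ G'.V
  e : G.E ≃ G'.E
  h : ∀ u, G.H u ≃ G'.H (v u)
  flip : G.E → Bool
  genus : ∀ u, G.genus u = G'.genus (v u)
  inc : ∀ s : Σ u, G.H u, G'.inc ⟨v s.1, h s.1 s.2⟩ =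
    Sum.map id (fun x => (e x.1, xor (flip x.1) x.2)) (G.inc s)

/-- Change of the labels of the legs. -/
def relabel (G : Graph I) (f : I ≃ J) : Graph J where
  V := G.V
  E := G.E
  H := G.H
  genus := G.genus
  inc := G.inc.trans (Equiv.sumCongr f (Equiv.refl _))
  rV := G.rV
  rE := G.rE

/-- `v` is an end of the edge `e`. -/
def IsEnd (G : Graph I) (e : G.E) (v : G.V) : Prop := ∃ c, (G.att e c).1 = v

/-- The half-edges at the ends of `e` that do not belong to `e`. -/
def Rest (G : Graph I) (e : G.E) : Type :=
  {s : Σ v, G.H v // G.IsEnd e s.1 ∧ ∀ c, s ≠ G.att e c}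

/-- The half-edges at the vertices of the graph in which `e` is contracted. -/
def contractH (G : Graph I) (e : G.E) : Option {v // ¬ G.IsEnd e v} → Type
  | none => G.Rest e
  | some v => G.H v

/-- The genera of the vertices of the graph in which `e` is contracted. -/
noncomputable def contractGenus (G : Graph I) (e : G.E) : Option {v // ¬ G.IsEnd e v} → ℕ
  | none => open Classical in
      if (G.att e false).1 = (G.att e true).1 then G.genus (G.att e false).1 + 1
      else G.genus (G.att e false).1 + G.genus (G.att e true).1
  | some v => G.genus v

/-- The half-edges of the contracted graph, as half-edges of the graph. -/
def contractIncl (G : Graph I) (e : G.E) : (Σ w, G.contractH e w) → Σ v, G.H v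
  | ⟨none, s⟩ => s.1
  | ⟨some v, s⟩ => ⟨v, s⟩

/-- The inclusion of the legs and the remaining edges. -/
def edgeIncl {E K : Type} (e : E) : K ⊕ {e' : E // e' ≠ e} × Bool → K ⊕ E × Bool :=
  Sum.map id (Prod.map Subtype.val id)

theorem edgeIncl_injective {E K : Type} (e : E) : Injective (edgeIncl (K := K) e) :=
  Injective.sumMap injective_id (Subtype.val_injective.prodMap injective_id)

theorem att_inj (G : Graph I) {e e' : G.E} {c c' : Bool} :
    G.att e c = G.att e' c' ↔ e = e' ∧ c = c' := by
  simp [att]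

theorem contractIncl_injective (G : Graph I) (e : G.E) : Injective (G.contractIncl e) := by
  rintro ⟨_ | v, s⟩ ⟨_ | v', s'⟩ h
  · exact congrArg (Sigma.mk none) (Subtype.ext h)
  · have h1 : s.1 = ⟨v', s'⟩ := h
    exact absurd (by simpa [h1] using s.2.1) v'.2
  · have h1 : s'.1 = ⟨v, s⟩ := h.symm
    exact absurd (by simpa [h1] using s'.2.1) v.2
  · obtain ⟨v, hv⟩ := v
    obtain ⟨v', hv'⟩ := v'
    simp only [contractIncl] at h
    obtain rfl : v = v' := congrArg Sigma.fst h
    cases h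
    rfl

theorem mem_range_contractIncl (G : Graph I) (e : G.E) (s : Σ v, G.H v) :
    s ∈ Set.range (G.contractIncl e) ↔ ∀ c, s ≠ G.att e c := by
  constructor
  · rintro ⟨⟨_ | v, t⟩, rfl⟩
    · exact t.2.2
    · intro c hc
      exact v.2 ⟨c, (congrArg Sigma.fst hc).symm⟩
  · intro hs
    by_cases h : G.IsEnd e s.1
    · exact ⟨⟨none, ⟨s, h, hs⟩⟩, rfl⟩
    · exact ⟨⟨some ⟨s.1, h⟩, s.2⟩, rfl⟩

theorem mem_range_edgeIncl {E K : Type} (e : E) (t : K ⊕ E × Bool) :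
    t ∈ Set.range (edgeIncl (K := K) e) ↔ ∀ c, t ≠ .inr (e, c) := by
  constructor
  · rintro ⟨_ | ⟨⟨e', he⟩, c'⟩, rfl⟩ c
    · simp [edgeIncl]
    · simp [edgeIncl, he]
  · intro h
    rcases t with i | ⟨e', c⟩
    · exact ⟨.inl i, rfl⟩
    · exact ⟨.inr (⟨e', fun h' => h c (by rw [h'])⟩, c), rfl⟩

theorem range_iff (G : Graph I) (e : G.E) (s : Σ v, G.H v) :
    s ∈ Set.range (G.contractIncl e) ↔ G.inc s ∈ Set.range (edgeIncl (K := I) e) := by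
  rw [mem_range_contractIncl, mem_range_edgeIncl]
  simp [att, Equiv.eq_symm_apply]

instance (G : Graph I) (e : G.E) : Finite (G.Rest e) :=
  inferInstanceAs (Finite {_s : Σ v, G.H v // _})

instance (G : Graph I) (e : G.E) : ∀ w, Finite (G.contractH e w)
  | none => inferInstanceAs (Finite (G.Rest e))
  | some v => G.finH v

/-- The graph `G/e` in which the edge `e` is contracted. The vertex that arises is the first one;
if `e` is a loop, the genus of its vertex goes up by one. -/
noncomputable def contract (G : Graph I) (e : G.E) : Graph I where
  V := Option {v // ¬ G.IsEnd e v}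
  E := {e' // e' ≠ e}
  H := G.contractH e
  finV := Fintype.ofFinite _
  finE := Fintype.ofFinite _
  genus := G.contractGenus e
  inc := liftEquiv (G.contractIncl e) (edgeIncl e) G.inc (G.contractIncl_injective e)
    (edgeIncl_injective e) (G.range_iff e)
  rV := consRank ((Embedding.subtype _).trans G.rV)
  rE := (Embedding.subtype _).trans G.rE

theorem contract_inc (G : Graph I) (e : G.E) (s : Σ w, G.contractH e w) :
    edgeIncl e ((G.contract e).inc s) = G.inc (G.contractIncl e s) :=
  liftEquiv_spec ..

end Graph

namespace Graph

variable {I J : Type}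

namespace Iso

variable {G G' : Graph I} (f : Iso G G')

/-- The bijection between the half-edges. -/
def sig : (Σ u, G.H u) ≃ Σ u, G'.H u := Equiv.sigmaCongr f.v f.h

theorem sig_apply (s : Σ u, G.H u) : f.sig s = ⟨f.v s.1, f.h s.1 s.2⟩ := rfl

theorem inc_sig (s : Σ u, G.H u) :
    G'.inc (f.sig s) = Sum.map id (fun x => (f.e x.1, xor (f.flip x.1) x.2)) (G.inc s) := f.inc s

theorem sig_att (e : G.E) (c : Bool) :
    f.sig (G.att e c) = G'.att (f.e e) (xor (f.flip e) c) := by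
  apply G'.inc.injective
  rw [inc_sig]
  simp [att]

theorem sig_leg (i : I) : f.sig (G.leg i) = G'.leg i := by
  apply G'.inc.injective
  rw [inc_sig]
  simp [leg]

theorem isEnd (e : G.E) (v : G.V) : G.IsEnd e v ↔ G'.IsEnd (f.e e) (f.v v) := by
  constructor
  · rintro ⟨c, rfl⟩
    exact ⟨xor (f.flip e) c, by rw [← f.sig_att]; rfl⟩
  · rintro ⟨c, hc⟩
    refine ⟨xor (f.flip e) c, f.v.injective ?_⟩
    have := f.sig_att e (xor (f.flip e) c)
    rw [← Bool.xor_assoc, Bool.xor_self, Bool.false_xor] at this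
    rw [← hc, ← this]; rfl

/-- The bijection between the remaining half-edges at an edge. -/
def rest (e : G.E) : G.Rest e ≃ G'.Rest (f.e e) :=
  f.sig.subtypeEquiv fun s => and_congr (f.isEnd e s.1) (by
    constructor
    · intro h c hc
      have := f.sig_att e (xor (f.flip e) c)
      rw [← Bool.xor_assoc, Bool.xor_self, Bool.false_xor, ← hc] at this
      exact h _ (f.sig.injective this.symm)
    · intro h c hc
      exact h _ (by rw [hc, f.sig_att]))

theorem rest_coe (e : G.E) (m : G.Rest e) : (f.rest e m).1 = f.sig m.1 := rfl

/-- The bijections between the half-edges of the contracted graphs. -/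
def contractEquivH (e : G.E) : ∀ w : Option {v // ¬ G.IsEnd e v},
    G.contractH e w ≃ G'.contractH (f.e e)
      ((f.v.subtypeEquiv fun v => not_congr (f.isEnd e v)).optionCongr w)
  | none => f.rest e
  | some v => f.h v

theorem end_eq (e : G.E) (c : Bool) :
    (G'.att (f.e e) (xor (f.flip e) c)).1 = f.v (G.att e c).1 := by
  rw [← f.sig_att]; rfl

theorem contractGenus (e : G.E) : ∀ w : Option {v // ¬ G.IsEnd e v},
    G.contractGenus e w = G'.contractGenus (f.e e)
      ((f.v.subtypeEquiv fun v => not_congr (f.isEnd e v)).optionCongr w)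
  | none => by
    change Graph.contractGenus G e none = Graph.contractGenus G' (f.e e) none
    have h1 := f.end_eq e false
    have h2 := f.end_eq e true
    have g1 := f.genus (G.att e false).1
    have g2 := f.genus (G.att e true).1
    have hiff : ((G.att e false).1 = (G.att e true).1) ↔
        ((G'.att (f.e e) false).1 = (G'.att (f.e e) true).1) := by
      cases hf : f.flip e
      · simp only [hf, Bool.false_xor] at h1 h2
        rw [h1, h2, f.v.apply_eq_iff_eq]
      · simp only [hf, Bool.xor_false, Bool.xor_true, Bool.not_true] at h1 h2
        rw [h1, h2, f.v.apply_eq_iff_eq, eq_comm]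
    unfold Graph.contractGenus
    by_cases h : (G.att e false).1 = (G.att e true).1
    · have h' := hiff.1 h
      rw [if_pos h, if_pos h']
      cases hf : f.flip e
      · simp only [hf, Bool.false_xor] at h1
        rw [h1, g1]
      · simp only [hf, Bool.xor_true, Bool.not_true] at h2
        rw [h2, ← g2, h]
    · have h' := fun h' => h (hiff.2 h')
      rw [if_neg h, if_neg h']
      cases hf : f.flip e
      · simp only [hf, Bool.false_xor] at h1 h2
        rw [h1, h2, g1, g2]
      · simp only [hf, Bool.xor_false, Bool.xor_true, Bool.not_true] at h1 h2
        rw [h1, h2, g1, g2, add_comm]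
  | some v => f.genus v

/-- An isomorphism induces an isomorphism between the contracted graphs. -/
noncomputable def contract (e : G.E) : Iso (G.contract e) (G'.contract (f.e e)) where
  v := (f.v.subtypeEquiv fun v => not_congr (f.isEnd e v)).optionCongr
  e := f.e.subtypeEquiv fun e' => not_congr (by simp)
  h := f.contractEquivH e
  flip e' := f.flip e'.1
  genus := f.contractGenus e
  inc s := by
    apply edgeIncl_injective (f.e e)
    have h1 := G.contract_inc e s
    have h2 : G'.contractIncl (f.e e)
        ⟨(f.v.subtypeEquiv fun v => not_congr (f.isEnd e v)).optionCongr s.1,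
          f.contractEquivH e s.1 s.2⟩ = f.sig (G.contractIncl e s) := by
      obtain ⟨_ | v, s⟩ := s <;> rfl
    refine (G'.contract_inc (f.e e) _).trans ?_
    refine (congrArg G'.inc h2).trans ?_
    rw [inc_sig, ← h1]
    generalize (G.contract e).inc s = t
    rcases t with i | ⟨e', c⟩ <;> rfl

theorem joined (v v' : G.V) : G.Joined v v' ↔ G'.Joined (f.v v) (f.v v') := by
  constructor
  · rintro ⟨e, c, rfl, rfl⟩
    refine ⟨f.e e, xor (f.flip e) c, ?_, ?_⟩
    · exact f.end_eq e c
    · rw [← f.end_eq, Bool.xor_not]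
  · rintro ⟨e, c, h1, h2⟩
    obtain ⟨e, rfl⟩ := f.e.surjective e
    obtain ⟨c, rfl⟩ : ∃ c', c = xor (f.flip e) c' :=
      ⟨xor (f.flip e) c, by rw [← Bool.xor_assoc, Bool.xor_self, Bool.false_xor]⟩
    refine ⟨e, c, f.v.injective ?_, f.v.injective ?_⟩
    · rw [← h1, f.end_eq]
    · rw [← h2, ← f.end_eq, Bool.xor_not]

theorem isStable (f : Iso G G') (g : ℕ) : G.IsStable g ↔ G'.IsStable g := by
  have h1 : ∑ v, G.genus v = ∑ v, G'.genus v := Fintype.sum_equiv f.v _ _ f.genus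
  have h2 : Fintype.card G.E = Fintype.card G'.E := Fintype.card_congr f.e
  have h3 : Fintype.card G.V = Fintype.card G'.V := Fintype.card_congr f.v
  have h4 : ∀ v v', Relation.ReflTransGen G.Joined v v' ↔
      Relation.ReflTransGen G'.Joined (f.v v) (f.v v') := by
    intro v v'
    constructor
    · exact fun h => h.lift f.v fun a b => (f.joined a b).1
    · intro h
      have := h.lift (p := G.Joined) f.v.symm fun a b hab => (f.joined _ _).2 (by simpa using hab)
      simpa [Function.onFun] using this
  unfold IsStable
  rw [h1, h2, h3]
  refine and_congr f.v.nonempty_congr (and_congr ?_ (and_congr ?_ Iff.rfl))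
  · rw [f.v.forall_congr_left]
    refine forall_congr' fun v => ?_
    rw [f.v.forall_congr_left]
    refine forall_congr' fun v' => ?_
    rw [h4]; simp
  · constructor
    · intro h v
      obtain ⟨v, rfl⟩ := f.v.surjective v
      rw [← f.genus, ← Nat.card_congr (f.h v)]; exact h v
    · intro h v
      rw [f.genus, Nat.card_congr (f.h v)]; exact h _

/-- The same isomorphism, after a change of the labels. -/
def relabel (a : I ≃ J) : Iso (G.relabel a) (G'.relabel a) where
  v := f.v
  e := f.e
  h := f.h
  flip := f.flip
  genus := f.genus
  inc s := by
    refine (congrArg (Equiv.sumCongr a (Equiv.refl _)) (f.inc s)).trans ?_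
    change _ = Sum.map _ _ (Equiv.sumCongr a _ (G.inc s))
    generalize G.inc s = x
    rcases x with i | ⟨e, c⟩ <;> rfl

end Iso

theorem relabel_isStable (G : Graph I) (a : I ≃ J) (g : ℕ) :
    (G.relabel a).IsStable g ↔ G.IsStable g := Iff.rfl

/-! ### Merging the decorations at the ends of an edge -/

section merge

theorem att_cases (G : Graph I) (e : G.E) (s t : Σ v, G.H v) (c : Bool)
    (hs : s = G.att e c) (ht : t = G.att e (!c)) (c' : Bool) : G.att e c' = s ∨ G.att e c' = t := by
  subst hs ht
  cases c <;> cases c' <;> simp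

theorem isEnd_iff (G : Graph I) (e : G.E) (s t : Σ v, G.H v) (c : Bool)
    (hs : s = G.att e c) (ht : t = G.att e (!c)) (v : G.V) : G.IsEnd e v ↔ v = s.1 ∨ v = t.1 := by
  constructor
  · rintro ⟨c', rfl⟩
    exact (G.att_cases e s t c hs ht c').imp (congrArg _) (congrArg _)
  · rintro (rfl | rfl)
    · exact ⟨c, by rw [hs]⟩
    · exact ⟨!c, by rw [ht]⟩

theorem rest_iff (G : Graph I) (e : G.E) (s t : Σ v, G.H v) (c : Bool)
    (hs : s = G.att e c) (ht : t = G.att e (!c)) (x : Σ v, G.H v) : (G.IsEnd e x.1 ∧ ∀ c, x ≠ G.att e c) ↔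
    (x.1 = s.1 ∨ x.1 = t.1) ∧ x ≠ s ∧ x ≠ t := by
  rw [G.isEnd_iff e s t c hs ht]
  refine and_congr Iff.rfl ⟨fun h => ⟨hs ▸ h _, ht ▸ h _⟩, fun h c' => ?_⟩
  rcases G.att_cases e s t c hs ht c' with h' | h' <;> rw [h']
  exacts [h.1, h.2]

/-- The remaining half-edges at the two ends of an edge that is not a loop. -/
noncomputable def restEquiv (G : Graph I) (e : G.E) (s t : Σ v, G.H v) (c : Bool)
    (hs : s = G.att e c) (ht : t = G.att e (!c)) (hne : s.1 ≠ t.1) :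
    {a : G.H s.1 // a ≠ s.2} ⊕ {b : G.H t.1 // b ≠ t.2} ≃ G.Rest e :=
  Equiv.ofBijective (Sum.elim
      (fun a => ⟨⟨s.1, a.1⟩, (G.rest_iff e s t c hs ht _).2 ⟨.inl rfl,
        fun h => a.2 (eq_of_heq (Sigma.mk.inj_iff.1 (h.trans s.eta.symm)).2),
        fun h => hne (Sigma.mk.inj_iff.1 (h.trans t.eta.symm)).1⟩⟩)
      (fun b => ⟨⟨t.1, b.1⟩, (G.rest_iff e s t c hs ht _).2 ⟨.inr rfl,
        fun h => hne (Sigma.mk.inj_iff.1 (h.trans s.eta.symm)).1.symm,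
        fun h => b.2 (eq_of_heq (Sigma.mk.inj_iff.1 (h.trans t.eta.symm)).2)⟩⟩)) (by
    constructor
    · rintro (⟨a, ha⟩ | ⟨a, ha⟩) (⟨b, hb⟩ | ⟨b, hb⟩) h
      · have := eq_of_heq (Sigma.mk.inj_iff.1 (congrArg Subtype.val h)).2
        subst this; rfl
      · exact absurd (congrArg (fun x => x.1.1) h) hne
      · exact absurd (congrArg (fun x => x.1.1) h).symm hne
      · have := eq_of_heq (Sigma.mk.inj_iff.1 (congrArg Subtype.val h)).2
        subst this; rfl
    · rintro ⟨⟨v, x⟩, hx⟩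
      obtain ⟨h1, h2, h3⟩ := (G.rest_iff e s t c hs ht _).1 hx
      dsimp only at h1
      rcases h1 with rfl | rfl
      · exact ⟨.inl ⟨x, fun h => h2 (by rw [h])⟩, rfl⟩
      · exact ⟨.inr ⟨x, fun h => h3 (by rw [h])⟩, rfl⟩)

/-- The half-edges at the vertex of a loop. -/
noncomputable def loopEquiv (G : Graph I) (e : G.E) (s t : Σ v, G.H v) (c : Bool)
    (hs : s = G.att e c) (ht : t = G.att e (!c)) (heq : s.1 = t.1) : Option (Option (G.Rest e)) ≃ G.H s.1 :=
  (Equiv.ofBijective (fun o : Option (Option (G.Rest e)) =>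
      (match o with
        | none => ⟨s, rfl⟩
        | some none => ⟨t, heq.symm⟩
        | some (some m) => ⟨m.1, by
            obtain ⟨h | h, -⟩ := (G.rest_iff e s t c hs ht _).1 m.2
            · exact h
            · exact h.trans heq.symm⟩ : {x : Σ v, G.H v // x.1 = s.1})) (by
    have hst : s ≠ t := by
      rw [hs, ht, Ne, att_inj]; simp
    have hm := fun m : G.Rest e => (G.rest_iff e s t c hs ht _).1 m.2
    constructor
    · rintro (_ | _ | m) (_ | _ | m') h <;> have h' := congrArg Subtype.val h <;> dsimp only at h'
      · rfl
      · exact absurd h' hst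
      · exact absurd h'.symm (hm m').2.1
      · exact absurd h'.symm hst
      · rfl
      · exact absurd h'.symm (hm m').2.2
      · exact absurd h' (hm m).2.1
      · exact absurd h' (hm m).2.2
      · rw [Subtype.ext h']
    · rintro ⟨x, hx⟩
      by_cases h1 : x = s
      · exact ⟨none, Subtype.ext h1.symm⟩
      by_cases h2 : x = t
      · exact ⟨some none, Subtype.ext h2.symm⟩
      exact ⟨some (some ⟨x, (G.rest_iff e s t c hs ht _).2 ⟨.inl hx, h1, h2⟩⟩), rfl⟩)).trans
    (Equiv.sigmaSubtype s.1)

theorem loopEquiv_spec (G : Graph I) (e : G.E) (s t : Σ v, G.H v) (c : Bool)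
    (hs : s = G.att e c) (ht : t = G.att e (!c)) (heq : s.1 = t.1) (o : Option (Option (G.Rest e))) :
    (⟨s.1, G.loopEquiv e s t c hs ht heq o⟩ : Σ v, G.H v) =
      match o with | none => s | some none => t | some (some m) => m.1 := by
  have key : ∀ y : {x : Σ v, G.H v // x.1 = s.1},
      (⟨s.1, Equiv.sigmaSubtype s.1 y⟩ : Σ v, G.H v) = y.1 := by
    rintro ⟨⟨v, y⟩, hy⟩
    dsimp only at hy
    subst hy
    rfl
  have key' := key (Equiv.sigmaSubtype s.1 |>.symm (G.loopEquiv e s t c hs ht heq o))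
  rw [Equiv.apply_symm_apply] at key'
  rw [key']
  unfold loopEquiv
  rw [Equiv.trans_apply, Equiv.symm_apply_apply]
  rcases o with _ | _ | m <;> rfl

end merge

end Graph

namespace Graph

variable {I J : Type}

/-- The degrees of the decorations of `G/e`, where a gluing has degree `-ε`. -/
noncomputable def contractDeg (ε : ℤ) (G : Graph I) (e : G.E) (p : G.V → ℤ) :
    Option {v // ¬ G.IsEnd e v} → ℤ
  | none => open Classical in
      (if (G.att e false).1 = (G.att e true).1 then p (G.att e false).1
        else p (G.att e false).1 + p (G.att e true).1) - ε
  | some v => p v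

theorem loop_iff (G : Graph I) (e : G.E) (s t : Σ v, G.H v) (c : Bool)
    (hs : s = G.att e c) (ht : t = G.att e (!c)) :
    (G.att e false).1 = (G.att e true).1 ↔ s.1 = t.1 := by
  subst hs ht
  cases c
  · rfl
  · exact eq_comm

theorem genus_loop (G : Graph I) (e : G.E) (s t : Σ v, G.H v) (c : Bool)
    (hs : s = G.att e c) (ht : t = G.att e (!c)) (h : s.1 = t.1) :
    G.genus s.1 + 1 = G.contractGenus e none := by
  have h' := (G.loop_iff e s t c hs ht).2 h
  rw [contractGenus, if_pos h', hs]
  cases c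
  · rfl
  · rw [h']

theorem genus_glue (G : Graph I) (e : G.E) (s t : Σ v, G.H v) (c : Bool)
    (hs : s = G.att e c) (ht : t = G.att e (!c)) (h : s.1 ≠ t.1) :
    G.genus s.1 + G.genus t.1 = G.contractGenus e none := by
  have h' := fun h' => h ((G.loop_iff e s t c hs ht).1 h')
  rw [contractGenus, if_neg h', hs, ht]
  cases c
  · rfl
  · rw [add_comm]; rfl

theorem deg_loop (ε : ℤ) (G : Graph I) (e : G.E) (s t : Σ v, G.H v) (c : Bool)
    (hs : s = G.att e c) (ht : t = G.att e (!c)) (h : s.1 = t.1) (p : G.V → ℤ) :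
    G.contractDeg ε e p none + ε = p s.1 := by
  have h' := (G.loop_iff e s t c hs ht).2 h
  rw [contractDeg, if_pos h', hs, sub_add_cancel]
  cases c
  · rfl
  · rw [h']

theorem deg_glue (ε : ℤ) (G : Graph I) (e : G.E) (s t : Σ v, G.H v) (c : Bool)
    (hs : s = G.att e c) (ht : t = G.att e (!c)) (h : s.1 ≠ t.1) (p : G.V → ℤ) :
    G.contractDeg ε e p none + ε = p s.1 + p t.1 := by
  have h' := fun h' => h ((G.loop_iff e s t c hs ht).1 h')
  rw [contractDeg, if_neg h', hs, ht, sub_add_cancel]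
  cases c
  · rfl
  · rw [add_comm]; rfl

end Graph

namespace ModularData

variable {k : Type u} [Field k] {ε : ℤ} (P : ModularData.{u, w} k ε) {I J : Type}

/-- The decorations of the vertices of a graph by elements of `P` of degrees `p`. -/
abbrev Dec (G : Graph I) (p : G.V → ℤ) : Type w := ∀ v, P.obj (G.genus v) (G.H v) (p v)

/-- The decoration of the new vertex of `G/e`: the decorations at the ends of the edge `e`, with the
half-edges `s` and `t`, are composed; if `e` is a loop, `s` and `t` are self-glued. -/
noncomputable def merge (G : Graph I) (e : G.E) (s t : Σ v, G.H v) (c : Bool)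
    (hs : s = G.att e c) (ht : t = G.att e (!c)) {p : G.V → ℤ} (x : P.Dec G p) :
    P.obj (G.contractGenus e none) (G.Rest e) (G.contractDeg ε e p none) :=
  open Classical in
  if h : s.1 = t.1 then
    P.selfGlue (M := G.Rest e) (G.genus_loop e s t c hs ht h) (G.deg_loop ε e s t c hs ht h p)
      (G.loopEquiv e s t c hs ht h) (x s.1)
  else
    P.glue (M := G.Rest e) (G.genus_glue e s t c hs ht h) (G.deg_glue ε e s t c hs ht h p)
      (Equiv.optionSubtypeNe s.2) (Equiv.optionSubtypeNe t.2) (G.restEquiv e s t c hs ht h)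
      (x s.1) (x t.1)

/-- The decoration of `G/e` by a decoration of `G`; the edge is directed so that the half-edge
`(e, c)` comes first. -/
noncomputable def contractDec (G : Graph I) (e : G.E) (c : Bool) {p : G.V → ℤ} (x : P.Dec G p) :
    P.Dec (G.contract e) (G.contractDeg ε e p)
  | none => P.merge G e (G.att e c) (G.att e (!c)) c rfl rfl x
  | some v => x v

/-- Decorations that correspond under an isomorphism of graphs. -/
def DecRel {G G' : Graph I} (f : Graph.Iso G G') {p : G.V → ℤ} {p' : G'.V → ℤ}
    (hp : ∀ u, p u = p' (f.v u)) (x : P.Dec G p) (x' : P.Dec G' p') : Prop :=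
  ∀ u, x' (f.v u) = P.cast (f.genus u) (hp u) (f.h u) (x u)

theorem contractDeg_iso {G G' : Graph I} (f : Graph.Iso G G') (e : G.E) {p : G.V → ℤ} {p' : G'.V → ℤ}
    (hp : ∀ u, p u = p' (f.v u)) : ∀ w : Option {v // ¬ G.IsEnd e v},
    G.contractDeg ε e p w = G'.contractDeg ε (f.e e) p' ((f.contract e).v w)
  | none => by
    change G.contractDeg ε e p none = G'.contractDeg ε (f.e e) p' none
    have h0 : G.att e true = G.att e (!false) := rfl
    have e1 : G'.att (f.e e) (xor (f.flip e) false) = f.sig (G.att e false) := (f.sig_att e _).symm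
    have e2 : G'.att (f.e e) (!(xor (f.flip e) false)) = f.sig (G.att e true) := by
      rw [← Bool.xor_not]; exact (f.sig_att e _).symm
    by_cases h : (G.att e false).1 = (G.att e true).1
    · have := G.deg_loop ε e _ _ false rfl h0 h p
      have h' : (f.sig (G.att e false)).1 = (f.sig (G.att e true)).1 := congrArg f.v h
      have h2 := G'.deg_loop ε (f.e e) _ _ _ e1.symm e2.symm h' p'
      have := hp (G.att e false).1
      simp only [Graph.Iso.sig_apply] at h2
      linarith
    · have := G.deg_glue ε e _ _ false rfl h0 h p
      have h' : (f.sig (G.att e false)).1 ≠ (f.sig (G.att e true)).1 := fun h' =>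
        h (f.v.injective h')
      have h2 := G'.deg_glue ε (f.e e) _ _ _ e1.symm e2.symm h' p'
      have := hp (G.att e false).1
      have := hp (G.att e true).1
      simp only [Graph.Iso.sig_apply] at h2
      linarith
  | some v => hp v

theorem merge_iso {G G' : Graph I} (f : Graph.Iso G G') (e : G.E) {p : G.V → ℤ} {p' : G'.V → ℤ}
    (hp : ∀ u, p u = p' (f.v u)) {x : P.Dec G p} {x' : P.Dec G' p'} (hx : P.DecRel f hp x x')
    (s t : Σ v, G.H v) (c : Bool) (hs : s = G.att e c) (ht : t = G.att e (!c))
    (s' t' : Σ v, G'.H v) (c' : Bool) (hs' : s' = G'.att (f.e e) c')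
    (ht' : t' = G'.att (f.e e) (!c')) (es : s' = f.sig s) (et : t' = f.sig t) :
    P.merge G' (f.e e) s' t' c' hs' ht' x' =
      P.cast ((f.contract e).genus none) (contractDeg_iso f e hp none) (f.rest e)
        (P.merge G e s t c hs ht x) := by
  subst es et
  unfold merge
  by_cases h : s.1 = t.1
  · have h' : (f.sig s).1 = (f.sig t).1 := congrArg f.v h
    rw [dif_pos h, dif_pos h']
    have hx' : x' (f.sig s).1 = _ := hx s.1
    rw [hx']
    refine P.selfGlue_cast _ _ _ _ _ (f.rest e) ?_ _
    intro o
    have h1 := congrArg f.sig (G.loopEquiv_spec e s t c hs ht h o)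
    have h2 := G'.loopEquiv_spec (f.e e) _ _ c' hs' ht' h' ((f.rest e).optionCongr.optionCongr o)
    refine eq_of_heq (Sigma.mk.inj_iff.1 (h1.trans (Eq.trans ?_ h2.symm))).2
    rcases o with _ | _ | m <;> rfl
  · have h' : ¬ (f.sig s).1 = (f.sig t).1 := fun h' => h (f.v.injective h')
    rw [dif_neg h, dif_neg h']
    have hx1 : x' (f.sig s).1 = _ := hx s.1
    have hx2 : x' (f.sig t).1 = _ := hx t.1
    rw [hx1, hx2]
    refine P.glue_cast _ _ _ _ _ _ _ _ (f.rest e)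
      ((f.h s.1).subtypeEquiv fun a => not_congr (f.h s.1).apply_eq_iff_eq.symm)
      ((f.h t.1).subtypeEquiv fun a => not_congr (f.h t.1).apply_eq_iff_eq.symm) ?_ ?_ ?_ _ _
    · rintro (_ | o) <;> rfl
    · rintro (_ | o) <;> rfl
    · rintro (o | o) <;> rfl

theorem merge_swap (G : Graph I) (e : G.E) {p : G.V → ℤ} (x : P.Dec G p)
    (s t : Σ v, G.H v) (c c' : Bool) (hs : s = G.att e c) (ht : t = G.att e (!c))
    (hs' : t = G.att e c') (ht' : s = G.att e (!c')) :
    P.merge G e s t c hs ht x = (open Classical in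
        if s.1 = t.1 then 1 else (p s.1 * p t.1).negOnePow) • P.merge G e t s c' hs' ht' x := by
  unfold merge
  by_cases h : s.1 = t.1
  · rw [dif_pos h, dif_pos h.symm, if_pos h, one_smul]
    obtain ⟨a, s⟩ := s
    obtain ⟨b, t⟩ := t
    dsimp only at h
    subst h
    refine P.selfGlue_symm ?_ _
    intro o
    have h1 := G.loopEquiv_spec e _ _ c hs ht rfl o
    have h2 := G.loopEquiv_spec e _ _ c' hs' ht' rfl (swapPts _ o)
    refine eq_of_heq (Sigma.mk.inj_iff.1 (h1.trans (Eq.trans ?_ h2.symm))).2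
    rcases o with _ | _ | m <;> rfl
  · rw [dif_neg h, dif_neg (Ne.symm h), if_neg h]
    exact P.glue_symm (by rintro (o | o) <;> rfl) _ _

end ModularData

namespace ModularData

variable {k : Type u} [Field k] {ε : ℤ} (P : ModularData.{u, w} k ε) {I J : Type}

/-! ### Multilinear forms on decorations -/

/-- A sign as an element of `k`. -/
abbrev sgn (k : Type u) [Field k] (s : ℤˣ) : k := ((s : ℤ) : k)

/-- For every graph with legs labelled by `I` and all degrees `p` of the decorations of its
vertices, a multilinear form on the decorations. The value of such a form on a decoration `x`
is the value on the tensor product of the decorations `x v`, in the order of the vertices. -/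
abbrev RawForms (P : ModularData.{u, w} k ε) (I : Type) : Type (max 1 u w) :=
  ∀ (G : Graph I) (p : G.V → ℤ),
    MultilinearMap k (fun v => P.obj (G.genus v) (G.H v) (p v)) k

/-- The forms on decorated graphs with edges of degree `δ` are natural if they are compatible with
all isomorphisms of graphs, up to the Koszul signs of reordering the edges and the vertices. -/
def IsNatural {P : ModularData.{u, w} k ε} (δ : ℤ) (φ : P.RawForms I) : Prop :=
  ∀ (G G' : Graph I) (f : Graph.Iso G G') (p : G.V → ℤ) (p' : G'.V → ℤ)
    (hp : ∀ u, p u = p' (f.v u)) (x : P.Dec G p) (x' : P.Dec G' p'), P.DecRel f hp x x' →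
    φ G' p' x' =
      sgn k (koszul G.rE (G'.rE ∘ f.e) (fun _ => δ) * koszul G.rV (G'.rV ∘ f.v) p) * φ G p x

/-- The part of degree `n` of the Feynman transform, at genus `g` and label set `I`. The elements are
the families `φ` of elements of `Det(E(G))^δ ⊗ P((G))^*` for all stable graphs `G` of genus
`g` with legs labelled by `I` which are invariant under all isomorphisms; here an edge has homological
degree `-δ`. (In characteristic `0` this is the direct sum over the isomorphism classes of
the coinvariants under `Aut(G)`.) -/
def Forms (P : ModularData.{u, w} k ε) (δ : ℤ) (g : ℕ) (I : Type) (n : ℤ) :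
    Submodule k (P.RawForms I) where
  carrier := {φ | (∀ G, ¬ G.IsStable g → φ G = 0) ∧
    (∀ G p, n + δ * Fintype.card G.E + ∑ v, p v ≠ 0 → φ G p = 0) ∧ IsNatural δ φ}
  zero_mem' := ⟨fun _ _ => rfl, fun _ _ _ => rfl, fun _ _ _ _ _ _ _ _ _ => by simp⟩
  add_mem' := by
    rintro a b ⟨ha, ha', ha''⟩ ⟨hb, hb', hb''⟩
    refine ⟨fun G hG => ?_, fun G p hp => ?_, fun G G' f p p' hp x x' hx => ?_⟩
    · rw [Pi.add_apply, ha G hG, hb G hG, add_zero]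
    · rw [Pi.add_apply, Pi.add_apply, ha' G p hp, hb' G p hp, add_zero]
    · simp only [Pi.add_apply, add_apply]
      rw [ha'' G G' f p p' hp x x' hx, hb'' G G' f p p' hp x x' hx, mul_add]
  smul_mem' := by
    rintro c a ⟨ha, ha', ha''⟩
    refine ⟨fun G hG => ?_, fun G p hp => ?_, fun G G' f p p' hp x x' hx => ?_⟩
    · rw [Pi.smul_apply, ha G hG, smul_zero]
    · rw [Pi.smul_apply, Pi.smul_apply, ha' G p hp, smul_zero]
    · simp only [Pi.smul_apply, smul_apply, smul_eq_mul]
      rw [ha'' G G' f p p' hp x x' hx, mul_left_comm]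

/-! ### The differential of the Feynman transform -/

/-- Lower the degree of the decoration of `v`. -/
noncomputable def lowerDeg {V : Type} (p : V → ℤ) (v : V) : V → ℤ := fun u =>
  open Classical in if u = v then p u - 1 else p u

theorem lowerDeg_self {V : Type} (p : V → ℤ) (v : V) : lowerDeg p v v + 1 = p v := by
  simp [lowerDeg]

theorem lowerDeg_ne {V : Type} (p : V → ℤ) {u v : V} (h : u ≠ v) : p u = lowerDeg p v u := by
  simp [lowerDeg, h]

/-- Apply the differential of `P` to the decoration of `v`. -/
noncomputable def dAt (G : Graph I) (p : G.V → ℤ) (v u : G.V) :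
    P.obj (G.genus u) (G.H u) (p u) →ₗ[k] P.obj (G.genus u) (G.H u) (lowerDeg p v u) :=
  open Classical in
  if h : u = v then P.d (by rw [h, lowerDeg_self])
  else P.cast rfl (lowerDeg_ne p h) (Equiv.refl _)

theorem merge_update_of_not_isEnd (G : Graph I) (e : G.E) (c : Bool) {p : G.V → ℤ}
    [DecidableEq G.V] (x : P.Dec G p) {u : G.V} (hu : ¬ G.IsEnd e u)
    (y : P.obj (G.genus u) (G.H u) (p u)) :
    P.merge G e (G.att e c) (G.att e (!c)) c rfl rfl (update x u y) =
      P.merge G e (G.att e c) (G.att e (!c)) c rfl rfl x := by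
  have h1 : (G.att e c).1 ≠ u := fun h => hu ⟨_, h⟩
  have h2 : (G.att e (!c)).1 ≠ u := fun h => hu ⟨_, h⟩
  unfold merge
  by_cases h : (G.att e c).1 = (G.att e (!c)).1
  · rw [dif_pos h, dif_pos h, update_of_ne h1]
  · rw [dif_neg h, dif_neg h, update_of_ne h1, update_of_ne h2]

theorem merge_update_add (G : Graph I) (e : G.E) (s t : Σ v, G.H v) (c : Bool)
    (hs : s = G.att e c) (ht : t = G.att e (!c)) {p : G.V → ℤ}
    [DecidableEq G.V] (x : P.Dec G p) {u : G.V} (hu : u = s.1 ∨ u = t.1)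
    (y z : P.obj (G.genus u) (G.H u) (p u)) :
    P.merge G e s t c hs ht (update x u (y + z)) = P.merge G e s t c hs ht (update x u y) +
      P.merge G e s t c hs ht (update x u z) := by
  by_cases h : s.1 = t.1
  · have hu' : u = s.1 := hu.elim id fun h' => h'.trans h.symm
    subst hu'
    simp only [merge, dif_pos h, update_self, map_add]
  · rcases hu with rfl | rfl
    · simp only [merge, dif_neg h, update_self, update_of_ne (Ne.symm h), map_add,
        LinearMap.add_apply]
    · simp only [merge, dif_neg h, update_self, update_of_ne h, map_add]

theorem merge_update_smul (G : Graph I) (e : G.E) (s t : Σ v, G.H v) (c : Bool)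
    (hs : s = G.att e c) (ht : t = G.att e (!c)) {p : G.V → ℤ}
    [DecidableEq G.V] (x : P.Dec G p) {u : G.V} (hu : u = s.1 ∨ u = t.1) (a : k)
    (y : P.obj (G.genus u) (G.H u) (p u)) :
    P.merge G e s t c hs ht (update x u (a • y)) =
      a • P.merge G e s t c hs ht (update x u y) := by
  by_cases h : s.1 = t.1
  · have hu' : u = s.1 := hu.elim id fun h' => h'.trans h.symm
    subst hu'
    simp only [merge, dif_pos h, update_self, map_smul]
  · rcases hu with rfl | rfl
    · simp only [merge, dif_neg h, update_self, update_of_ne (Ne.symm h), map_smul,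
        LinearMap.smul_apply]
    · simp only [merge, dif_neg h, update_self, update_of_ne h, map_smul]

theorem contractDec_update_of_not_isEnd (G : Graph I) (e : G.E) (c : Bool) {p : G.V → ℤ}
    [DecidableEq G.V] [DecidableEq (G.contract e).V] (x : P.Dec G p) {u : G.V}
    (hu : ¬ G.IsEnd e u) (y : P.obj (G.genus u) (G.H u) (p u)) :
    P.contractDec G e c (update x u y) =
      update (P.contractDec G e c x) (some ⟨u, hu⟩ : Option {v // ¬ G.IsEnd e v}) y := by
  refine eq_update_iff.2 ⟨update_self (β := fun v => P.obj (G.genus v) (G.H v) (p v)) u y x, ?_⟩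
  rintro (_ | w) hw
  · exact P.merge_update_of_not_isEnd G e c x hu y
  · exact update_of_ne (fun h' => hw (congrArg some (Subtype.ext h'))) _ _

theorem contractDec_update_of_isEnd (G : Graph I) (e : G.E) (c : Bool) {p : G.V → ℤ}
    [DecidableEq G.V] [DecidableEq (G.contract e).V] (x : P.Dec G p) {u : G.V}
    (hu : G.IsEnd e u) (y : P.obj (G.genus u) (G.H u) (p u)) :
    P.contractDec G e c (update x u y) =
      update (P.contractDec G e c x) (none : Option {v // ¬ G.IsEnd e v})
        (P.merge G e (G.att e c) (G.att e (!c)) c rfl rfl (update x u y)) := by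
  refine eq_update_iff.2 ⟨rfl, ?_⟩
  rintro (_ | w) hw
  · exact absurd rfl hw
  · have h : (w : G.V) ≠ u := fun h' => w.2 (h' ▸ hu)
    exact update_of_ne h _ _

/-- The form `x ↦ φ(G/e, x/e)`. -/
noncomputable def contractForm (φ : P.RawForms I) (G : Graph I) (e : G.E) (c : Bool)
    (p : G.V → ℤ) : MultilinearMap k (fun v => P.obj (G.genus v) (G.H v) (p v)) k where
  toFun x := φ (G.contract e) (G.contractDeg ε e p) (P.contractDec G e c x)
  map_update_add' := by
    classical
    intro _ x u y z
    by_cases hu : G.IsEnd e u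
    · rw [P.contractDec_update_of_isEnd G e c x hu, P.contractDec_update_of_isEnd G e c x hu,
        P.contractDec_update_of_isEnd G e c x hu,
        P.merge_update_add G e _ _ c rfl rfl x ((G.isEnd_iff e _ _ c rfl rfl u).1 hu)]
      exact (φ (G.contract e) _).map_update_add _
        (none : Option {v // ¬ G.IsEnd e v}) _ _
    · rw [P.contractDec_update_of_not_isEnd G e c x hu, P.contractDec_update_of_not_isEnd G e c x hu,
        P.contractDec_update_of_not_isEnd G e c x hu]
      exact (φ (G.contract e) _).map_update_add _
        (some ⟨u, hu⟩ : Option {v // ¬ G.IsEnd e v}) _ _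
  map_update_smul' := by
    classical
    intro _ x u a y
    by_cases hu : G.IsEnd e u
    · rw [P.contractDec_update_of_isEnd G e c x hu, P.contractDec_update_of_isEnd G e c x hu,
        P.merge_update_smul G e _ _ c rfl rfl x ((G.isEnd_iff e _ _ c rfl rfl u).1 hu)]
      exact (φ (G.contract e) _).map_update_smul _
        (none : Option {v // ¬ G.IsEnd e v}) _ _
    · rw [P.contractDec_update_of_not_isEnd G e c x hu, P.contractDec_update_of_not_isEnd G e c x hu]
      exact (φ (G.contract e) _).map_update_smul _
        (some ⟨u, hu⟩ : Option {v // ¬ G.IsEnd e v}) _ _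

/-- The sign of moving the edge `e` and the decorations of its ends (first the end of `(e, c)`)
to the left of all the other edges and decorations, respectively. -/
noncomputable def contractSign (δ : ℤ) (G : Graph I) (e : G.E) (c : Bool) (p : G.V → ℤ) : ℤˣ :=
  shuffle (· = e) G.rE (fun _ => δ) * shuffle (G.IsEnd e) G.rV p *
    (if G.rV (G.att e (!c)).1 < G.rV (G.att e c).1 then
      (p (G.att e c).1 * p (G.att e (!c)).1).negOnePow else 1)

/-- The contribution of an edge to the differential. -/
noncomputable def contractTerm (δ : ℤ) (φ : P.RawForms I) (G : Graph I) (e : G.E) (c : Bool)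
    (p : G.V → ℤ) : MultilinearMap k (fun v => P.obj (G.genus v) (G.H v) (p v)) k :=
  sgn k (contractSign δ G e c p) • P.contractForm φ G e c p

open Classical in
/-- The differential of the Feynman transform: the transpose of the differential of `P`
and of the structure maps `P((G)) → P((G/e))`, where `e` is put to the left of the other edges.
(The direction of `e` chosen here does not matter.) -/
noncomputable def dRaw (δ : ℤ) (g : ℕ) (φ : P.RawForms I) : P.RawForms I := fun G p =>
  if G.IsStable g then
    sgn k (δ * Fintype.card G.E).negOnePow •
      ∑ v, sgn k (∑ u with G.rV u < G.rV v, p u).negOnePow •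
        (φ G (lowerDeg p v)).compLinearMap (P.dAt G p v) +
    ∑ e, P.contractTerm δ φ G e false p
  else 0

end ModularData

theorem units_mul_cancel_aux {a b c d : ℤˣ} (h : a * b = c * d) : a * c = b * d := by
  have h1 := Int.units_mul_self b
  have h2 := Int.units_mul_self c
  calc a * c = a * b * (b * c) := by rw [mul_assoc, ← mul_assoc b, h1, one_mul]
    _ = c * c * (b * d) := by rw [h]; ac_rfl
    _ = b * d := by rw [h2, one_mul]

theorem sgn_mul {k : Type u} [Field k] (a b : ℤˣ) :
    ModularData.sgn k (a * b) = ModularData.sgn k a * ModularData.sgn k b := by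
  simp [ModularData.sgn]

theorem units_smul_eq {k : Type u} [Field k] {M : Type w} [AddCommGroup M] [Module k M] (a : ℤˣ)
    (x : M) : a • x = ModularData.sgn k a • x := by
  rw [ModularData.sgn, Units.smul_def, Int.cast_smul_eq_zsmul]

theorem shuffle_singleton {X : Type} [Fintype X] [DecidableEq X] (v : X) (r : X → ℕ) (p : X → ℤ) :
    shuffle (· = v) r p = ∏ u with r u < r v, (p v * p u).negOnePow := by
  have h : shuffle (· = v) r p =
      ∏ᶠ b : {b // ¬ b = v}, if r b.1 < r v then (p v * p b.1).negOnePow else 1 :=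
    finprod_eq_of_bijective (fun x : {a // a = v} × {b // ¬ b = v} => x.2)
      ⟨fun x y h => Prod.ext (Subsingleton.elim _ _) h, fun y => ⟨(⟨v, rfl⟩, y), rfl⟩⟩
      (by rintro ⟨⟨a, rfl⟩, b⟩; rfl)
  rw [h, finprod_eq_prod_of_fintype, Finset.prod_filter,
    ← Fintype.prod_subtype_mul_prod_subtype (fun u => u = v)]
  refine (one_mul _).symm.trans (congrArg (· * _) ?_)
  refine (Finset.prod_eq_one ?_).symm
  rintro ⟨a, rfl⟩ -
  simp

theorem shuffle_lowerDeg {X : Type} [Fintype X] (v : X) (r : X → ℕ) (p : X → ℤ) :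
    (∑ u with r u < r v, p u).negOnePow =
      shuffle (· = v) r p * shuffle (· = v) r (ModularData.lowerDeg p v) := by
  classical
  rw [shuffle_singleton, shuffle_singleton, ← Finset.prod_mul_distrib]
  have h : ∀ s : Finset X, (∑ u ∈ s, p u).negOnePow = ∏ u ∈ s, (p u).negOnePow := by
    intro s
    induction s using Finset.induction_on with
    | empty => simp
    | insert a s ha ih => rw [Finset.sum_insert ha, Finset.prod_insert ha, Int.negOnePow_add, ih]
  rw [h]
  refine Finset.prod_congr rfl fun u hu => ?_
  have hne : u ≠ v := by
    rintro rfl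
    simp at hu
  rw [← ModularData.lowerDeg_ne p hne, ← Int.negOnePow_add, Int.negOnePow_eq_iff]
  have := ModularData.lowerDeg_self p v
  rw [← this]
  exact ⟨- (ModularData.lowerDeg p v v * p u), by ring⟩

theorem koszul_lowerDeg {X : Type} [Fintype X] (v : X) (r r' : X → ℕ) (hr : Injective r)
    (hr' : Injective r') (p : X → ℤ) :
    (∑ u with r' u < r' v, p u).negOnePow * koszul r r' (ModularData.lowerDeg p v) =
      koszul r r' p * (∑ u with r u < r v, p u).negOnePow := by
  have h1 := koszul_shuffle (· = v) r r' hr hr' p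
  have h2 := koszul_shuffle (· = v) r r' hr hr' (ModularData.lowerDeg p v)
  have e : koszul (fun a : {a // ¬ a = v} => r a) (fun a => r' a)
      (fun a => ModularData.lowerDeg p v a) =
      koszul (fun a : {a // ¬ a = v} => r a) (fun a => r' a) (fun a => p a) :=
    koszul_congr_deg _ _ _ _ fun x => (ModularData.lowerDeg_ne p x.2).symm
  rw [koszul_subsingleton (X := {a // a = v}), mul_one] at h1 h2
  rw [e] at h2
  have h3 := units_mul_cancel_aux h1
  have h4 := units_mul_cancel_aux (h2.trans (mul_comm _ _))
  have h5 := units_mul_cancel_aux h2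
  rw [shuffle_lowerDeg, shuffle_lowerDeg, ← mul_assoc, h3]
  calc _ = shuffle (· = v) r' p * (koszul r r' (ModularData.lowerDeg p v) *
        shuffle (· = v) r' (ModularData.lowerDeg p v)) := by ac_rfl
    _ = _ := by rw [h2]; ac_rfl

theorem koszul_pair {X : Type} [Finite X] (a b : X) (h : ∀ x, x = a ∨ x = b) (r r' : X → ℕ)
    (hr : Injective r) (hr' : Injective r') (p : X → ℤ) :
    koszul r r' p * (if r' b < r' a then (p a * p b).negOnePow else 1) =
      if r b < r a then (p a * p b).negOnePow else 1 := by
  by_cases hab : a = b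
  · subst hab
    have : Subsingleton X := ⟨fun x y => by
      rw [(h x).elim id id, (h y).elim id id]⟩
    simp [koszul_subsingleton]
  have key : ∀ r : X → ℕ, shuffle (· = a) r p = if r b < r a then (p a * p b).negOnePow else 1 := by
    intro r
    let : Unique {x // ¬ x = a} :=
      { default := ⟨b, Ne.symm hab⟩
        uniq := fun x => Subtype.ext ((h x.1).resolve_left x.2) }
    let : Unique ({x // x = a} × {x // ¬ x = a}) :=
      { default := (⟨a, rfl⟩, default)
        uniq := fun x => Prod.ext (Subsingleton.elim _ _) (Subsingleton.elim _ _) }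
    exact (finprod_unique _).trans rfl
  have h1 := koszul_shuffle (· = a) r r' hr hr' p
  have : Subsingleton {x // ¬ x = a} := ⟨fun x y => Subtype.ext
    (((h x.1).resolve_left x.2).trans ((h y.1).resolve_left y.2).symm)⟩
  rw [koszul_subsingleton (X := {x // x = a}), koszul_subsingleton (X := {x // ¬ x = a}), mul_one,
    mul_one, key, key] at h1
  exact h1

namespace ModularData

variable {k : Type u} [Field k] {ε : ℤ} (P : ModularData.{u, w} k ε) {I J : Type}

theorem decRel_dAt {G G' : Graph I} (f : Graph.Iso G G') {p : G.V → ℤ} {p' : G'.V → ℤ}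
    (hp : ∀ u, p u = p' (f.v u)) {x : P.Dec G p} {x' : P.Dec G' p'} (hx : P.DecRel f hp x x')
    (v : G.V) (hq : ∀ u, lowerDeg p v u = lowerDeg p' (f.v v) (f.v u)) :
    P.DecRel f hq (fun u => P.dAt G p v u (x u)) (fun u => P.dAt G' p' (f.v v) u (x' u)) := by
  intro u
  dsimp only
  unfold dAt
  by_cases h : u = v
  · subst h
    rw [dif_pos rfl, dif_pos rfl, hx]
    exact P.d_cast _ _ _ _ _ _ _
  · have h' : ¬ f.v u = f.v v := fun h' => h (f.v.injective h')
    rw [dif_neg h, dif_neg h', hx, cast_trans, cast_trans]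
    rfl

theorem decRel_contract {G G' : Graph I} (f : Graph.Iso G G') (e : G.E) {p : G.V → ℤ}
    {p' : G'.V → ℤ} (hp : ∀ u, p u = p' (f.v u)) {x : P.Dec G p} {x' : P.Dec G' p'}
    (hx : P.DecRel f hp x x') (c : Bool) :
    P.DecRel (f.contract e) (contractDeg_iso (ε := ε) f e hp) (P.contractDec G e c x)
      (P.contractDec G' (f.e e) (xor (f.flip e) c) x')
  | none => P.merge_iso f e hp hx _ _ c rfl rfl _ _ _ rfl rfl (f.sig_att e c).symm
      (by rw [← Bool.xor_not, f.sig_att])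
  | some u => hx u

variable (δ : ℤ)

theorem contractTerm_swap (φ : P.RawForms I) (G : Graph I) (e : G.E) (c : Bool)
    (p : G.V → ℤ) (x : P.Dec G p) :
    P.contractTerm δ φ G e (!c) p x = P.contractTerm δ φ G e c p x := by
  classical
  let s : ℤˣ := if (G.att e (!c)).1 = (G.att e c).1 then 1
    else (p (G.att e (!c)).1 * p (G.att e c).1).negOnePow
  have h1 : P.contractDec G e (!c) x = update (P.contractDec G e c x)
      (none : Option {v // ¬ G.IsEnd e v}) (sgn k s • P.contractDec G e c x none) := by
    refine eq_update_iff.2 ⟨?_, ?_⟩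
    · rw [← units_smul_eq]
      have := P.merge_swap G e x (G.att e (!c)) (G.att e c) (!c) c rfl (by simp) rfl rfl
      refine Eq.trans ?_ (this.trans ?_)
      · change P.merge G e _ (G.att e (!(!c))) (!c) _ _ x = _
        congr 2; simp
      · rfl
    · rintro (_ | w) hw
      · exact absurd rfl hw
      · rfl
  have h2 : φ (G.contract e) (G.contractDeg ε e p) (P.contractDec G e (!c) x) =
      sgn k s * φ (G.contract e) (G.contractDeg ε e p) (P.contractDec G e c x) := by
    rw [h1]
    refine ((φ (G.contract e) _).map_update_smul _
      (none : Option {v // ¬ G.IsEnd e v}) _ _).trans ?_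
    rw [smul_eq_mul]
    congr 2
    exact update_eq_self _ _
  have h3 : contractSign δ G e (!c) p * s = contractSign δ G e c p := by
    unfold contractSign
    rw [mul_assoc]
    congr 1
    simp only [Bool.not_not]
    by_cases h : (G.att e (!c)).1 = (G.att e c).1
    · simp [s, h]
    · have h' : G.rV (G.att e (!c)).1 ≠ G.rV (G.att e c).1 := fun h' => h (G.rV.injective h')
      simp only [s, if_neg h]
      rcases lt_or_gt_of_ne h' with h' | h'
      · simp [h', h'.not_gt, mul_comm]
      · simp [h', h'.not_gt]
  change sgn k _ • φ _ _ _ = sgn k _ • φ _ _ _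
  rw [h2, smul_eq_mul, smul_eq_mul, ← mul_assoc, ← sgn_mul, h3]

theorem contractSign_iso {G G' : Graph I} (f : Graph.Iso G G') (e : G.E) {p : G.V → ℤ}
    {p' : G'.V → ℤ} (hp : ∀ u, p u = p' (f.v u)) (c : Bool) :
    contractSign δ G' (f.e e) (xor (f.flip e) c) p' *
        (koszul (G.contract e).rE ((G'.contract (f.e e)).rE ∘ (f.contract e).e) (fun _ => δ) *
          koszul (G.contract e).rV ((G'.contract (f.e e)).rV ∘ (f.contract e).v)
            (G.contractDeg ε e p)) =
      koszul G.rE (G'.rE ∘ f.e) (fun _ => δ) * koszul G.rV (G'.rV ∘ f.v) p *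
        contractSign δ G e c p := by
  have hp' : p = p' ∘ f.v := funext hp
  have hE := koszul_shuffle (· = e) G.rE (G'.rE ∘ f.e) G.rE.injective
    (G'.rE.injective.comp f.e.injective) (fun _ => δ)
  have hE' : shuffle (· = e) (G'.rE ∘ f.e) (fun _ => δ) =
      shuffle (· = f.e e) G'.rE (fun _ => δ) :=
    shuffle_equiv f.e (· = e) (· = f.e e) (fun _ => f.e.apply_eq_iff_eq.symm) G'.rE (fun _ => δ)
  rw [koszul_subsingleton (X := {a // a = e}), mul_one, hE'] at hE
  have hV := koszul_shuffle (G.IsEnd e) G.rV (G'.rV ∘ f.v) G.rV.injective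
    (G'.rV.injective.comp f.v.injective) p
  have hV' : shuffle (G.IsEnd e) (G'.rV ∘ f.v) p =
      shuffle (G'.IsEnd (f.e e)) G'.rV p' := by
    rw [hp']
    exact shuffle_equiv f.v _ _ (fun v => f.isEnd e v) _ _
  rw [hV'] at hV
  have hP := koszul_pair (X := {a // G.IsEnd e a}) ⟨(G.att e c).1, ⟨c, rfl⟩⟩
    ⟨(G.att e (!c)).1, ⟨!c, rfl⟩⟩ (fun x => by
      refine ((G.isEnd_iff e _ _ c rfl rfl x).1 x.2).imp Subtype.ext Subtype.ext)
    (fun a => G.rV a) (fun a => G'.rV (f.v a)) (G.rV.injective.comp Subtype.val_injective)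
    ((G'.rV.injective.comp f.v.injective).comp Subtype.val_injective) (fun a => p a)
  have hK : koszul (G.contract e).rV ((G'.contract (f.e e)).rV ∘ (f.contract e).v)
      (G.contractDeg ε e p) =
      koszul (fun a : {a // ¬ G.IsEnd e a} => G.rV a) (fun a => G'.rV (f.v a)) (fun a => p a) := by
    have h1 : (G'.contract (f.e e)).rV ∘ (f.contract e).v =
        consRank ⟨fun a : {a // ¬ G.IsEnd e a} => G'.rV (f.v a),
          (G'.rV.injective.comp f.v.injective).comp Subtype.val_injective⟩ := by
      funext w
      rcases w with _ | w <;> rfl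
    rw [h1]
    exact koszul_consRank _ _ _
  have hL : koszul (G.contract e).rE ((G'.contract (f.e e)).rE ∘ (f.contract e).e) (fun _ => δ) =
      koszul (fun a : {a // ¬ a = e} => G.rE a) (fun a => G'.rE (f.e a)) (fun _ => δ) := rfl
  have e1 := f.end_eq e c
  have e2 : (G'.att (f.e e) (!(xor (f.flip e) c))).1 = f.v (G.att e (!c)).1 := by
    rw [← Bool.xor_not]; exact f.end_eq e (!c)
  rw [hK, hL]
  unfold contractSign
  rw [e1, e2, ← hp, ← hp]
  dsimp only at hP
  simp only [comp_def] at hE hV ⊢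
  rw [← hP]
  generalize koszul (fun a : {a // G.IsEnd e a} => G.rV a) (fun a => G'.rV (f.v a))
    (fun a => p a) = k1 at *
  generalize koszul (fun a : {a // ¬ G.IsEnd e a} => G.rV a) (fun a => G'.rV (f.v a))
    (fun a => p a) = k2 at *
  generalize koszul (fun a : {a // ¬ a = e} => G.rE a) (fun a => G'.rE (f.e a)) (fun _ => δ) = k3
    at *
  generalize (if G'.rV (f.v (G.att e (!c)).1) < G'.rV (f.v (G.att e c).1) then
    (p (G.att e c).1 * p (G.att e (!c)).1).negOnePow else 1) = k4
  calc _ = (shuffle (· = f.e e) G'.rE fun _ => δ) * k3 *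
        (shuffle (G'.IsEnd (f.e e)) G'.rV p' * k2) * k4 := by ac_rfl
    _ = _ := ?_
  have h1 := units_mul_cancel_aux hE
  have h2 := units_mul_cancel_aux (hV.trans (mul_assoc _ _ _))
  rw [← h1]
  calc _ = (koszul (fun x => G.rE x) (fun x => G'.rE (f.e x)) fun _ => δ) *
        (shuffle (· = e) G.rE fun _ => δ) * (shuffle (G'.IsEnd (f.e e)) G'.rV p' * (k1 * k2)) *
        (k1 * k4) := by
        have h3 : k2 = k1 * k2 * k1 := by
          rw [mul_comm k1, mul_assoc, Int.units_mul_self, mul_one]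
        conv_lhs => rw [h3]
        ac_rfl
    _ = _ := by rw [← h2]; ac_rfl

theorem contractTerm_iso {φ : P.RawForms I} (hφ : IsNatural δ φ) {G G' : Graph I}
    (f : Graph.Iso G G') (e : G.E) {p : G.V → ℤ} {p' : G'.V → ℤ} (hp : ∀ u, p u = p' (f.v u))
    {x : P.Dec G p} {x' : P.Dec G' p'} (hx : P.DecRel f hp x x') (c c' : Bool) :
    P.contractTerm δ φ G' (f.e e) c' p' x' =
      sgn k (koszul G.rE (G'.rE ∘ f.e) (fun _ => δ) * koszul G.rV (G'.rV ∘ f.v) p) *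
        P.contractTerm δ φ G e c p x := by
  have h0 : P.contractTerm δ φ G' (f.e e) c' p' x' =
      P.contractTerm δ φ G' (f.e e) (xor (f.flip e) c) p' x' := by
    by_cases h : c' = xor (f.flip e) c
    · rw [h]
    · rw [show c' = !(xor (f.flip e) c) by
        revert h; cases c' <;> cases (xor (f.flip e) c) <;> simp, contractTerm_swap]
  rw [h0]
  have h1 := hφ _ _ (f.contract e) _ _ (contractDeg_iso (ε := ε) f e hp) _ _
    (P.decRel_contract f e hp hx c)
  change sgn k _ • φ _ _ _ = _ * (sgn k _ • φ _ _ _)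
  rw [h1, smul_eq_mul, smul_eq_mul, ← mul_assoc, ← mul_assoc, ← sgn_mul, ← sgn_mul,
    contractSign_iso δ f e hp c]

end ModularData

namespace ModularData

variable {k : Type u} [Field k] {ε : ℤ} (P : ModularData.{u, w} k ε) {I J : Type}

theorem sum_lowerDeg {V : Type} [Fintype V] (p : V → ℤ) (v : V) :
    ∑ u, lowerDeg p v u + 1 = ∑ u, p u := by
  classical
  rw [← Finset.add_sum_erase _ _ (Finset.mem_univ v), ← Finset.add_sum_erase _ p (Finset.mem_univ v),
    ← lowerDeg_self p v, add_right_comm]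
  congr 1
  exact Finset.sum_congr rfl fun u hu => (lowerDeg_ne p (Finset.ne_of_mem_erase hu)).symm

theorem sum_contractDeg (G : Graph I) (e : G.E) (p : G.V → ℤ) :
    ∑ w : (G.contract e).V, G.contractDeg ε e p w + ε = ∑ v, p v := by
  classical
  have h0 : (G.contract e).finV = (inferInstance : Fintype (Option {v // ¬ G.IsEnd e v})) :=
    Subsingleton.elim _ _
  have h1 : ∑ w : (G.contract e).V, G.contractDeg ε e p w = G.contractDeg ε e p none +
      ∑ v : {v // ¬ G.IsEnd e v}, p v :=
    (Finset.sum_congr (congrArg (@Finset.univ _) h0) fun _ _ => rfl).trans (Fintype.sum_option _)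
  rw [← Fintype.sum_subtype_add_sum_subtype (G.IsEnd e), h1, add_right_comm]
  congr 1
  have hv := fun x : {a // G.IsEnd e a} => (G.isEnd_iff e _ _ false rfl rfl x.1).1 x.2
  by_cases h : (G.att e false).1 = (G.att e (!false)).1
  · rw [G.deg_loop ε e _ _ false rfl rfl h]
    let : Unique {a // G.IsEnd e a} :=
      { default := ⟨_, false, rfl⟩
        uniq := fun x => Subtype.ext ((hv x).elim id fun h' => h'.trans h.symm) }
    exact (Fintype.sum_unique fun x : {a // G.IsEnd e a} => p x).symm
  · rw [G.deg_glue ε e _ _ false rfl rfl h]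
    refine (Fintype.sum_eq_add (f := fun x : {a // G.IsEnd e a} => p x) (⟨_, false, rfl⟩ : {a // G.IsEnd e a}) ⟨_, !false, rfl⟩
      (fun h' => h (congrArg Subtype.val h')) ?_).symm
    intro x hx
    rcases hv x with h' | h'
    · exact absurd (Subtype.ext h') hx.1
    · exact absurd (Subtype.ext h') hx.2

theorem dRaw_apply (δ : ℤ) {g : ℕ} (φ : P.RawForms I) {G : Graph I} (hG : G.IsStable g)
    (p : G.V → ℤ) (x : P.Dec G p) :
    P.dRaw δ g φ G p x = sgn k (δ * Fintype.card G.E).negOnePow *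
      ∑ v, sgn k (∑ u with G.rV u < G.rV v, p u).negOnePow *
        φ G (lowerDeg p v) (fun u => P.dAt G p v u (x u)) +
      ∑ e, P.contractTerm δ φ G e false p x := by
  simp [dRaw, hG]

theorem dRaw_mem {δ : ℤ} (hεδ : ε + δ = 1) {g : ℕ} {n m : ℤ} (h : m + 1 = n) {φ : P.RawForms I}
    (hφ : φ ∈ P.Forms δ g I n) : P.dRaw δ g φ ∈ P.Forms δ g I m := by
  obtain ⟨-, h2, h3⟩ := hφ
  refine ⟨fun G hG => funext fun p => if_neg hG, fun G p hp => ?_, ?_⟩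
  · by_cases hG : G.IsStable g
    · ext x
      rw [dRaw_apply _ _ _ hG, zero_apply]
      have e1 : ∀ v, φ G (lowerDeg p v) = 0 := fun v => h2 G _ (by
        have := sum_lowerDeg p v
        omega)
      have e2 : ∀ e, φ (G.contract e) (G.contractDeg ε e p) = 0 := fun e => h2 _ _ (by
        classical
        have a1 := sum_contractDeg (ε := ε) G e p
        have a2 : Fintype.card (G.contract e).E + 1 = Fintype.card G.E := by
          have : Fintype.card (G.contract e).E = Fintype.card {e' // e' ≠ e} :=
            Fintype.card_congr (Equiv.refl _)
          rw [this, Fintype.card_subtype_compl, Fintype.card_subtype_eq]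
          have : 0 < Fintype.card G.E := Fintype.card_pos_iff.2 ⟨e⟩
          omega
        intro h0
        apply hp
        rw [← a2]
        push_cast
        linear_combination h0 + h - a1 + hεδ)
      have e3 : ∀ e, P.contractTerm δ φ G e false p x = 0 := fun e => by
        change sgn k _ • φ _ _ _ = _
        rw [e2 e]; simp
      simp [e1, e3]
    · exact if_neg hG
  · intro G G' f p p' hp x x' hx
    by_cases hG : G.IsStable g
    · have hG' := (f.isStable g).1 hG
      rw [dRaw_apply _ _ _ hG, dRaw_apply _ _ _ hG', mul_add]
      have hE : Fintype.card G.E = Fintype.card G'.E := Fintype.card_congr f.e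
      congr 1
      · rw [hE, mul_left_comm]
        congr 1
        rw [Finset.mul_sum]
        refine (Fintype.sum_equiv f.v _ _ fun v => ?_).symm
        have hq : ∀ u, lowerDeg p v u = lowerDeg p' (f.v v) (f.v u) := by
          intro u
          by_cases h' : u = v
          · simp [lowerDeg, hp, h']
          · simp [lowerDeg, hp, h']
        rw [h3 G G' f _ _ hq _ _ (P.decRel_dAt f hp hx v hq), ← mul_assoc, ← mul_assoc, ← sgn_mul,
          ← sgn_mul]
        have hs : ∑ u with G'.rV u < G'.rV (f.v v), p' u =
            ∑ u with (G'.rV ∘ f.v) u < (G'.rV ∘ f.v) v, p u := by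
          rw [Finset.sum_filter, Finset.sum_filter]
          refine (Fintype.sum_equiv f.v _ _ fun u => ?_).symm
          simp [hp]
        have := koszul_lowerDeg v G.rV (G'.rV ∘ f.v) G.rV.injective
          (G'.rV.injective.comp f.v.injective) p
        rw [hs, mul_left_comm, this, mul_assoc]
      · rw [Finset.mul_sum]
        refine (Fintype.sum_equiv f.e _ _ fun e => ?_).symm
        exact (P.contractTerm_iso δ h3 f e hp hx _ _).symm
    · have hG' := fun h => hG ((f.isStable g).2 h)
      rw [show P.dRaw δ g φ G p = 0 from if_neg hG, show P.dRaw δ g φ G' p' = 0 from if_neg hG']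
      simp

theorem contractTerm_add (δ : ℤ) (φ ψ : P.RawForms I) (G : Graph I) (e : G.E) (c : Bool)
    (p : G.V → ℤ) (x : P.Dec G p) : P.contractTerm δ (φ + ψ) G e c p x =
      P.contractTerm δ φ G e c p x + P.contractTerm δ ψ G e c p x :=
  mul_add _ _ _

theorem contractTerm_smul (δ : ℤ) (a : k) (φ : P.RawForms I) (G : Graph I) (e : G.E) (c : Bool)
    (p : G.V → ℤ) (x : P.Dec G p) : P.contractTerm δ (a • φ) G e c p x =
      a * P.contractTerm δ φ G e c p x :=
  mul_left_comm _ _ _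

/-- The differential of the Feynman transform. -/
noncomputable def dForms {δ : ℤ} (hεδ : ε + δ = 1) {g : ℕ} {n m : ℤ} (h : m + 1 = n) :
    P.Forms δ g I n →ₗ[k] P.Forms δ g I m where
  toFun φ := ⟨P.dRaw δ g φ.1, P.dRaw_mem hεδ h φ.2⟩
  map_add' φ ψ := by
    refine Subtype.ext (funext fun G => funext fun p => MultilinearMap.ext fun x => ?_)
    by_cases hG : G.IsStable g
    · change P.dRaw δ g (φ.1 + ψ.1) G p x = P.dRaw δ g φ.1 G p x + P.dRaw δ g ψ.1 G p x
      simp only [dRaw_apply _ _ _ hG, contractTerm_add, Pi.add_apply, add_apply, mul_add,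
        Finset.sum_add_distrib]
      abel
    · change P.dRaw δ g (φ.1 + ψ.1) G p x = P.dRaw δ g φ.1 G p x + P.dRaw δ g ψ.1 G p x
      simp [dRaw, hG]
  map_smul' a φ := by
    refine Subtype.ext (funext fun G => funext fun p => MultilinearMap.ext fun x => ?_)
    by_cases hG : G.IsStable g
    · change P.dRaw δ g (a • φ.1) G p x = a * P.dRaw δ g φ.1 G p x
      simp only [dRaw_apply _ _ _ hG, contractTerm_smul, Pi.smul_apply, smul_apply, smul_eq_mul,
        mul_add, Finset.mul_sum, mul_left_comm a]
    · change P.dRaw δ g (a • φ.1) G p x = a * P.dRaw δ g φ.1 G p x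
      simp [dRaw, hG]

/-- The relabelling of a family of forms. -/
def mapRaw (f : I ≃ J) (φ : P.RawForms I) : P.RawForms J := fun G p => φ (G.relabel f.symm) p

theorem mapRaw_mem {δ : ℤ} {g : ℕ} {n : ℤ} (f : I ≃ J) {φ : P.RawForms I}
    (hφ : φ ∈ P.Forms δ g I n) : P.mapRaw f φ ∈ P.Forms δ g J n :=
  ⟨fun G hG => funext fun p => congrFun (hφ.1 (G.relabel f.symm) hG) p,
    fun G p hp => hφ.2.1 (G.relabel f.symm) p hp,
    fun G G' a p p' hp x x' hx => hφ.2.2 (G.relabel f.symm) (G'.relabel f.symm)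
      (a.relabel f.symm) p p' hp x x' hx⟩

/-- The relabelling maps of the Feynman transform. -/
def mapForms {δ : ℤ} {g : ℕ} {n : ℤ} (f : I ≃ J) : P.Forms δ g I n →ₗ[k] P.Forms δ g J n where
  toFun φ := ⟨P.mapRaw f φ.1, P.mapRaw_mem f φ.2⟩
  map_add' _ _ := rfl
  map_smul' _ _ := rfl

end ModularData

/-! ### Composition: grafting along an edge -/

namespace Graph

variable {L K : Type}

/-- The edge `e` is the only one between a vertex in `U` and a vertex outside `U`, its half in `U` is
`(e, c)`, and the legs at the vertices in `U` are those labelled by the image of the injection `j`. -/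
structure Cut (G : Graph L) (U : G.V → Prop) (j : K → L) (e : G.E) (c : Bool) : Prop where
  inj : Injective j
  fst : U (G.att e c).1
  snd : ¬ U (G.att e (!c)).1
  other : ∀ e', e' ≠ e → (U (G.att e' false).1 ↔ U (G.att e' true).1)
  legs : ∀ l, U (G.leg l).1 ↔ l ∈ Set.range j

/-- The edges other than `e` between vertices in `U`. -/
abbrev SideE (G : Graph L) (U : G.V → Prop) (e : G.E) : Type :=
  {e' : {e' // e' ≠ e} // U (G.att e'.1 false).1}

/-- The half-edges at the vertices in `U`, as half-edges of the graph. -/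
def sideIncl (G : Graph L) (U : G.V → Prop) (s : Σ v : {v // U v}, G.H v) : Σ v, G.H v :=
  ⟨s.1, s.2⟩

/-- The legs and edges of the part of the graph at `U`: the new leg `none` is the half-edge
`(e, c)`. -/
def sideLegs (G : Graph L) (U : G.V → Prop) (j : K → L) (e : G.E) (c : Bool) :
    Option K ⊕ G.SideE U e × Bool → L ⊕ G.E × Bool
  | .inl none => .inr (e, c)
  | .inl (some a) => .inl (j a)
  | .inr (e', b) => .inr (e'.1, b)

theorem sideIncl_injective (G : Graph L) (U : G.V → Prop) : Injective (G.sideIncl U) := by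
  rintro ⟨⟨v, hv⟩, s⟩ ⟨⟨v', hv'⟩, s'⟩ h
  obtain rfl : v = v' := congrArg Sigma.fst h
  cases h
  rfl

theorem sideLegs_injective (G : Graph L) (U : G.V → Prop) {j : K → L} (hj : Injective j) (e : G.E)
    (c : Bool) : Injective (G.sideLegs U j e c) := by
  rintro ((_ | a) | ⟨⟨⟨a, ha⟩, ha'⟩, b⟩) ((_ | a') | ⟨⟨⟨a', hb⟩, hb'⟩, b'⟩) h <;>
    simp only [sideLegs, Sum.inr.injEq, Sum.inl.injEq, Prod.mk.injEq, reduceCtorEq] at h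
  · rfl
  · exact absurd h.1.symm hb
  · rw [hj h]
  · exact absurd h.1 ha
  · obtain ⟨rfl, rfl⟩ := h
    rfl

theorem side_range (G : Graph L) {U : G.V → Prop} {j : K → L} {e : G.E} {c : Bool}
    (h : G.Cut U j e c) (s : Σ v, G.H v) :
    s ∈ Set.range (G.sideIncl U) ↔ G.inc s ∈ Set.range (G.sideLegs U j e c) := by
  have h1 : s ∈ Set.range (G.sideIncl U) ↔ U s.1 := by
    constructor
    · rintro ⟨t, rfl⟩; exact t.1.2
    · exact fun hs => ⟨⟨⟨s.1, hs⟩, s.2⟩, rfl⟩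
  rw [h1]
  obtain ⟨t, rfl⟩ := G.inc.symm.surjective s
  rw [Equiv.apply_symm_apply]
  rcases t with l | ⟨e', b⟩
  · refine (h.legs l).trans ⟨?_, ?_⟩
    · rintro ⟨a, rfl⟩; exact ⟨.inl (some a), rfl⟩
    · rintro ⟨(_ | a) | ⟨a, b⟩, ha⟩ <;>
        simp only [sideLegs, Sum.inl.injEq, reduceCtorEq] at ha
      exact ⟨a, ha⟩
  · change U (G.att e' b).1 ↔ _
    constructor
    · intro hU
      by_cases he : e' = e
      · subst he
        obtain rfl : b = c := by
          by_contra hb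
          rw [show b = !c by revert hb; cases b <;> cases c <;> simp] at hU
          exact h.snd hU
        exact ⟨.inl none, rfl⟩
      · have : U (G.att e' false).1 := by
          cases b
          · exact hU
          · exact (h.other e' he).2 hU
        exact ⟨.inr (⟨⟨e', he⟩, this⟩, b), rfl⟩
    · rintro ⟨(_ | a) | ⟨⟨⟨a, ha⟩, ha'⟩, b'⟩, hx⟩ <;>
        simp only [sideLegs, Sum.inr.injEq, Prod.mk.injEq, reduceCtorEq] at hx
      · obtain ⟨rfl, rfl⟩ := hx
        exact h.fst
      · obtain ⟨rfl, rfl⟩ := hx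
        cases b'
        · exact ha'
        · exact (h.other a ha).1 ha'

/-- The part of a graph at the vertices in `U`, when the graph is cut along an edge. -/
noncomputable def side (G : Graph L) {U : G.V → Prop} {j : K → L} {e : G.E} {c : Bool}
    (h : G.Cut U j e c) : Graph (Option K) where
  V := {v // U v}
  E := G.SideE U e
  H v := G.H v
  finV := Fintype.ofFinite _
  finE := Fintype.ofFinite _
  genus v := G.genus v
  inc := liftEquiv (G.sideIncl U) (G.sideLegs U j e c) G.inc (G.sideIncl_injective U)
    (G.sideLegs_injective U h.inj e c) (G.side_range h)
  rV := (Embedding.subtype _).trans G.rV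
  rE := ((Embedding.subtype _).trans (Embedding.subtype _)).trans G.rE

theorem side_inc (G : Graph L) {U : G.V → Prop} {j : K → L} {e : G.E} {c : Bool}
    (h : G.Cut U j e c) (s : Σ v : {v // U v}, G.H v) :
    G.sideLegs U j e c ((G.side h).inc s) = G.inc (G.sideIncl U s) :=
  liftEquiv_spec ..

namespace Iso

variable {G G' : Graph L} (f : Iso G G')

theorem leg_eq (l : L) : (G'.leg l).1 = f.v (G.leg l).1 := by
  rw [← f.sig_leg]; rfl

theorem cut {U : G.V → Prop} {U' : G'.V → Prop} (hU : ∀ v, U v ↔ U' (f.v v)) (j : K → L)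
    (e : G.E) (c : Bool) : G.Cut U j e c ↔ G'.Cut U' j (f.e e) (xor (f.flip e) c) := by
  have h1 : U (G.att e c).1 ↔ U' (G'.att (f.e e) (xor (f.flip e) c)).1 := by
    rw [hU, f.end_eq]
  have h2 : U (G.att e (!c)).1 ↔ U' (G'.att (f.e e) (!(xor (f.flip e) c))).1 := by
    rw [hU, ← Bool.xor_not, f.end_eq]
  have h3 : ∀ e', (U (G.att e' false).1 ↔ U (G.att e' true).1) ↔
      (U' (G'.att (f.e e') false).1 ↔ U' (G'.att (f.e e') true).1) := by
    intro e'
    rw [hU, hU, ← f.end_eq, ← f.end_eq]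
    cases f.flip e'
    · exact Iff.rfl
    · exact ⟨Iff.symm, Iff.symm⟩
  have h4 : ∀ l, U (G.leg l).1 ↔ U' (G'.leg l).1 := fun l => by rw [hU, f.leg_eq]
  constructor
  · intro h
    refine ⟨h.inj, h1.1 h.fst, fun hs => h.snd (h2.2 hs), fun e' he => ?_,
      fun l => (h4 l).symm.trans (h.legs l)⟩
    obtain ⟨e', rfl⟩ := f.e.surjective e'
    exact (h3 e').1 (h.other e' fun he' => he (by rw [he']))
  · intro h
    exact ⟨h.inj, h1.2 h.fst, fun hs => h.snd (h2.1 hs),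
      fun e' he => (h3 e').2 (h.other _ fun he' => he (f.e.injective he')),
      fun l => (h4 l).trans (h.legs l)⟩

theorem sideE {U : G.V → Prop} {U' : G'.V → Prop} (hU : ∀ v, U v ↔ U' (f.v v)) {j : K → L}
    {e : G.E} {c : Bool} (h : G.Cut U j e c) (e' : {e' // e' ≠ e}) :
    U (G.att e'.1 false).1 ↔ U' (G'.att (f.e e'.1) false).1 := by
  have h1 : ∀ b, U (G.att e'.1 b).1 ↔ U' (G'.att (f.e e'.1) (xor (f.flip e'.1) b)).1 := by
    intro b
    rw [hU, f.end_eq]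
  cases hf : f.flip e'.1
  · have := h1 false
    rwa [hf] at this
  · have := h1 true
    rw [hf] at this
    exact (h.other _ e'.2).trans this

/-- The isomorphism between the parts of isomorphic graphs. -/
noncomputable def side {U : G.V → Prop} {U' : G'.V → Prop} (hU : ∀ v, U v ↔ U' (f.v v))
    {j : K → L} {e : G.E} {c c' : Bool} (h : G.Cut U j e c) (h' : G'.Cut U' j (f.e e) c')
    (hc : c' = xor (f.flip e) c) : Iso (G.side h) (G'.side h') where
  v := f.v.subtypeEquiv hU
  e := (f.e.subtypeEquiv fun e' => not_congr f.e.apply_eq_iff_eq.symm).subtypeEquiv (f.sideE hU h)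
  h u := f.h u.1
  flip e' := f.flip e'.1.1
  genus u := f.genus u.1
  inc s := by
    apply G'.sideLegs_injective U' h.inj (f.e e) c'
    have h1 := G.side_inc h s
    refine (G'.side_inc h' _).trans ?_
    refine (f.inc_sig (G.sideIncl U s)).trans ?_
    rw [← h1]
    generalize (G.side h).inc s = t
    subst hc
    rcases t with (_ | a) | ⟨e', b⟩ <;> rfl

end Iso

end Graph

namespace ModularData

variable {k : Type u} [Field k] {ε : ℤ} (P : ModularData.{u, w} k ε) {I J : Type}

theorem restrict_update_pos {V : Type} [DecidableEq V] {M : V → Type w} (U : V → Prop)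
    [DecidableEq {v // U v}] (x : ∀ v, M v) {u : V} (hu : U u) (y : M u) :
    (fun v : {v // U v} => update x u y v.1) =
      update (fun v : {v // U v} => x v.1) ⟨u, hu⟩ y :=
  eq_update_iff.2 ⟨update_self _ _ _, fun _ hv => update_of_ne (fun h => hv (Subtype.ext h)) _ _⟩

theorem restrict_update_neg {V : Type} [DecidableEq V] {M : V → Type w} (U : V → Prop)
    (x : ∀ v, M v) {u : V} (hu : ¬ U u) (y : M u) :
    (fun v : {v // U v} => update x u y v.1) = fun v : {v // U v} => x v.1 :=
  funext fun v => update_of_ne (show v.1 ≠ u from fun h => hu (h ▸ v.2)) _ _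

/-- The product of a form in the variables in `U` and a form in the other variables. -/
def mulForms {V : Type} {M : V → Type w} [∀ v, AddCommGroup (M v)] [∀ v, Module k (M v)]
    (U : V → Prop) (A : MultilinearMap k (fun v : {v // U v} => M v) k)
    (B : MultilinearMap k (fun v : {v // ¬ U v} => M v) k) : MultilinearMap k M k where
  toFun x := A (fun v => x v.1) * B (fun v => x v.1)
  map_update_add' := by
    classical
    intro _ x u y z
    by_cases hu : U u
    · have hu' : ¬ ¬ U u := fun h => h hu
      simp only [restrict_update_pos U x hu, restrict_update_neg (fun v => ¬ U v) x hu',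
        A.map_update_add, add_mul]
    · simp only [restrict_update_neg U x hu, restrict_update_pos (fun v => ¬ U v) x hu,
        B.map_update_add, mul_add]
  map_update_smul' := by
    classical
    intro _ x u a y
    by_cases hu : U u
    · have hu' : ¬ ¬ U u := fun h => h hu
      simp only [restrict_update_pos U x hu, restrict_update_neg (fun v => ¬ U v) x hu',
        A.map_update_smul, smul_mul_assoc]
    · simp only [restrict_update_neg U x hu, restrict_update_pos (fun v => ¬ U v) x hu,
        B.map_update_smul, mul_smul_comm]

open Classical in
/-- The sign of reordering the edges of `G` into `e`, the other edges at `U`, the remaining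
edges, and the vertices into those in `U` and the others, and of moving the edges of the second part
past the form on the first part. -/
noncomputable def cutSign (δ : ℤ) (G : Graph I) (U : G.V → Prop) (e : G.E) (p : G.V → ℤ) : ℤˣ :=
  shuffle (· = e) G.rE (fun _ => δ) *
    shuffle (fun e' : {e' // e' ≠ e} => U (G.att e'.1 false).1) (fun e' => G.rE e') (fun _ => δ) *
    shuffle U G.rV p *
    (δ * Fintype.card {e' : {e' // e' ≠ e} // ¬ U (G.att e'.1 false).1} *
      ∑ v : {v // U v}, p v).negOnePow

open Classical in
/-- The contribution of one way of cutting `G` along an edge into two parts, with the legs `I` and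
`J`, respectively, to the composition. -/
noncomputable def cutTerm (δ : ℤ) (φ : P.RawForms (Option I)) (ψ : P.RawForms (Option J))
    (G : Graph (I ⊕ J)) (p : G.V → ℤ) (U : Set G.V) (e : G.E) (c : Bool) :
    MultilinearMap k (fun v => P.obj (G.genus v) (G.H v) (p v)) k :=
  if h : G.Cut (· ∈ U) Sum.inl e c ∧ G.Cut (fun v => ¬ v ∈ U) Sum.inr e (!c) then
    sgn k (cutSign δ G (· ∈ U) e p) •
      mulForms (· ∈ U) (φ (G.side h.1) fun v => p v.1) (ψ (G.side h.2) fun v => p v.1)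
  else 0

/-- The composition of the Feynman transform: grafting along a new edge, put to the left of the
others. The value on `G` is the sum over all the ways of cutting `G` into two parts. -/
noncomputable def compRaw (δ : ℤ) (g : ℕ) (φ : P.RawForms (Option I))
    (ψ : P.RawForms (Option J)) : P.RawForms (I ⊕ J) := fun G p =>
  open Classical in
  if G.IsStable g then ∑ U : Set G.V, ∑ e : G.E, ∑ c : Bool, P.cutTerm δ φ ψ G p U e c else 0

end ModularData

namespace ModularData

variable {k : Type u} [Field k] {ε : ℤ} (P : ModularData.{u, w} k ε) {I J : Type}

theorem cutTerm_pos (δ : ℤ) (φ : P.RawForms (Option I)) (ψ : P.RawForms (Option J))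
    (G : Graph (I ⊕ J)) (p : G.V → ℤ) (U : Set G.V) (e : G.E) (c : Bool)
    (h₁ : G.Cut (· ∈ U) Sum.inl e c) (h₂ : G.Cut (fun v => ¬ v ∈ U) Sum.inr e (!c))
    (x : P.Dec G p) :
    P.cutTerm δ φ ψ G p U e c x = sgn k (cutSign δ G (· ∈ U) e p) *
      (φ (G.side h₁) (fun v => p v.1) (fun v => x v.1) *
        ψ (G.side h₂) (fun v => p v.1) (fun v => x v.1)) := by
  have h : P.cutTerm δ φ ψ G p U e c = sgn k (cutSign δ G (· ∈ U) e p) •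
      mulForms (· ∈ U) (φ (G.side h₁) fun v => p v.1) (ψ (G.side h₂) fun v => p v.1) :=
    dif_pos ⟨h₁, h₂⟩
  rw [h]
  rfl

theorem cutTerm_neg (δ : ℤ) (φ : P.RawForms (Option I)) (ψ : P.RawForms (Option J))
    (G : Graph (I ⊕ J)) (p : G.V → ℤ) (U : Set G.V) (e : G.E) (c : Bool)
    (h : ¬ (G.Cut (· ∈ U) Sum.inl e c ∧ G.Cut (fun v => ¬ v ∈ U) Sum.inr e (!c))) :
    P.cutTerm δ φ ψ G p U e c = 0 := dif_neg h

theorem compRaw_apply (δ : ℤ) {g : ℕ} (φ : P.RawForms (Option I)) (ψ : P.RawForms (Option J))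
    {G : Graph (I ⊕ J)} (hG : G.IsStable g) (p : G.V → ℤ) (x : P.Dec G p) :
    P.compRaw δ g φ ψ G p x = ∑ U : Set G.V, ∑ e : G.E, ∑ c : Bool,
      P.cutTerm δ φ ψ G p U e c x := by
  unfold compRaw
  rw [if_pos hG]
  simp only [sum_apply]

theorem units_mul_aux {a a' b k₀ c c' b₁ b₂ s s' t t₁ t₂ : ℤˣ} (h1 : b * a = a' * k₀)
    (h2 : k₀ * c = c' * (b₁ * b₂)) (h3 : t * s = s' * (t₁ * t₂)) (m : ℤˣ) :
    a' * c' * s' * m * (b₁ * t₁) * (b₂ * t₂) = b * t * (a * c * s * m) :=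
  calc _ = a' * (c' * (b₁ * b₂)) * (s' * (t₁ * t₂)) * m := by ac_rfl
    _ = (a' * k₀) * c * (t * s) * m := by rw [← h2, ← h3]; ac_rfl
    _ = _ := by rw [← h1]; ac_rfl

theorem cutSign_iso (δ : ℤ) {L : Type} {G G' : Graph L} (f : Graph.Iso G G') {p : G.V → ℤ}
    {p' : G'.V → ℤ} (hp : ∀ u, p u = p' (f.v u)) {U : G.V → Prop} {U' : G'.V → Prop}
    (hU : ∀ v, U v ↔ U' (f.v v)) {e : G.E} 
    (hE : ∀ e' : {e' // e' ≠ e}, U (G.att e'.1 false).1 ↔ U' (G'.att (f.e e'.1) false).1) :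
    cutSign δ G' U' (f.e e) p' *
        (koszul (fun a : G.SideE U e => G.rE a.1) (fun a => G'.rE (f.e a.1)) (fun _ => δ) *
          koszul (fun v : {v // U v} => G.rV v) (fun v => G'.rV (f.v v)) (fun v => p v)) *
        (koszul (fun a : G.SideE (fun v => ¬ U v) e => G.rE a.1) (fun a => G'.rE (f.e a.1))
            (fun _ => δ) *
          koszul (fun v : {v // ¬ U v} => G.rV v) (fun v => G'.rV (f.v v)) (fun v => p v)) =
      koszul G.rE (G'.rE ∘ f.e) (fun _ => δ) * koszul G.rV (G'.rV ∘ f.v) p *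
        cutSign δ G U e p := by
  classical
  have hp' : p = p' ∘ f.v := funext hp
  have hA := koszul_shuffle (· = e) G.rE (G'.rE ∘ f.e) G.rE.injective
    (G'.rE.injective.comp f.e.injective) (fun _ => δ)
  have hA' : shuffle (· = e) (G'.rE ∘ f.e) (fun _ => δ) =
      shuffle (· = f.e e) G'.rE (fun _ => δ) :=
    shuffle_equiv f.e (· = e) (· = f.e e) (fun _ => f.e.apply_eq_iff_eq.symm) G'.rE (fun _ => δ)
  rw [koszul_subsingleton (X := {a // a = e}), mul_one, hA'] at hA
  have hB := koszul_shuffle (fun e' : {e' // ¬ e' = e} => U (G.att e'.1 false).1)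
    (fun a => G.rE a) (fun a => G'.rE (f.e a)) (G.rE.injective.comp Subtype.val_injective)
    ((G'.rE.injective.comp f.e.injective).comp Subtype.val_injective) (fun _ => δ)
  let fE : {e' // ¬ e' = e} ≃ {e' // ¬ e' = f.e e} :=
    f.e.subtypeEquiv fun e' => not_congr f.e.apply_eq_iff_eq.symm
  have hB' : shuffle (fun e' : {e' // ¬ e' = e} => U (G.att e'.1 false).1)
      (fun a => G'.rE (f.e a)) (fun _ => δ) =
      shuffle (fun e' : {e' // ¬ e' = f.e e} => U' (G'.att e'.1 false).1) (fun a => G'.rE a)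
        (fun _ => δ) :=
    shuffle_equiv fE (fun e' => U (G.att e'.1 false).1) (fun e' => U' (G'.att e'.1 false).1)
      hE (fun a => G'.rE a) (fun _ => δ)
  rw [hB'] at hB
  have hV := koszul_shuffle U G.rV (G'.rV ∘ f.v) G.rV.injective
    (G'.rV.injective.comp f.v.injective) p
  have hV' : shuffle U (G'.rV ∘ f.v) p = shuffle U' G'.rV p' := by
    rw [hp']
    exact shuffle_equiv f.v _ _ hU _ _
  rw [hV'] at hV
  have hc : Fintype.card {e' : {e' // e' ≠ e} // ¬ U (G.att e'.1 false).1} =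
      Fintype.card {e' : {e' // e' ≠ f.e e} // ¬ U' (G'.att e'.1 false).1} :=
    Fintype.card_congr (fE.subtypeEquiv fun a => not_congr (hE a))
  have hs : ∑ v : {v // U v}, p v = ∑ v : {v // U' v}, p' v :=
    Fintype.sum_equiv (f.v.subtypeEquiv hU) _ _ fun v => hp v
  unfold cutSign
  rw [hc, hs]
  simp only [comp_def, ne_eq] at hA hB hV ⊢
  generalize koszul (fun a : {a // ¬ a = e} => G.rE a) (fun a => G'.rE (f.e a)) (fun _ => δ) = k0
    at *
  have h1 := units_mul_cancel_aux hA
  have h2 := units_mul_cancel_aux (hB.trans (mul_assoc _ _ _))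
  have h3 := units_mul_cancel_aux (hV.trans (mul_assoc _ _ _))
  exact units_mul_aux h1 h2 h3 _

theorem sgn_mul_aux {s a b t c : ℤˣ} (h : s * a * b = t * c) (x y : k) :
    sgn k s * (sgn k a * x * (sgn k b * y)) = sgn k t * (sgn k c * (x * y)) := by
  have h' := congrArg (sgn k) h
  rw [sgn_mul, sgn_mul, sgn_mul] at h'
  linear_combination (x * y) * h'

theorem cutTerm_iso {δ : ℤ} {φ : P.RawForms (Option I)} {ψ : P.RawForms (Option J)}
    (hφ : IsNatural δ φ) (hψ : IsNatural δ ψ) {G G' : Graph (I ⊕ J)} (f : Graph.Iso G G')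
    {p : G.V → ℤ} {p' : G'.V → ℤ} (hp : ∀ u, p u = p' (f.v u)) {x : P.Dec G p} {x' : P.Dec G' p'}
    (hx : P.DecRel f hp x x') (U : Set G.V) (U' : Set G'.V) (hU : ∀ v, v ∈ U ↔ f.v v ∈ U')
    (e : G.E) (c : Bool) :
    P.cutTerm δ φ ψ G' p' U' (f.e e) (xor (f.flip e) c) x' =
      sgn k (koszul G.rE (G'.rE ∘ f.e) (fun _ => δ) * koszul G.rV (G'.rV ∘ f.v) p) *
        P.cutTerm δ φ ψ G p U e c x := by
  have hU' : ∀ v, (¬ v ∈ U) ↔ ¬ f.v v ∈ U' := fun v => not_congr (hU v)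
  have c1 : G.Cut (· ∈ U) (Sum.inl : I → I ⊕ J) e c ↔
      G'.Cut (· ∈ U') Sum.inl (f.e e) (xor (f.flip e) c) := f.cut hU Sum.inl e c
  have c2 : G.Cut (fun v => ¬ v ∈ U) (Sum.inr : J → I ⊕ J) e (!c) ↔
      G'.Cut (fun v => ¬ v ∈ U') Sum.inr (f.e e) (!(xor (f.flip e) c)) := by
    rw [← Bool.xor_not]
    exact f.cut hU' Sum.inr e (!c)
  by_cases h : G.Cut (· ∈ U) Sum.inl e c ∧ G.Cut (fun v => ¬ v ∈ U) Sum.inr e (!c)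
  · obtain ⟨h1, h2⟩ := h
    have h1' := c1.1 h1
    have h2' := c2.1 h2
    rw [P.cutTerm_pos δ φ ψ G p U e c h1 h2 x, P.cutTerm_pos δ φ ψ G' p' U' _ _ h1' h2' x']
    have n1 := hφ _ _ (f.side hU h1 h1' rfl) (fun v => p v.1) (fun v => p' v.1)
      (fun v => hp v.1) (fun v => x v.1) (fun v => x' v.1) (fun v => hx v.1)
    have n2 := hψ _ _ (f.side hU' h2 h2' (by rw [← Bool.xor_not])) (fun v => p v.1)
      (fun v => p' v.1) (fun v => hp v.1) (fun v => x v.1) (fun v => x' v.1) (fun v => hx v.1)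
    rw [n1, n2]
    exact sgn_mul_aux (cutSign_iso δ f hp hU (f.sideE hU h1)) _ _
  · rw [P.cutTerm_neg δ φ ψ G p U e c h,
      P.cutTerm_neg δ φ ψ G' p' U' _ _ (fun h' => h ⟨c1.2 h'.1, c2.2 h'.2⟩)]
    simp

/-- The involution of `Bool` given by the flip of an edge. -/
def xorEquiv (b : Bool) : Bool ≃ Bool where
  toFun c := xor b c
  invFun c := xor b c
  left_inv c := by simp
  right_inv c := by simp

theorem sum_inst {X : Type} (a b : Fintype X) (f : X → ℤ) :
    ∑ x ∈ @Finset.univ X a, f x = ∑ x ∈ @Finset.univ X b, f x := by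
  rw [Subsingleton.elim a b]

theorem compRaw_mem {δ : ℤ} {g₁ g₂ g : ℕ} {p_ q r : ℤ} (hr : r + δ = p_ + q)
    {φ : P.RawForms (Option I)} {ψ : P.RawForms (Option J)} (hφ : φ ∈ P.Forms δ g₁ (Option I) p_)
    (hψ : ψ ∈ P.Forms δ g₂ (Option J) q) : P.compRaw δ g φ ψ ∈ P.Forms δ g (I ⊕ J) r := by
  classical
  refine ⟨fun G hG => funext fun p => if_neg hG, fun G p hp => ?_, ?_⟩
  · by_cases hG : G.IsStable g
    · ext x
      rw [compRaw_apply _ _ _ _ hG, zero_apply]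
      refine Finset.sum_eq_zero fun U _ => Finset.sum_eq_zero fun e _ =>
        Finset.sum_eq_zero fun c _ => ?_
      by_cases h : G.Cut (· ∈ U) Sum.inl e c ∧ G.Cut (fun v => ¬ v ∈ U) Sum.inr e (!c)
      · obtain ⟨h1, h2⟩ := h
        rw [P.cutTerm_pos δ φ ψ G p U e c h1 h2 x]
        have d1 := hφ.2.1 (G.side h1) fun v => p v.1
        have d2 := hψ.2.1 (G.side h2) fun v => p v.1
        have s1 : ∑ v : (G.side h1).V, p v.1 = ∑ v : {v // v ∈ U}, p v :=
          sum_inst _ _ _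
        have s2 : ∑ v : (G.side h2).V, p v.1 = ∑ v : {v // ¬ v ∈ U}, p v :=
          sum_inst _ _ _
        have s3 := Fintype.sum_subtype_add_sum_subtype (· ∈ U) p
        have s4 : Fintype.card (G.side h1).E + Fintype.card (G.side h2).E + 1 =
            Fintype.card G.E := by
          rw [← Fintype.card_sum, ← Fintype.card_option]
          refine Fintype.card_congr (Equiv.trans ?_ (Equiv.optionSubtypeNe e))
          exact (Equiv.sumCompl fun e' : {e' // e' ≠ e} => (G.att e'.1 false).1 ∈ U).optionCongr
        rw [s1] at d1
        rw [s2] at d2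
        by_cases z1 : p_ + δ * Fintype.card (G.side h1).E + ∑ v : {v // v ∈ U}, p v = 0
        · by_cases z2 : q + δ * Fintype.card (G.side h2).E + ∑ v : {v // ¬ v ∈ U}, p v = 0
          · refine absurd ?_ hp
            rw [← s4, ← s3]
            push_cast
            linear_combination z1 + z2 + hr
          · have y : ψ (G.side h2) (fun v => p v.1) (fun v => x v.1) = 0 := by
              rw [d2 z2]; rfl
            rw [y, mul_zero, mul_zero]
        · have y : φ (G.side h1) (fun v => p v.1) (fun v => x v.1) = 0 := by
            rw [d1 z1]; rfl
          rw [y, zero_mul, mul_zero]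
      · rw [P.cutTerm_neg δ φ ψ G p U e c h, zero_apply]
    · exact if_neg hG
  · intro G G' f p p' hp x x' hx
    by_cases hG : G.IsStable g
    · have hG' := (f.isStable g).1 hG
      rw [compRaw_apply _ _ _ _ hG, compRaw_apply _ _ _ _ hG', Finset.mul_sum]
      refine (Fintype.sum_equiv (Equiv.Set.congr f.v) _ _ fun U => ?_).symm
      rw [Finset.mul_sum]
      refine Fintype.sum_equiv f.e _ _ fun e => ?_
      rw [Finset.mul_sum]
      refine Fintype.sum_equiv (xorEquiv (f.flip e)) _ _ fun c => ?_
      exact (P.cutTerm_iso hφ.2.2 hψ.2.2 f hp hx U _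
        (fun v => (f.v.injective.mem_set_image).symm) e c).symm
    · have hG' := fun h => hG ((f.isStable g).2 h)
      rw [show P.compRaw δ g φ ψ G p = 0 from if_neg hG,
        show P.compRaw δ g φ ψ G' p' = 0 from if_neg hG']
      simp

end ModularData

namespace ModularData

variable {k : Type u} [Field k] {ε : ℤ} (P : ModularData.{u, w} k ε) {I J : Type}

theorem cutTerm_add_left (δ : ℤ) (φ φ' : P.RawForms (Option I)) (ψ : P.RawForms (Option J))
    (G : Graph (I ⊕ J)) (p : G.V → ℤ) (U : Set G.V) (e : G.E) (c : Bool) (x : P.Dec G p) :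
    P.cutTerm δ (φ + φ') ψ G p U e c x =
      P.cutTerm δ φ ψ G p U e c x + P.cutTerm δ φ' ψ G p U e c x := by
  by_cases h : G.Cut (· ∈ U) Sum.inl e c ∧ G.Cut (fun v => ¬ v ∈ U) Sum.inr e (!c)
  · simp only [P.cutTerm_pos δ _ _ G p U e c h.1 h.2]
    rw [← mul_add, ← add_mul]
    rfl
  · simp only [P.cutTerm_neg δ _ _ G p U e c h, zero_apply, add_zero]

theorem cutTerm_add_right (δ : ℤ) (φ : P.RawForms (Option I)) (ψ ψ' : P.RawForms (Option J))
    (G : Graph (I ⊕ J)) (p : G.V → ℤ) (U : Set G.V) (e : G.E) (c : Bool) (x : P.Dec G p) :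
    P.cutTerm δ φ (ψ + ψ') G p U e c x =
      P.cutTerm δ φ ψ G p U e c x + P.cutTerm δ φ ψ' G p U e c x := by
  by_cases h : G.Cut (· ∈ U) Sum.inl e c ∧ G.Cut (fun v => ¬ v ∈ U) Sum.inr e (!c)
  · simp only [P.cutTerm_pos δ _ _ G p U e c h.1 h.2]
    rw [← mul_add, ← mul_add]
    rfl
  · simp only [P.cutTerm_neg δ _ _ G p U e c h, zero_apply, add_zero]

theorem cutTerm_smul_left (δ : ℤ) (a : k) (φ : P.RawForms (Option I)) (ψ : P.RawForms (Option J))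
    (G : Graph (I ⊕ J)) (p : G.V → ℤ) (U : Set G.V) (e : G.E) (c : Bool) (x : P.Dec G p) :
    P.cutTerm δ (a • φ) ψ G p U e c x = a * P.cutTerm δ φ ψ G p U e c x := by
  by_cases h : G.Cut (· ∈ U) Sum.inl e c ∧ G.Cut (fun v => ¬ v ∈ U) Sum.inr e (!c)
  · simp only [P.cutTerm_pos δ _ _ G p U e c h.1 h.2]
    exact (congrArg (_ * ·) (mul_assoc _ _ _)).trans (mul_left_comm _ _ _)
  · simp only [P.cutTerm_neg δ _ _ G p U e c h, zero_apply, mul_zero]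

theorem cutTerm_smul_right (δ : ℤ) (a : k) (φ : P.RawForms (Option I)) (ψ : P.RawForms (Option J))
    (G : Graph (I ⊕ J)) (p : G.V → ℤ) (U : Set G.V) (e : G.E) (c : Bool) (x : P.Dec G p) :
    P.cutTerm δ φ (a • ψ) G p U e c x = a * P.cutTerm δ φ ψ G p U e c x := by
  by_cases h : G.Cut (· ∈ U) Sum.inl e c ∧ G.Cut (fun v => ¬ v ∈ U) Sum.inr e (!c)
  · simp only [P.cutTerm_pos δ _ _ G p U e c h.1 h.2]
    exact (congrArg (_ * ·) (mul_left_comm _ _ _)).trans (mul_left_comm _ _ _)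
  · simp only [P.cutTerm_neg δ _ _ G p U e c h, zero_apply, mul_zero]

theorem forms_ext {δ : ℤ} {g : ℕ} {n : ℤ} {φ ψ : P.Forms δ g I n}
    (h : ∀ G, G.IsStable g → ∀ p x, φ.1 G p x = ψ.1 G p x) : φ = ψ := by
  refine Subtype.ext (funext fun G => ?_)
  by_cases hG : G.IsStable g
  · exact funext fun p => MultilinearMap.ext fun x => h G hG p x
  · rw [φ.2.1 G hG, ψ.2.1 G hG]

/-- The composition of the Feynman transform. -/
noncomputable def compForms {δ : ℤ} (g₁ g₂ g : ℕ) {p q r : ℤ} (hr : r + δ = p + q) :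
    P.Forms δ g₁ (Option I) p →ₗ[k] P.Forms δ g₂ (Option J) q →ₗ[k] P.Forms δ g (I ⊕ J) r :=
  LinearMap.mk₂ k (fun φ ψ => ⟨P.compRaw δ g φ.1 ψ.1, P.compRaw_mem hr φ.2 ψ.2⟩)
    (fun φ φ' ψ => P.forms_ext fun G hG p x => by
      change P.compRaw δ g (φ.1 + φ'.1) ψ.1 G p x =
        P.compRaw δ g φ.1 ψ.1 G p x + P.compRaw δ g φ'.1 ψ.1 G p x
      simp only [compRaw_apply _ _ _ _ hG, cutTerm_add_left, Finset.sum_add_distrib])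
    (fun a φ ψ => P.forms_ext fun G hG p x => by
      change P.compRaw δ g (a • φ.1) ψ.1 G p x = a * P.compRaw δ g φ.1 ψ.1 G p x
      simp only [compRaw_apply _ _ _ _ hG, cutTerm_smul_left, Finset.mul_sum])
    (fun φ ψ ψ' => P.forms_ext fun G hG p x => by
      change P.compRaw δ g φ.1 (ψ.1 + ψ'.1) G p x =
        P.compRaw δ g φ.1 ψ.1 G p x + P.compRaw δ g φ.1 ψ'.1 G p x
      simp only [compRaw_apply _ _ _ _ hG, cutTerm_add_right, Finset.sum_add_distrib])
    (fun a φ ψ => P.forms_ext fun G hG p x => by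
      change P.compRaw δ g φ.1 (a • ψ.1) G p x = a * P.compRaw δ g φ.1 ψ.1 G p x
      simp only [compRaw_apply _ _ _ _ hG, cutTerm_smul_right, Finset.mul_sum])

end ModularData

/-! ### The Feynman transform, its cyclic part, and the dg dual -/

/-- Genus-graded chain complexes with relabelling maps and compositions: the part of the data of a
(twisted) modular operad that is left if the self-gluings, which raise the genus, are forgotten. -/
structure GenusData (k : Type u) [Field k] (δ : ℤ) where
  obj : ℕ → Type → ℤ → Type w
  [acg : ∀ g I n, AddCommGroup (obj g I n)]
  [mod : ∀ g I n, Module k (obj g I n)]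
  d : ∀ {g : ℕ} {I : Type} {n m : ℤ}, m + 1 = n → (obj g I n →ₗ[k] obj g I m)
  map : ∀ {g : ℕ} {I J : Type} {n : ℤ}, I ≃ J → (obj g I n →ₗ[k] obj g J n)
  comp : ∀ {g₁ g₂ g : ℕ} {I J : Type} [Finite I] [Finite J] {p q r : ℤ}, g₁ + g₂ = g →
    r + δ = p + q →
    (obj g₁ (Option I) p →ₗ[k] obj g₂ (Option J) q →ₗ[k] obj g (I ⊕ J) r)

attribute [instance] GenusData.acg GenusData.mod

/-- The cyclic part: the part of genus `0`. -/
def GenusData.cyc {k : Type u} [Field k] {δ : ℤ} (Q : GenusData.{u, w} k δ) :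
    CyclicData.{u, w} k δ where
  obj := Q.obj 0
  d := Q.d
  map := Q.map
  comp := Q.comp rfl

/-- The Feynman transform of `P`, which is twisted by the `ε`-th power of the dualizing cocycle.
The result is twisted by the `δ`-th power, `δ = 1 - ε`, so that its elements are families of elements
of `Det(E(G))^δ ⊗ P((G))^*`. The case `ε = 0`, `δ = 1` is the Feynman transform of a modular
operad with trivial cocycle. -/
noncomputable def ModularData.feynman {k : Type u} [Field k] {ε : ℤ} (P : ModularData.{u, w} k ε)
    (δ : ℤ) (hεδ : ε + δ = 1) : GenusData.{u, max 1 u w} k δ where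
  obj g I n := P.Forms δ g I n
  d h := P.dForms hεδ h
  map f := P.mapForms f
  comp {g₁ g₂ g} _ _ _ _ _ _ _ _ h := P.compForms g₁ g₂ g h

/-- The dg dual `DA` of a cyclic operad `A`: `(DA)(I)` is the sum over the trees `T` with legs
labelled by `I` of the duals of `(sA[-1])((T)) = (ΣsA)((T))`, without a twist. -/
noncomputable def CyclicOperad.dgDual {k : Type u} [Field k] (A : CyclicOperad.{u, w} k) :
    CyclicData.{u, max 1 u w} k 0 :=
  ((A.suspension.toDecoration (CyclicData.suspension_equivariant A.equivariant)).feynman 0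
    (by norm_num)).cyc

/-- `Cyc(F(Ã))`: the genus `0` part of the Feynman transform of the modular operad `Ã`. -/
noncomputable def CyclicOperad.cycFeynman {k : Type u} [Field k] (A : CyclicOperad.{u, w} k) :
    CyclicData.{u, max 1 u w} k 1 :=
  (A.toModular.feynman 1 (by norm_num)).cyc

/-- An isomorphism of (twisted) cyclic operads: isomorphisms of graded vector spaces that are compatible
with the differentials, the relabelling maps and the compositions. -/
structure CyclicData.Iso {k : Type u} [Field k] {δ : ℤ} (A B : CyclicData.{u, w} k δ) where
  equiv : ∀ (I : Type) [Finite I] (n : ℤ), A.obj I n ≃ₗ[k] B.obj I n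
  d : ∀ {I : Type} [Finite I] {n m : ℤ} (h : m + 1 = n) (x : A.obj I n),
    equiv I m (A.d h x) = B.d h (equiv I n x)
  map : ∀ {I J : Type} [Finite I] [Finite J] {n : ℤ} (f : I ≃ J) (x : A.obj I n),
    equiv J n (A.map f x) = B.map f (equiv I n x)
  comp : ∀ {I J : Type} [Finite I] [Finite J] {p q r : ℤ} (h : r + δ = p + q)
    (x : A.obj (Option I) p) (y : A.obj (Option J) q),
    equiv (I ⊕ J) r (A.comp h x y) = B.comp h (equiv (Option I) p x) (equiv (Option J) q y)

end CycFeyn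

/-! Compare both sides on a single tree. The left side has `Det(E) ⊗ A((T))^*`. The right side has
`Det⁻¹(k^I)`, shifted, tensored with the dual of the product over the vertices of `Det⁻¹(k^{H(v)}) ⊗
A(H(v))`, each factor shifted by 3. What has to be shown is that the one-dimensional spaces at the
vertices multiply to `Det(E)` times the determinant of the legs, up to shifts, by an isomorphism so
canonical that it respects tree isomorphisms, differentials and grafting.

Modulo 2 the shift by 3 is one odd symbol per vertex, and every half-edge is another odd symbol. A
tree has one vertex more than it has edges: once a root is chosen, every other vertex belongs to
exactly one edge. So the same odd symbols can be listed in two ways. Listed by vertices, each vertex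
is followed by its half-edges; this is the product over the vertices. Listed by edges, the legs come
first, then the root, then for every edge its vertex and its two halves. A block of three odd
symbols is odd, so permuting the edges produces exactly the sign of `Det(E)`, and permuting the legs
that of `Det(k^I)`. The comparison sign `Graph.Rooting.sign` is the sign of passing from one list to
the other.

The crux is that this sign does not depend on the root. Moving the root along an edge exchanges two
vertex symbols and also the two halves of that edge, which is an even permutation
(`Graph.Rooting.exists_move`, `Graph.IsStable.sign_eq`). That trees have exactly one rooting for
each root follows from connectedness and the Euler characteristic, which also forces all genus
labels to vanish.

The full comparison sign `Graph.Rooting.totalSign` has two more factors: `crossSign`, the Koszul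
sign of separating the shift symbols from the decorations, and `legSign`, a correction depending
only on the number of legs that composition requires. Its behaviour under isomorphisms
(`totalSign_map`), under the internal differential (`totalSign_lowerDeg`), under contraction of an
edge (`totalSign_contract`) and under cutting at an edge (`totalSign_cut`) gives the
compatibilities. As natural forms determine their values for all orders of the vertices and edges
from those for one order, contraction and cutting are computed only for orders in which the relevant
edge and vertices come first. -/

namespace CycFeyn

open Function

/-! ### The sign of reordering odd symbols -/

section Reorder

variable {X Y L L' L'' : Type} [LinearOrder L] [LinearOrder L'] [LinearOrder L'']

/-- The sign of reordering odd symbols `X` from the order given by the rank function `a` to the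
order given by `b`. -/
noncomputable def reorder (a : X → L) (b : X → L') : ℤˣ :=
  ∏ᶠ x : X × X, if a x.1 < a x.2 ∧ b x.2 < b x.1 then -1 else 1

/-- The sign of moving the symbols in `X` to the left of those in `Y`. -/
noncomputable def crossing (a : X ⊕ Y → L) : ℤˣ :=
  ∏ᶠ x : X × Y, if a (.inr x.2) < a (.inl x.1) then -1 else 1

theorem koszul_one (r r' : X → ℕ) : koszul r r' (fun _ => 1) = reorder r r' := by
  simp [koszul, reorder]

theorem reorder_symm (a : X → L) (b : X → L') : reorder a b = reorder b a :=
  finprod_eq_of_bijective Prod.swap Prod.swap_bijective fun x => by simp [and_comm]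

theorem reorder_self (a : X → L) : reorder a a = 1 :=
  finprod_eq_one_of_forall_eq_one fun _ => if_neg fun h => (h.1.trans h.2).false

theorem reorder_comp_equiv (e : X ≃ Y) (a : Y → L) (b : Y → L') :
    reorder (a ∘ e) (b ∘ e) = reorder a b :=
  finprod_eq_of_bijective _ (e.prodCongr e).bijective fun _ => rfl

theorem reorder_congr {M M' : Type} [LinearOrder M] [LinearOrder M'] {a : X → L} {b : X → L'}
    {a' : X → M} {b' : X → M'} (ha : ∀ x y, a x < a y ↔ a' x < a' y)
    (hb : ∀ x y, b x < b y ↔ b' x < b' y) : reorder a b = reorder a' b' := by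
  simp only [reorder, ha, hb]

/-- A pair is inverted between `a` and `c` exactly when it is inverted in one, but not both, of the
two intermediate steps. The factors are indexed by ordered pairs, so all three products are first
rewritten over the pairs that increase under `b`. -/
theorem reorder_trans [Finite X] {a : X → L} {b : X → L'} {c : X → L''} (ha : Injective a)
    (hb : Injective b) (hc : Injective c) : reorder a b * reorder b c = reorder a c := by
  classical
  have := Fintype.ofFinite X
  simp only [reorder, finprod_eq_prod_of_fintype]
  have h1 : (∏ x : X × X, if a x.1 < a x.2 ∧ b x.2 < b x.1 then (-1 : ℤˣ) else 1) =
      ∏ x : X × X, if b x.1 < b x.2 ∧ a x.2 < a x.1 then (-1 : ℤˣ) else 1 :=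
    Fintype.prod_equiv (Equiv.prodComm X X) _ _ fun x => by simp [and_comm]
  have h2 : (∏ x : X × X, if a x.1 < a x.2 ∧ c x.2 < c x.1 then (-1 : ℤˣ) else 1) =
      (∏ x : X × X, if b x.1 < b x.2 ∧ a x.1 < a x.2 ∧ c x.2 < c x.1 then (-1 : ℤˣ) else 1) *
      ∏ x : X × X, if b x.1 < b x.2 ∧ a x.2 < a x.1 ∧ c x.1 < c x.2 then (-1 : ℤˣ) else 1 := by
    have : (∏ x : X × X, if b x.1 < b x.2 ∧ a x.2 < a x.1 ∧ c x.1 < c x.2 then (-1 : ℤˣ) else 1) =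
        ∏ x : X × X, if b x.2 < b x.1 ∧ a x.1 < a x.2 ∧ c x.2 < c x.1 then (-1 : ℤˣ) else 1 :=
      Fintype.prod_equiv (Equiv.prodComm X X) _ _ fun x => if_congr Iff.rfl rfl rfl
    rw [this, ← Finset.prod_mul_distrib]
    refine Finset.prod_congr rfl fun x _ => ?_
    by_cases hx : x.1 = x.2
    · simp [hx]
    · rcases lt_or_gt_of_ne (hb.ne hx) with h | h <;> simp [h, h.not_gt]
  rw [h1, h2, ← Finset.prod_mul_distrib, ← Finset.prod_mul_distrib]
  refine Finset.prod_congr rfl fun x _ => ?_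
  by_cases hx : x.1 = x.2
  · simp [hx]
  · rcases lt_or_gt_of_ne (ha.ne hx) with h | h <;> rcases lt_or_gt_of_ne (hb.ne hx) with h' | h' <;>
      rcases lt_or_gt_of_ne (hc.ne hx) with h'' | h'' <;>
      simp [h, h.not_gt, h', h'.not_gt, h'', h''.not_gt]

/-- Pairs inside `X` and inside `Y` give the last two factors. A mixed pair is inverted exactly when
it contributes to one of the two crossings and not to the other. -/
theorem reorder_sum [Finite X] [Finite Y] {a : X ⊕ Y → L} {b : X ⊕ Y → L'} (ha : Injective a)
    (hb : Injective b) : reorder a b = crossing a * crossing b *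
      reorder (a ∘ Sum.inl) (b ∘ Sum.inl) * reorder (a ∘ Sum.inr) (b ∘ Sum.inr) := by
  classical
  have := Fintype.ofFinite X
  have := Fintype.ofFinite Y
  simp only [reorder, crossing, finprod_eq_prod_of_fintype, Fintype.prod_prod_type,
    Fintype.prod_sum_type, Finset.prod_mul_distrib, comp_apply]
  have key : (∏ x : X, ∏ y : Y, (if a (.inl x) < a (.inr y) ∧ b (.inr y) < b (.inl x) then
        (-1 : ℤˣ) else 1)) *
      (∏ y : Y, ∏ x : X, (if a (.inr y) < a (.inl x) ∧ b (.inl x) < b (.inr y) then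
        (-1 : ℤˣ) else 1)) =
      (∏ x : X, ∏ y : Y, if a (.inr y) < a (.inl x) then (-1 : ℤˣ) else 1) *
      (∏ x : X, ∏ y : Y, if b (.inr y) < b (.inl x) then (-1 : ℤˣ) else 1) := by
    rw [Finset.prod_comm (s := (Finset.univ : Finset Y)), ← Finset.prod_mul_distrib,
      ← Finset.prod_mul_distrib]
    refine Finset.prod_congr rfl fun x _ => ?_
    rw [← Finset.prod_mul_distrib, ← Finset.prod_mul_distrib]
    refine Finset.prod_congr rfl fun y _ => ?_
    have h1 : a (.inl x) ≠ a (.inr y) := fun h => by cases ha h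
    have h2 : b (.inl x) ≠ b (.inr y) := fun h => by cases hb h
    rcases lt_or_gt_of_ne h1 with h1 | h1 <;> rcases lt_or_gt_of_ne h2 with h2 | h2 <;>
      simp [h1, h2, h1.not_gt, h2.not_gt]
  rw [← key]
  generalize (∏ x : X, ∏ y : Y, _ : ℤˣ) = t1
  generalize (∏ y : Y, ∏ x : X, _ : ℤˣ) = t2
  ac_rfl

/-- The sign of a permutation, as the sign of reordering by it. -/
theorem reorder_swap_mul_swap [Finite X] [DecidableEq X] {b : X → L} (hb : Injective b)
    {x y x' y' : X} (h : x ≠ y) (h' : x' ≠ y') :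
    reorder b (b ∘ (Equiv.swap x y * Equiv.swap x' y')) = 1 := by
  let F : Equiv.Perm X →* ℤˣ :=
    { toFun σ := reorder b (b ∘ σ)
      map_one' := reorder_self b
      map_mul' σ τ := by
        rw [← reorder_comp_equiv τ b (b ∘ σ), mul_comm]
        exact (reorder_trans hb (hb.comp τ.injective)
          ((hb.comp σ.injective).comp τ.injective)).symm }
  -- All transpositions are conjugate, and a homomorphism to the commutative group of signs is
  -- constant on conjugacy classes. Hence the two factors agree and their product is a square.
  have h1 : F (Equiv.swap x y) = F (Equiv.swap x' y') :=
    isConj_iff_eq.1 (F.map_isConj (Equiv.Perm.isConj_swap h h'))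
  change F (_ * _) = 1
  rw [map_mul, h1, Int.units_mul_self]

theorem finprod_fiber {M : Type} [CommMonoid M] [Finite X] [Finite Y] (f : X → Y) (F : X → M) :
    ∏ᶠ x, F x = ∏ᶠ y, ∏ᶠ x : {x // f x = y}, F x := by
  classical
  have := Fintype.ofFinite X
  have := Fintype.ofFinite Y
  simp only [finprod_eq_prod_of_fintype]
  rw [← Fintype.prod_sigma' (fun y (x : {x // f x = y}) => F x)]
  exact (Fintype.prod_equiv (Equiv.sigmaFiberEquiv f) _ _ fun _ => rfl).symm

theorem negOnePow_prod {s : Finset X} (f : X → ℤ) :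
    (∑ x ∈ s, f x).negOnePow = ∏ x ∈ s, (f x).negOnePow := by
  classical
  induction s using Finset.induction_on with
  | empty => simp
  | insert a s ha ih => rw [Finset.sum_insert ha, Finset.prod_insert ha, Int.negOnePow_add, ih]

/-- Reordering blocks, the order in each block being fixed. -/
theorem reorder_blocks [Finite X] [Finite Y] (f : X → Y) {a a' : Y → ℕ} (ha : Injective a)
    (ha' : Injective a') (i : X → ℕ) :
    reorder (fun x => toLex (a (f x), i x)) (fun x => toLex (a' (f x), i x)) =
      koszul a a' (fun y => Nat.card {x // f x = y}) := by
  classical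
  have := Fintype.ofFinite X
  have := Fintype.ofFinite Y
  unfold reorder koszul
  rw [finprod_fiber (fun x : X × X => (f x.1, f x.2))]
  refine finprod_congr fun y => ?_
  have key : ∀ x : {x : X × X // (f x.1, f x.2) = y},
      (if toLex (a (f x.1.1), i x.1.1) < toLex (a (f x.1.2), i x.1.2) ∧
        toLex (a' (f x.1.2), i x.1.2) < toLex (a' (f x.1.1), i x.1.1) then (-1 : ℤˣ) else 1) =
      if a y.1 < a y.2 ∧ a' y.2 < a' y.1 then -1 else 1 := by
    rintro ⟨⟨x, x'⟩, rfl⟩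
    dsimp only
    refine if_congr ?_ rfl rfl
    simp only [Prod.Lex.toLex_lt_toLex, ha.eq_iff, ha'.eq_iff]
    constructor
    · rintro ⟨h1 | h1, h2 | h2⟩
      · exact ⟨h1, h2⟩
      · rw [h2.1] at h1; exact absurd h1 (lt_irrefl _)
      · rw [h1.1] at h2; exact absurd h2 (lt_irrefl _)
      · exact absurd (h1.2.trans h2.2) (lt_irrefl _)
    · exact fun h => ⟨.inl h.1, .inl h.2⟩
  -- For two given blocks either every pair across them is inverted or none is, so they contribute a
  -- power whose exponent is the product of their sizes.
  rw [finprod_congr key, finprod_eq_prod_of_fintype, Finset.prod_const]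
  have hc : (Finset.univ : Finset {x : X × X // (f x.1, f x.2) = y}).card =
      Nat.card {x // f x = y.1} * Nat.card {x // f x = y.2} := by
    rw [← Nat.card_prod, Finset.card_univ, ← Nat.card_eq_fintype_card]
    refine Nat.card_congr ⟨fun x => (⟨x.1.1, congrArg Prod.fst x.2⟩, ⟨x.1.2, congrArg Prod.snd x.2⟩),
      fun x => ⟨(x.1.1, x.2.1), Prod.ext x.1.2 x.2.2⟩, fun _ => rfl, fun _ => rfl⟩
  rw [hc]
  split_ifs
  · rw [← Nat.cast_mul, Int.negOnePow_def, zpow_natCast]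
  · rw [one_pow]

/-- Reordering inside the blocks, the order of the blocks being fixed. -/
theorem reorder_inside [Finite X] [Finite Y] (f : X → Y) {a : Y → ℕ} (ha : Injective a)
    (i i' : X → ℕ) :
    reorder (fun x => toLex (a (f x), i x)) (fun x => toLex (a (f x), i' x)) =
      ∏ᶠ y, reorder (fun x : {x // f x = y} => i x) (fun x => i' x) := by
  classical
  have := Fintype.ofFinite X
  have := Fintype.ofFinite Y
  unfold reorder
  rw [finprod_fiber (fun x : X × X => f x.1)]
  refine finprod_congr fun y => ?_
  have hinj : Injective fun x : {x // f x = y} × {x // f x = y} =>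
      (⟨(x.1.1, x.2.1), x.1.2⟩ : {x : X × X // f x.1 = y}) := by
    rintro ⟨⟨x, hx⟩, ⟨x', hx'⟩⟩ ⟨⟨z, hz⟩, ⟨z', hz'⟩⟩ h
    simpa using h
  rw [finprod_eq_prod_of_fintype, finprod_eq_prod_of_fintype]
  -- Pairs from different blocks are never inverted, since the blocks keep their order; only pairs
  -- within one block remain.
  refine (Fintype.prod_of_injective _ hinj _ _ ?_ ?_).symm
  · rintro ⟨⟨x, x'⟩, hx⟩ h
    dsimp only at hx ⊢
    refine if_neg ?_
    have hne : f x' ≠ f x := fun h' => h ⟨(⟨x, hx⟩, ⟨x', h'.trans hx⟩), rfl⟩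
    simp only [Prod.Lex.toLex_lt_toLex, ha.eq_iff, hne, hne.symm, false_and, or_false]
    exact fun h => (h.1.trans h.2).false
  · rintro ⟨⟨x, hx⟩, ⟨x', hx'⟩⟩
    dsimp only
    refine if_congr ?_ rfl rfl
    simp [Prod.Lex.toLex_lt_toLex, hx, hx']

end Reorder
end CycFeyn

namespace CycFeyn

open Function

/-! ### The sign of a tree -/

/-- The odd symbols of a tree: the half-edges, and the vertices, which are the root (`none`) and
one vertex for every edge. -/
abbrev TreeSym (I E : Type) : Type := (I ⊕ E × Bool) ⊕ Option E

/-- The order of the symbols that lists the legs, the root, and then for every edge its vertex,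
the half-edge not at this vertex, and the half-edge at this vertex. -/
def edgeRank {I E : Type} (r : I → ℕ) (rE : E → ℕ) (dir : E → Bool) : TreeSym I E → ℕ ×ₗ ℕ
  | .inl (.inl i) => toLex (0, r i)
  | .inl (.inr (e, b)) => toLex (rE e + 1 + 1, if b = dir e then 2 else 1)
  | .inr none => toLex (1, 0)
  | .inr (some e) => toLex (rE e + 1 + 1, 0)

theorem edgeRank_injective {I E : Type} (r : I ↪ ℕ) (rE : E ↪ ℕ) (dir : E → Bool) :
    Injective (edgeRank r rE dir) := by
  have hE : ∀ e e', rE e + 1 + 1 = rE e' + 1 + 1 → e = e' := fun e e' h =>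
    rE.injective (by omega)
  rintro ((i | ⟨e, b⟩) | _ | e) ((i' | ⟨e', b'⟩) | _ | e') h <;>
    simp only [edgeRank, toLex_inj, Prod.mk.injEq] at h <;> obtain ⟨h1, h2⟩ := h <;> try omega
  · rw [r.injective h2]
  · obtain rfl := hE _ _ h1
    cases b <;> cases b' <;> cases hd : dir e <;> simp [hd] at h2 <;> rfl
  · split_ifs at h2
  · rfl
  · split_ifs at h2
  · rw [hE _ _ h1]

/-- The block of edges or legs to which a symbol belongs. -/
def edgeBlock {I E : Type} : TreeSym I E → Option (Option E)
  | .inl (.inl _) => none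
  | .inl (.inr (e, _)) => some (some e)
  | .inr none => some none
  | .inr (some e) => some (some e)

/-- The place of a symbol in its block. -/
def edgePlace {I E : Type} (r : I → ℕ) (dir : E → Bool) : TreeSym I E → ℕ
  | .inl (.inl i) => r i
  | .inl (.inr (e, b)) => if b = dir e then 2 else 1
  | .inr none => 0
  | .inr (some _) => 0

/-- The legs form block 0, the root block 1, and the edges the blocks from 2 on. This lexicographic
form is what `reorder_blocks` and `reorder_inside` apply to. -/
theorem edgeRank_eq {I E : Type} (r : I → ℕ) (rE : E ↪ ℕ) (dir : E → Bool) :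
    edgeRank r rE dir =
      fun x => toLex (consRank (consRank rE) (edgeBlock x), edgePlace r dir x) := by
  funext x
  rcases x with (i | ⟨e, b⟩) | _ | e <;> rfl

theorem card_edgeBlock {I E : Type} (e : E) :
    Nat.card {x : TreeSym I E // edgeBlock x = some (some e)} = 3 := by
  have h : Nat.card {x : TreeSym I E // edgeBlock x = some (some e)} = Nat.card (Option Bool) := by
    refine Nat.card_congr ⟨fun x => match x with
      | ⟨.inl (.inr (_, b)), _⟩ => some b
      | _ => none, fun o => match o with
      | none => ⟨.inr (some e), rfl⟩
      | some b => ⟨.inl (.inr (e, b)), rfl⟩, ?_, ?_⟩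
    · rintro ⟨(i | ⟨e', b⟩) | _ | e', h⟩ <;> simp [edgeBlock] at h <;> subst h <;> rfl
    · rintro (_ | b) <;> rfl
  rw [h]; simp

/-- The source of `Det(Edge)`. A change of the order of the legs acts inside the first block; a
change of the order of the edges permutes blocks that are odd as a whole. -/
theorem reorder_edgeRank {I E : Type} [Finite I] [Finite E] (r r' : I ↪ ℕ) (rE rE' : E ↪ ℕ)
    (dir : E → Bool) : reorder (edgeRank r rE dir) (edgeRank r' rE' dir) =
      koszul r r' (fun _ => 1) * koszul rE rE' (fun _ => 1) := by
  rw [← reorder_trans (edgeRank_injective r rE dir) (edgeRank_injective r' rE dir)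
    (edgeRank_injective r' rE' dir)]
  congr 1
  · rw [edgeRank_eq, edgeRank_eq, reorder_inside _ (consRank (consRank rE)).injective,
      finprod_eq_single _ none, koszul_one]
    · refine (reorder_comp_equiv
        (⟨fun i => ⟨.inl (.inl i), rfl⟩, fun x => match x with | ⟨.inl (.inl i), _⟩ => i,
          fun _ => rfl, ?_⟩ : I ≃ {x : TreeSym I E // edgeBlock x = none}) _ _).symm.trans ?_
      rotate_left
      · rfl
      · rintro ⟨(i | ⟨e', b⟩) | _ | e', h⟩ <;> simp [edgeBlock] at h; rfl
    · rintro (_ | y) hy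
      · exact absurd rfl hy
      · rw [show (fun x : {x : TreeSym I E // edgeBlock x = some y} => edgePlace r' dir x.1) =
          fun x => edgePlace r dir x.1 from funext fun x => ?_, reorder_self]
        obtain ⟨(i | ⟨e', b⟩) | _ | e', h⟩ := x
        · simp [edgeBlock] at h
        all_goals rfl
  · rw [edgeRank_eq, edgeRank_eq, reorder_blocks _ (consRank (consRank rE)).injective
      (consRank (consRank rE')).injective, koszul_consRank, koszul_consRank]
    -- An edge block consists of three odd symbols, and 3 · 3 has the parity of 1 · 1. The blocks of
    -- the legs and of the root stay in front.
    simp only [card_edgeBlock, koszul]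
    rfl

/-- The order of the vertices and half-edges in which every vertex is followed by its half-edges. -/
def vertexRank {V : Type} {H : V → Type} (rV : V → ℕ) (ρ : ∀ v, H v ↪ ℕ) :
    (Σ v, Option (H v)) → ℕ ×ₗ ℕ := fun s => toLex (rV s.1, consRank (ρ s.1) s.2)

theorem vertexRank_injective {V : Type} {H : V → Type} (rV : V ↪ ℕ) (ρ : ∀ v, H v ↪ ℕ) :
    Injective (vertexRank rV ρ) := by
  rintro ⟨v, o⟩ ⟨v', o'⟩ h
  simp only [vertexRank, toLex_inj, Prod.mk.injEq, rV.apply_eq_iff_eq] at h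
  obtain ⟨rfl, h⟩ := h
  rw [(consRank (ρ v)).injective h]

/-- The block of `v` contains the vertex and its half-edges. Its size `|H(v)| + 1` has the parity of
the shift `3 - |H(v)|` in the suspension, so permuting blocks gives the Koszul sign of permuting the
shifts. -/
theorem reorder_vertexRank {V : Type} {H : V → Type} [Finite V] [∀ v, Finite (H v)] (rV rV' : V ↪ ℕ)
    (ρ ρ' : ∀ v, H v ↪ ℕ) : reorder (vertexRank rV ρ) (vertexRank rV' ρ') =
      (∏ᶠ v, koszul (ρ v) (ρ' v) (fun _ => 1)) * koszul rV rV' (fun v => Nat.card (H v) + 1) := by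
  rw [← reorder_trans (vertexRank_injective rV ρ) (vertexRank_injective rV ρ')
    (vertexRank_injective rV' ρ')]
  congr 1
  · refine (reorder_inside (X := Σ v, Option (H v)) Sigma.fst rV.injective (fun s => consRank (ρ s.1) s.2)
      (fun s => consRank (ρ' s.1) s.2)).trans (finprod_congr fun v => ?_)
    rw [← koszul_consRank _ _ (fun _ => 1), koszul_one]
    refine Eq.trans ?_ (reorder_comp_equiv
      (Equiv.sigmaSubtype (β := fun v => Option (H v)) v) _ _)
    refine reorder_congr ?_ ?_ <;> rintro ⟨⟨v, x⟩, rfl⟩ ⟨⟨v', y⟩, h⟩ <;> cases h <;> rfl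
  · refine (reorder_blocks (X := Σ v, Option (H v)) Sigma.fst rV.injective rV'.injective
      (fun s => consRank (ρ' s.1) s.2)).trans (koszul_congr_deg _ _ _ _ fun v => ?_)
    rw [Nat.card_congr (Equiv.sigmaSubtype v), Finite.card_option]
    simp

/-- The vertices and half-edges, at the vertices. -/
def optionSigma {V : Type} (H : V → Type) : (Σ v, H v) ⊕ V ≃ Σ v, Option (H v) where
  toFun
    | .inl s => ⟨s.1, some s.2⟩
    | .inr v => ⟨v, none⟩
  invFun
    | ⟨v, some h⟩ => .inl ⟨v, h⟩
    | ⟨v, none⟩ => .inr v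
  left_inv := by rintro (s | v) <;> rfl
  right_inv := by rintro ⟨v, _ | h⟩ <;> rfl

namespace Graph

variable {I J : Type}

/-- A root and a direction of every edge towards one of its ends, such that every vertex other than
the root is the chosen end of exactly one edge. -/
structure Rooting (G : Graph I) where
  root : G.V
  dir : G.E → Bool
  bij : Bijective fun o : Option G.E => o.elim root fun e => (G.att e (dir e)).1

namespace Rooting

variable {G G' : Graph I} (m : Rooting G)

theorem ext' {m m' : Rooting G} (h : m.root = m'.root) (h' : m.dir = m'.dir) : m = m' := by
  cases m; cases m'; cases h; cases h'; rfl

/-- The vertices, as the root and the vertices that belong to the edges. -/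
noncomputable def equiv : Option G.E ≃ G.V := Equiv.ofBijective _ m.bij

@[simp] theorem equiv_none : m.equiv none = m.root := rfl

@[simp] theorem equiv_some (e : G.E) : m.equiv (some e) = (G.att e (m.dir e)).1 := rfl

theorem att_ne_root (e : G.E) : (G.att e (m.dir e)).1 ≠ m.root := fun h => by
  cases m.equiv.injective (a₁ := some e) (a₂ := none) h

theorem att_inj {e e' : G.E} (h : (G.att e (m.dir e)).1 = (G.att e' (m.dir e')).1) : e = e' :=
  Option.some.inj (m.equiv.injective (a₁ := some e) (a₂ := some e') h)

/-- The symbols of a tree, at its vertices. -/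
noncomputable def sym : TreeSym I G.E ≃ Σ v, Option (G.H v) :=
  (Equiv.sumCongr G.inc.symm m.equiv).trans (optionSigma G.H)

/-- The sign of reordering the symbols of a tree from the order of its vertices to the order of its
edges. -/
noncomputable def sign (r : I ↪ ℕ) (ρ : ∀ v, G.H v ↪ ℕ) : ℤˣ :=
  reorder (vertexRank G.rV ρ ∘ m.sym) (edgeRank r G.rE m.dir)

theorem vertexRank_sym_injective (ρ : ∀ v, G.H v ↪ ℕ) : Injective (vertexRank G.rV ρ ∘ m.sym) :=
  (vertexRank_injective G.rV ρ).comp m.sym.injective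

/-- Transport of a rooting along an isomorphism. -/
def map (f : Iso G G') : Rooting G' where
  root := f.v m.root
  dir e := xor (f.flip (f.e.symm e)) (m.dir (f.e.symm e))
  bij := by
    have h : (fun o : Option G'.E => o.elim (f.v m.root) fun e =>
        (G'.att e (xor (f.flip (f.e.symm e)) (m.dir (f.e.symm e)))).1) =
        f.v ∘ m.equiv ∘ f.e.optionCongr.symm := by
      funext o
      rcases o with _ | e
      · rfl
      · obtain ⟨e, rfl⟩ := f.e.surjective e
        have : f.e.optionCongr.symm (some (f.e e)) = some e := by
          rw [Equiv.symm_apply_eq]; rfl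
        simp [f.end_eq, this]
    rw [h]
    exact f.v.bijective.comp (m.equiv.bijective.comp (Equiv.bijective _))

/-- The bijection between the half-edges of edges. -/
def _root_.CycFeyn.Graph.Iso.halves (f : Iso G G') : G.E × Bool ≃ G'.E × Bool where
  toFun x := (f.e x.1, xor (f.flip x.1) x.2)
  invFun x := (f.e.symm x.1, xor (f.flip (f.e.symm x.1)) x.2)
  left_inv x := by simp
  right_inv x := by simp

/-- The isomorphism identifies the symbols of the two trees, the flip of an edge exchanging its
halves together with its chosen end. After this identification only the orders differ, and both ends
of the reordering are corrected by `reorder_vertexRank` and `reorder_edgeRank`. -/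
theorem sign_map [Finite I] (f : Iso G G') (r : I ↪ ℕ) (ρ : ∀ v, G.H v ↪ ℕ)
    (ρ' : ∀ v, G'.H v ↪ ℕ) : (m.map f).sign r ρ' =
      (∏ᶠ v, koszul (ρ v) (ρ' (f.v v) ∘ f.h v) (fun _ => 1)) *
      koszul G.rV (G'.rV ∘ f.v) (fun v => Nat.card (G.H v) + 1) *
      koszul G.rE (G'.rE ∘ f.e) (fun _ => 1) * m.sign r ρ := by
  let σ : TreeSym I G.E ≃ TreeSym I G'.E :=
    Equiv.sumCongr (Equiv.sumCongr (Equiv.refl I) f.halves) f.e.optionCongr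
  let ρ'' : ∀ v, G.H v ↪ ℕ := fun v => (f.h v).toEmbedding.trans (ρ' (f.v v))
  have h1 : vertexRank G'.rV ρ' ∘ (m.map f).sym ∘ σ =
      vertexRank (f.v.toEmbedding.trans G'.rV) ρ'' ∘ m.sym := by
    funext x
    rcases x with x | o
    · obtain ⟨s, rfl⟩ := G.inc.surjective x
      have e1 : (m.map f).sym (σ (.inl (G.inc s))) = ⟨f.v s.1, some (f.h s.1 s.2)⟩ := by
        have : G'.inc.symm (Sum.map id (fun x => (f.e x.1, xor (f.flip x.1) x.2)) (G.inc s)) =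
          f.sig s := by rw [← f.inc_sig, Equiv.symm_apply_apply]
        have h2 : Equiv.sumCongr (Equiv.refl I) f.halves (G.inc s) =
          Sum.map id (fun x => (f.e x.1, xor (f.flip x.1) x.2)) (G.inc s) := rfl
        simp only [sym, σ, Equiv.trans_apply, Equiv.sumCongr_apply, Sum.map_inl]
        rw [← Equiv.sumCongr_apply, h2, this]
        rfl
      have e2 : m.sym (.inl (G.inc s)) = ⟨s.1, some s.2⟩ := by
        simp [sym, optionSigma]
      simp only [comp_apply, e1, e2]
      rfl
    · have e1 : (m.map f).sym (σ (.inr o)) = ⟨f.v (m.equiv o), none⟩ := by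
        have : (m.map f).equiv (f.e.optionCongr o) = f.v (m.equiv o) := by
          rcases o with _ | e
          · rfl
          · simp [map, f.end_eq]
        change (⟨(m.map f).equiv (f.e.optionCongr o), none⟩ : Σ v, Option (G'.H v)) = _
        rw [this]
      have e2 : m.sym (.inr o) = ⟨m.equiv o, none⟩ := rfl
      simp only [comp_apply, e1, e2]
      rfl
  have h2 : edgeRank r G'.rE (m.map f).dir ∘ σ =
      edgeRank r (f.e.toEmbedding.trans G'.rE) m.dir := by
    funext x
    rcases x with (i | ⟨e, b⟩) | _ | e
    · rfl
    · simp [σ, edgeRank, Iso.halves, map]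
    · rfl
    · rfl
  have : Finite (Σ v, Option (G.H v)) := inferInstance
  unfold sign
  rw [← reorder_comp_equiv σ, comp_assoc, h1, h2,
    ← reorder_trans (b := vertexRank G.rV ρ ∘ m.sym)
      ((vertexRank_injective (f.v.toEmbedding.trans G'.rV) ρ'').comp m.sym.injective)
      (m.vertexRank_sym_injective ρ) (edgeRank_injective _ _ _),
    ← reorder_trans (b := edgeRank r G.rE m.dir) (m.vertexRank_sym_injective ρ)
      (edgeRank_injective _ _ _) (edgeRank_injective _ _ _),
    reorder_symm, reorder_comp_equiv m.sym, reorder_vertexRank, reorder_edgeRank]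
  have h3 : koszul r r (fun _ => 1) = 1 := koszul_self _ _
  rw [h3, one_mul, mul_comm (reorder _ _), ← mul_assoc]
  rfl

/-- Change of the order of the legs. -/
theorem sign_rank [Finite I] (r r' : I ↪ ℕ) (ρ : ∀ v, G.H v ↪ ℕ) :
    m.sign r' ρ = koszul r r' (fun _ => 1) * m.sign r ρ := by
  have h3 : koszul G.rE G.rE (fun _ => 1) = 1 := koszul_self _ _
  unfold sign
  rw [← reorder_trans (b := edgeRank r G.rE m.dir) (m.vertexRank_sym_injective ρ)
      (edgeRank_injective _ _ _) (edgeRank_injective _ _ _), reorder_edgeRank, h3, mul_one, mul_comm]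

/-- Relabelling the legs. -/
def relabel (f : I ≃ J) : Rooting (G.relabel f) where
  root := m.root
  dir := m.dir
  bij := m.bij

theorem sign_relabel (f : I ≃ J) (r : J ↪ ℕ) (ρ : ∀ v, G.H v ↪ ℕ) :
    (m.relabel f).sign r ρ = m.sign (f.toEmbedding.trans r) ρ := by
  let σ : TreeSym I G.E ≃ TreeSym J G.E :=
    Equiv.sumCongr (Equiv.sumCongr f (Equiv.refl _)) (Equiv.refl _)
  refine (reorder_comp_equiv σ (vertexRank G.rV ρ ∘ (m.relabel f).sym)
    (edgeRank r G.rE m.dir)).symm.trans ?_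
  refine reorder_congr (fun x y => ?_) (fun x y => ?_)
  · have : ∀ x, (m.relabel f).sym (σ x) = m.sym x := by
      rintro ((i | ⟨e, b⟩) | _ | e)
      · change (optionSigma G.H) (.inl (G.inc.symm ((Equiv.sumCongr f (Equiv.refl _)).symm
          (.inl (f i))))) = (optionSigma G.H) (.inl (G.inc.symm (.inl i)))
        simp
      · rfl
      · rfl
      · rfl
    exact iff_of_eq (congrArg₂ (fun a b => vertexRank G.rV ρ a < vertexRank G.rV ρ b)
      (this x) (this y))
  · have : ∀ x, edgeRank r (G.relabel f).rE (m.relabel f).dir (σ x) =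
        edgeRank (f.toEmbedding.trans r) G.rE m.dir x := by
      rintro ((i | ⟨e, b⟩) | _ | e) <;> rfl
    exact iff_of_eq (congrArg₂ (· < ·) (this x) (this y))

/-- The root can be moved along an edge. -/
theorem exists_move (e : G.E) (c : Bool) (h : (G.att e c).1 = m.root) [Finite I] :
    ∃ m' : Rooting G, m'.root = (G.att e (!c)).1 ∧ ∀ r ρ, m'.sign r ρ = m.sign r ρ := by
  classical
  -- The chosen end of an edge is never the root, so it is the other end.
  have hd : m.dir e = !c := by
    by_contra hc
    refine m.att_ne_root e ?_
    rw [show m.dir e = c by revert hc; cases m.dir e <;> cases c <;> simp, h]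
  have hfun : (fun o : Option G.E => o.elim (G.att e (!c)).1
      fun e' => (G.att e' (update m.dir e c e')).1) =
      m.equiv ∘ Equiv.swap none (some e) := by
    funext o
    rcases o with _ | e'
    · simp [hd]
    · by_cases he : e' = e
      · subst he
        simp [h]
      · simp only [Option.elim_some, ne_eq, he, not_false_eq_true, update_of_ne, comp_apply]
        rw [Equiv.swap_apply_of_ne_of_ne (by simp) (by simpa using he)]
        rfl
  let m' : Rooting G := ⟨(G.att e (!c)).1, update m.dir e c, by
    rw [hfun]; exact m.equiv.bijective.comp (Equiv.bijective _)⟩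
  refine ⟨m', rfl, fun r ρ => ?_⟩
  -- With the new root, the symbol of the root and that of the vertex belonging to `e` trade places
  -- (`σ`), and reversing the direction of `e` exchanges the places of its two halves (`τ`).
  -- Together the two transpositions are even, so the sign is unchanged.
  let σ : Equiv.Perm (TreeSym I G.E) := Equiv.swap (.inr none) (.inr (some e))
  let τ : Equiv.Perm (TreeSym I G.E) := Equiv.swap (.inl (.inr (e, false))) (.inl (.inr (e, true)))
  have h1 : ∀ x, m'.sym x = m.sym (σ x) := by
    rintro (x | o)
    · rw [show σ (.inl x) = .inl x from Equiv.swap_apply_of_ne_of_ne (by simp) (by simp)]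
      rfl
    · have : σ (.inr o) = .inr (Equiv.swap none (some e) o) :=
        (Sum.inr_injective.swap_apply none (some e) o)
      rw [this]
      change (⟨m'.equiv o, none⟩ : Σ v, Option (G.H v)) = ⟨m.equiv _, none⟩
      rw [show m'.equiv o = _ from congrFun hfun o]
      rfl
  have h2 : ∀ x, edgeRank r G.rE m'.dir x = edgeRank r G.rE m.dir (τ x) := by
    rintro ((i | ⟨e', b⟩) | o)
    · rw [show τ (.inl (.inl i)) = _ from Equiv.swap_apply_of_ne_of_ne (by simp) (by simp)]
      rfl
    · by_cases he : e' = e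
      · subst he
        have h3 : τ (.inl (.inr (e', b))) = .inl (.inr (e', !b)) := by
          cases b
          · exact Equiv.swap_apply_left _ _
          · exact Equiv.swap_apply_right _ _
        rw [h3]
        simp only [edgeRank, m', update_self, hd]
        cases b <;> cases c <;> rfl
      · rw [show τ (.inl (.inr (e', b))) = _ from
          Equiv.swap_apply_of_ne_of_ne (by simp [he]) (by simp [he])]
        simp [edgeRank, m', he]
    · rw [show τ (.inr o) = _ from Equiv.swap_apply_of_ne_of_ne (by simp) (by simp)]
      rcases o with _ | o <;> rfl
  unfold sign
  have h3 : vertexRank G.rV ρ ∘ m'.sym = (vertexRank G.rV ρ ∘ m.sym) ∘ σ := by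
    funext x; simp [h1]
  have h4 : edgeRank r G.rE m'.dir = (edgeRank r G.rE m.dir ∘ (τ * σ)) ∘ σ := by
    funext x; simp [h2, σ]
  rw [h3, h4, reorder_comp_equiv, ← reorder_trans (m.vertexRank_sym_injective ρ)
    (edgeRank_injective r G.rE m.dir) ((edgeRank_injective r G.rE m.dir).comp (τ * σ).injective),
    reorder_swap_mul_swap (edgeRank_injective _ _ _) (by simp) (by simp), mul_one]

end Rooting

end Graph

end CycFeyn

/-! ### Trees: parent edges, and uniqueness of the rooting with a given root -/

namespace CycFeyn

open Function

namespace Graph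

variable {I J : Type}

/-- The depth is the distance to `v₀` in the underlying simple graph; the first step of a shortest
walk supplies the edge. -/
theorem exists_depth (G : Graph I) (hG : ∀ v v', Relation.ReflTransGen G.Joined v v') (v₀ : G.V) :
    ∃ d : G.V → ℕ, ∀ v, v ≠ v₀ → ∃ e c, (G.att e c).1 = v ∧ d (G.att e (!c)).1 < d v := by
  let S : SimpleGraph G.V := SimpleGraph.fromRel G.Joined
  have hS : ∀ v, S.Reachable v v₀ := by
    intro v
    induction hG v v₀ using Relation.ReflTransGen.head_induction_on with
    | refl => exact SimpleGraph.Reachable.refl _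
    | @head a b h _ ih =>
      by_cases hab : a = b
      · rwa [hab]
      · exact (SimpleGraph.Adj.reachable (by
          rw [SimpleGraph.fromRel_adj]; exact ⟨hab, .inl h⟩)).trans ih
  refine ⟨fun v => S.dist v v₀, fun v hv => ?_⟩
  obtain ⟨p, hp⟩ := (hS v).exists_walk_length_eq_dist
  cases p with
  | nil => exact absurd rfl hv
  | @cons _ b _ h p =>
    have h1 : S.dist b v₀ < S.dist v v₀ := by
      have := SimpleGraph.dist_le p
      rw [SimpleGraph.Walk.length_cons] at hp
      omega
    rw [SimpleGraph.fromRel_adj] at h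
    rcases h.2 with ⟨e, c, h2, h3⟩ | ⟨e, c, h2, h3⟩
    · exact ⟨e, c, h2, by rwa [h3]⟩
    · exact ⟨e, !c, h3, by rwa [Bool.not_not, h2]⟩

/-- Each vertex other than `v₀` gets an edge that leads closer to `v₀`. If two different vertices
had the same edge, they would be its two ends, and each would be closer to `v₀` than the other. -/
theorem exists_parent (G : Graph I) (hG : ∀ v v', Relation.ReflTransGen G.Joined v v') (v₀ : G.V) :
    ∃ (d : G.V → ℕ) (pe : {v // v ≠ v₀} → G.E) (pc : {v // v ≠ v₀} → Bool), Injective pe ∧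
      ∀ v, (G.att (pe v) (pc v)).1 = v.1 ∧ d (G.att (pe v) (!pc v)).1 < d v.1 := by
  obtain ⟨d, hd⟩ := G.exists_depth hG v₀
  choose pe pc h using fun v : {v // v ≠ v₀} => hd v.1 v.2
  refine ⟨d, pe, pc, fun v w hvw => ?_, h⟩
  by_contra hne
  have hne' : v.1 ≠ w.1 := fun h' => hne (Subtype.ext h')
  have hc : pc w = !pc v := by
    by_contra hc
    have hc' : pc w = pc v := by
      revert hc; cases pc w <;> cases pc v <;> simp
    refine hne' ?_
    rw [← (h v).1, ← (h w).1, hvw, hc']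
  have h1 := (h v).2
  have h2 := (h w).2
  rw [hc, Bool.not_not, ← hvw, (h v).1] at h2
  rw [hvw, ← hc, (h w).1] at h1
  exact (h1.trans h2).false

/-- The parent edges embed the vertices other than a chosen one into the edges. -/
theorem card_le_of_connected (G : Graph I)
    (hG : ∀ v v', Relation.ReflTransGen G.Joined v v') : Fintype.card G.V ≤ Fintype.card G.E + 1 := by
  classical
  rcases isEmpty_or_nonempty G.V with h | ⟨⟨v₀⟩⟩
  · simp
  · obtain ⟨-, pe, -, hpe, -⟩ := G.exists_parent hG v₀
    have := Fintype.card_le_of_injective pe hpe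
    rw [Fintype.card_subtype_compl, Fintype.card_subtype_eq] at this
    omega

/-- Total genus 0 says that the sum of the genus labels plus `|E| + 1` equals `|V|`, while
connectedness gives `|V| ≤ |E| + 1`. -/
theorem IsStable.genus_eq_zero {G : Graph I} (hG : G.IsStable 0) (v : G.V) : G.genus v = 0 := by
  have h1 := G.card_le_of_connected hG.2.1
  have h2 := hG.2.2.2
  have h3 : ∑ v, G.genus v = 0 := by omega
  exact (Finset.sum_eq_zero_iff.1 h3) v (Finset.mem_univ v)

theorem IsStable.card_eq {G : Graph I} (hG : G.IsStable 0) :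
    Fintype.card G.E + 1 = Fintype.card G.V := by
  have h2 := hG.2.2.2
  rw [Finset.sum_eq_zero fun v _ => hG.genus_eq_zero v] at h2
  omega

/-- A tree has exactly one rooting with a given root. -/
theorem IsStable.existsUnique_rooting {G : Graph I} (hG : G.IsStable 0) (v₀ : G.V) :
    ∃ m : Rooting G, m.root = v₀ ∧ ∀ m' : Rooting G, m'.root = v₀ → m' = m := by
  classical
  obtain ⟨d, pe, pc, hpe, h⟩ := G.exists_parent hG.2.1 v₀
  -- Here the graph being a tree enters: the numbers of edges and of vertices other than `v₀` agree,
  -- so every edge is a parent edge.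
  have hbij : Bijective pe := by
    refine (Fintype.bijective_iff_injective_and_card pe).2 ⟨hpe, ?_⟩
    have := hG.card_eq
    rw [Fintype.card_subtype_compl, Fintype.card_subtype_eq]
    omega
  let q := Equiv.ofBijective pe hbij
  have hq : ∀ v, q.symm (pe v) = v := fun v => q.symm_apply_apply v
  let m : Rooting G := ⟨v₀, fun e => pc (q.symm e), by
    have hfun : (fun o : Option G.E => o.elim v₀ fun e => (G.att e (pc (q.symm e))).1) =
        Equiv.optionSubtypeNe v₀ ∘ q.symm.optionCongr := by
      funext o
      rcases o with _ | e
      · rfl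
      · obtain ⟨v, rfl⟩ := hbij.surjective e
        have : q.optionCongr.symm (some (pe v)) = some v :=
          congrArg some (hq v)
        simp only [Option.elim_some, hq, (h v).1, comp_apply]
        exact (congrArg (Equiv.optionSubtypeNe v₀) this).symm
    rw [hfun]
    exact (Equiv.bijective _).comp (Equiv.bijective _)⟩
  refine ⟨m, rfl, fun m' hm' => Rooting.ext' hm' (funext fun e => ?_)⟩
  -- Induction on the depth. If `m'` directed the parent edge of `v` away from `v`, it would direct
  -- it to a vertex `w` closer to `v₀`, and `w ≠ v₀` since no edge points to the root. By induction
  -- the parent edge of `w` points to `w` as well, so the two parent edges coincide and `w = v`, a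
  -- contradiction.
  have key : ∀ n (v : {v // v ≠ v₀}), d v.1 = n → (G.att (pe v) (m'.dir (pe v))).1 = v.1 := by
    intro n
    induction n using Nat.strong_induction_on with
    | _ n ih =>
      intro v hv
      by_contra hne
      have hd : m'.dir (pe v) = !pc v := by
        by_contra hc
        have hc' : m'.dir (pe v) = pc v := by
          revert hc; cases m'.dir (pe v) <;> cases pc v <;> simp
        exact hne (by rw [hc', (h v).1])
      have hw : (G.att (pe v) (m'.dir (pe v))).1 ≠ v₀ := hm' ▸ m'.att_ne_root (pe v)
      have hlt : d (G.att (pe v) (m'.dir (pe v))).1 < n := by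
        rw [hd, ← hv]; exact (h v).2
      have h1 := ih _ hlt ⟨_, hw⟩ rfl
      have h2 := hpe (m'.att_inj h1)
      exact hne (congrArg Subtype.val h2)
  obtain ⟨v, rfl⟩ := hbij.surjective e
  change _ = pc (q.symm (pe v))
  rw [hq]
  by_contra hc
  have hc' : m'.dir (pe v) = !pc v := by
    revert hc; cases m'.dir (pe v) <;> cases pc v <;> simp
  have h1 := key _ v rfl
  have h2 := (h v).2
  rw [← hc', h1] at h2
  exact h2.false

/-- The sign of a tree does not depend on the choice of the root. -/
theorem IsStable.sign_eq [Finite I] {G : Graph I} (hG : G.IsStable 0) (m m' : Rooting G) (r : I ↪ ℕ)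
    (ρ : ∀ v, G.H v ↪ ℕ) : m.sign r ρ = m'.sign r ρ := by
  -- The root is moved step by step along a path from one root to the other. The resulting rooting
  -- has the root of `m'`, and hence equals `m'` by uniqueness.
  have key : ∀ v, Relation.ReflTransGen G.Joined m.root v →
      ∃ m'' : Rooting G, m''.root = v ∧ m''.sign r ρ = m.sign r ρ := by
    intro v hv
    induction hv with
    | refl => exact ⟨m, rfl, rfl⟩
    | tail _ h ih =>
      obtain ⟨m₁, h₁, h₂⟩ := ih
      obtain ⟨e, c, h₃, h₄⟩ := h
      obtain ⟨m₂, h₅, h₆⟩ := m₁.exists_move e c (h₃.trans h₁.symm)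
      exact ⟨m₂, h₅.trans h₄, (h₆ r ρ).trans h₂⟩
  obtain ⟨m'', h₁, h₂⟩ := key m'.root (hG.2.1 _ _)
  obtain ⟨m₀, -, h₃⟩ := hG.existsUnique_rooting m'.root
  rw [← h₂, h₃ m'' h₁, h₃ m' rfl]

theorem IsStable.nonempty_rooting {G : Graph I} (hG : G.IsStable 0) : Nonempty (Rooting G) := by
  obtain ⟨v₀⟩ := hG.1
  obtain ⟨m, -⟩ := hG.existsUnique_rooting v₀
  exact ⟨m⟩

end Graph

end CycFeyn

namespace CycFeyn

open Function

theorem lt_iff_lt_of_imp {X L L' : Type} [LinearOrder L] [LinearOrder L'] {a : X → L} {b : X → L'}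
    (ha : Injective a) (h : ∀ x y, a x < a y → b x < b y) (x y : X) : a x < a y ↔ b x < b y := by
  refine ⟨h x y, fun hb => ?_⟩
  by_contra hn
  rcases (not_lt.1 hn).lt_or_eq with h' | h'
  · exact (hb.trans (h y x h')).false
  · rw [ha h'] at hb
    exact hb.false

namespace Graph

variable {I J : Type}

/-! ### Contraction of an edge -/

section contract

variable (G : Graph I) (e : G.E)

/-- The half-edges at the vertices of the contracted graph, as half-edges of the graph. -/
def halfOfContract (z : Σ w, (G.contract e).H w) : Σ v, G.H v := G.contractIncl e z

/-- The edges of the contracted graph, as edges of the graph. -/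
def edgeOfContract (e' : (G.contract e).E) : G.E := Subtype.val (p := (· ≠ e)) e'

variable {e} in
/-- The vertex of the contracted graph at a vertex that is not an end of the edge. -/
def toContract {v : G.V} (hv : ¬ G.IsEnd e v) : (G.contract e).V :=
  (some ⟨v, hv⟩ : Option {v // ¬ G.IsEnd e v})

/-- The new vertex of the contracted graph. -/
def newVertex : (G.contract e).V := (none : Option {v // ¬ G.IsEnd e v})

theorem edgeOfContract_ne (e' : (G.contract e).E) : G.edgeOfContract e e' ≠ e :=
  Subtype.prop (p := (· ≠ e)) e'

theorem edgeOfContract_injective : Injective (G.edgeOfContract e) := Subtype.val_injective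

theorem exists_edgeOfContract {e' : G.E} (h : e' ≠ e) : ∃ e'', G.edgeOfContract e e'' = e' :=
  ⟨(⟨e', h⟩ : {e' // e' ≠ e}), rfl⟩

theorem inc_halfOfContract (z : Σ w, (G.contract e).H w) : G.inc (G.halfOfContract e z) =
    Sum.map id (Prod.map (G.edgeOfContract e) id) ((G.contract e).inc z) :=
  (G.contract_inc e z).symm

theorem halfOfContract_inc_symm (x : I ⊕ (G.contract e).E × Bool) :
    G.halfOfContract e ((G.contract e).inc.symm x) =
      G.inc.symm (Sum.map id (Prod.map (G.edgeOfContract e) id) x) := by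
  rw [Equiv.eq_symm_apply, inc_halfOfContract, Equiv.apply_symm_apply]

theorem halfOfContract_att (e' : (G.contract e).E) (c : Bool) :
    G.halfOfContract e ((G.contract e).att e' c) = G.att (G.edgeOfContract e e') c :=
  G.halfOfContract_inc_symm e _

variable {e} in
theorem fst_eq_toContract {z : Σ w, (G.contract e).H w} {v : G.V}
    (h : (G.halfOfContract e z).1 = v) (hv : ¬ G.IsEnd e v) : z.1 = G.toContract hv := by
  obtain ⟨_ | w, s⟩ := z
  · have h1 : G.IsEnd e (G.halfOfContract e ⟨G.newVertex e, s⟩).1 := (s : G.Rest e).2.1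
    exact absurd (h ▸ h1) hv
  · exact congrArg some (Subtype.ext h)

variable {e} in
theorem toContract_inj {v w : G.V} {hv : ¬ G.IsEnd e v} {hw : ¬ G.IsEnd e w} :
    G.toContract hv = G.toContract hw ↔ v = w :=
  ⟨fun h => congrArg Subtype.val (Option.some.inj h), fun h => by subst h; rfl⟩

variable {e} in
theorem toContract_ne_newVertex {v : G.V} {hv : ¬ G.IsEnd e v} :
    G.toContract hv ≠ G.newVertex e := fun h => by cases h

variable {e} in
theorem contractVertex_cases (w : (G.contract e).V) :
    w = G.newVertex e ∨ ∃ v, ∃ hv : ¬ G.IsEnd e v, w = G.toContract hv := by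
  rcases w with _ | ⟨v, hv⟩
  exacts [.inl rfl, .inr ⟨v, hv, rfl⟩]

variable {G} (m : Rooting G)

/-- The ends of `e` are the root and the vertex belonging to `e`. The root belongs to no edge, and
no vertex belongs to two. -/
theorem Rooting.not_isEnd {e : G.E} (h : m.root = (G.att e false).1) {e' : G.E} (he : e' ≠ e) :
    ¬ G.IsEnd e (G.att e' (m.dir e')).1 := by
  rintro ⟨c, hc⟩
  have hd : m.dir e = true := by
    by_contra hd
    refine m.att_ne_root e ?_
    rw [h, (Bool.not_eq_true _).mp hd]
  cases c
  · exact m.att_ne_root e' (hc.symm.trans h.symm)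
  · exact he (m.att_inj (by rw [← hc, hd]))

theorem Rooting.dir_eq_true {e : G.E} (h : m.root = (G.att e false).1) : m.dir e = true := by
  by_contra hd
  refine m.att_ne_root e ?_
  rw [h, (Bool.not_eq_true _).mp hd]

/-- A rooting of the contracted graph. -/
noncomputable def Rooting.contract {e : G.E} (h : m.root = (G.att e false).1) :
    Rooting (G.contract e) where
  root := G.newVertex e
  dir e' := m.dir (G.edgeOfContract e e')
  bij := by
    -- No other edge points to an end of `e`, so the chosen ends survive the contraction unchanged.
    have key : ∀ e' : (G.contract e).E,
        ((G.contract e).att e' (m.dir (G.edgeOfContract e e'))).1 =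
        G.toContract (m.not_isEnd h (G.edgeOfContract_ne e e')) := fun e' =>
      G.fst_eq_toContract (congrArg Sigma.fst (G.halfOfContract_att e e' _)) _
    constructor
    · rintro (_ | e₁) (_ | e₂) h'
      · rfl
      · exact absurd ((key _).symm.trans h'.symm) G.toContract_ne_newVertex
      · exact absurd ((key _).symm.trans h') G.toContract_ne_newVertex
      · have h'' := G.toContract_inj.1 ((key _).symm.trans (h'.trans (key _)))
        exact congrArg some (G.edgeOfContract_injective e (m.att_inj h''))
    · intro w
      rcases G.contractVertex_cases w with rfl | ⟨v, hv, rfl⟩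
      · exact ⟨none, rfl⟩
      · obtain ⟨o, rfl⟩ := m.equiv.surjective v
        rcases o with _ | e'
        · exact absurd ⟨false, h.symm⟩ hv
        · have he : e' ≠ e := by
            rintro rfl
            exact hv ⟨_, rfl⟩
          obtain ⟨e'', rfl⟩ := G.exists_edgeOfContract e he
          exact ⟨some e'', key _⟩

/-- The order of the half-edges at the contracted graph. -/
def contractHalfRank {e : G.E} (s : G.Rest e ↪ ℕ) (ρ : ∀ v, G.H v ↪ ℕ) :
    ∀ w, (G.contract e).H w ↪ ℕ
  | none => s
  | some v => ρ v

/-- The order of the half-edges at an end of an edge in which the half-edge of the edge comes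
first. -/
noncomputable def endRank {H : Type} (t : H) (s : {a : H // a ≠ t} ↪ ℕ) : H ↪ ℕ :=
  open Classical in (Equiv.optionSubtypeNe t).symm.toEmbedding.trans (consRank s)

theorem endRank_self {H : Type} (t : H) (s : {a : H // a ≠ t} ↪ ℕ) : endRank t s t = 0 := by
  classical
  change consRank s ((Equiv.optionSubtypeNe t).symm t) = 0
  rw [Equiv.optionSubtypeNe_symm_self]; rfl

theorem endRank_of_ne {H : Type} (t : H) (s : {a : H // a ≠ t} ↪ ℕ) (a : {a : H // a ≠ t}) :
    endRank t s a.1 = s a + 1 := by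
  classical
  change consRank s ((Equiv.optionSubtypeNe t).symm a.1) = _
  rw [Equiv.optionSubtypeNe_symm_of_ne a.2]; rfl

/-- The vertices and half-edges of the contracted graph, in the graph; the new vertex is sent to the
first end of the edge. -/
def contractSymIncl (e : G.E) : (Σ w, Option ((G.contract e).H w)) → Σ v, Option (G.H v)
  | ⟨none, none⟩ => ⟨(G.att e false).1, none⟩
  | ⟨none, some s⟩ => ⟨(G.halfOfContract e ⟨none, s⟩).1, some (G.halfOfContract e ⟨none, s⟩).2⟩
  | ⟨some v, o⟩ => ⟨v, o⟩

theorem contractSymIncl_half (e : G.E) (z : Σ w, (G.contract e).H w) :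
    contractSymIncl e ⟨z.1, some z.2⟩ =
      ⟨(G.halfOfContract e z).1, some (G.halfOfContract e z).2⟩ := by
  obtain ⟨_ | v, s⟩ := z <;> rfl

/-- The symbols of a tree, as the symbols of an edge and those of the other edges. -/
def removeEdge {E : Type} [DecidableEq E] (e : E) :
    Option Bool ⊕ TreeSym I {e' // e' ≠ e} ≃ TreeSym I E where
  toFun
    | .inl none => .inr (some e)
    | .inl (some b) => .inl (.inr (e, b))
    | .inr (.inl x) => .inl (edgeIncl e x)
    | .inr (.inr o) => .inr (o.map Subtype.val)
  invFun
    | .inl (.inl i) => .inr (.inl (.inl i))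
    | .inl (.inr (e', b)) => if h : e' = e then .inl (some b) else .inr (.inl (.inr (⟨e', h⟩, b)))
    | .inr none => .inr (.inr none)
    | .inr (some e') => if h : e' = e then .inl none else .inr (.inr (some ⟨e', h⟩))
  left_inv := by
    rintro ((_ | b) | (i | ⟨⟨e', he⟩, b⟩) | _ | ⟨e', he⟩) <;> simp [edgeIncl, *]
  right_inv := by
    rintro ((i | ⟨e', b⟩) | _ | e')
    · rfl
    · by_cases h : e' = e <;> simp [h, edgeIncl]
    · rfl
    · by_cases h : e' = e <;> simp [h]

/-- Since `e` is the first edge, only the legs and the root come before its block. Each of these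
`|I| + 1` symbols is passed by three odd ones. -/
theorem crossing_edgeRank_removeEdge {E : Type} [DecidableEq E] [Finite I] [Finite E] (e : E)
    (r : I → ℕ) (rE : E → ℕ) (dir : E → Bool) (hE : ∀ e', e' ≠ e → rE e < rE e') :
    crossing (edgeRank r rE dir ∘ removeEdge e) = (Nat.card I + 1 : ℤ).negOnePow := by
  have := Fintype.ofFinite I
  have := Fintype.ofFinite E
  unfold crossing
  rw [finprod_eq_prod_of_fintype, Fintype.prod_prod_type, Finset.prod_comm]
  have hE' := fun e' : {e' // e' ≠ e} => hE e'.1 e'.2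
  simp only [Int.negOnePow_add, Int.negOnePow_one]
  simp [Fintype.prod_option, Fintype.prod_sum_type, removeEdge, edgeIncl,
    edgeRank, Prod.Lex.toLex_lt_toLex, (hE' _).not_gt, (hE' _).ne',
    Int.negOnePow_def]

/-- The symbols of a tree, as the symbols of an edge and those of the contracted tree. -/
noncomputable def contractSym (e : G.E) : Option Bool ⊕ TreeSym I (G.contract e).E ≃ TreeSym I G.E :=
  open Classical in removeEdge e

/-- The edge `e` comes first, and so do its ends. -/
structure EdgeFirst (G : Graph I) (e : G.E) : Prop where
  edge : ∀ e', e' ≠ e → G.rE e < G.rE e'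
  ends : G.rV (G.att e false).1 < G.rV (G.att e true).1
  vertex : ∀ v w, G.IsEnd e v → ¬ G.IsEnd e w → G.rV v < G.rV w

/-- The order of the remaining half-edges at an edge. -/
noncomputable def restRank {e : G.E} (hne : (G.att e false).1 ≠ (G.att e true).1)
    (s : {a // a ≠ (G.att e false).2} ⊕ {a // a ≠ (G.att e true).2} ↪ ℕ) : G.Rest e ↪ ℕ :=
  (G.restEquiv e _ _ false rfl rfl hne).symm.toEmbedding.trans s

/-- The symbols of the contracted graph are of four kinds: the new vertex, the remaining half-edges
at the first and at the second end of `e`, and everything at other vertices. The bound `N` separates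
the second kind from the third. The explicit ranks reduce all later comparisons to inequalities
between numbers. -/
theorem vertexRank_contract_cases {e : G.E} (hne : (G.att e false).1 ≠ (G.att e true).1)
    (ρ : ∀ v, G.H v ↪ ℕ)
    (s : {a // a ≠ (G.att e false).2} ⊕ {a // a ≠ (G.att e true).2} ↪ ℕ) {N : ℕ}
    (hs₀ : ∀ a, s (.inl a) < N) (hs₁ : ∀ a, N ≤ s (.inr a))
    (hρ₀ : ρ (G.att e false).1 = endRank (G.att e false).2 (Embedding.inl.trans s))
    (hρ₁ : ρ (G.att e true).1 = endRank (G.att e true).2 (Embedding.inr.trans s))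
    (z : Σ w, Option ((G.contract e).H w)) :
    (z = ⟨G.newVertex e, none⟩ ∧
      vertexRank (G.contract e).rV (contractHalfRank (restRank hne s) ρ) z = toLex (0, 0) ∧
      vertexRank G.rV ρ (contractSymIncl e z) = toLex (G.rV (G.att e false).1, 0)) ∨
    (z ≠ ⟨G.newVertex e, none⟩ ∧ ∃ n < N,
      vertexRank (G.contract e).rV (contractHalfRank (restRank hne s) ρ) z = toLex (0, n + 1) ∧
      vertexRank G.rV ρ (contractSymIncl e z) = toLex (G.rV (G.att e false).1, n + 2)) ∨
    (z ≠ ⟨G.newVertex e, none⟩ ∧ ∃ n, N ≤ n ∧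
      vertexRank (G.contract e).rV (contractHalfRank (restRank hne s) ρ) z = toLex (0, n + 1) ∧
      vertexRank G.rV ρ (contractSymIncl e z) = toLex (G.rV (G.att e true).1, n + 2)) ∨
    (z ≠ ⟨G.newVertex e, none⟩ ∧ ∃ v n, ¬ G.IsEnd e v ∧
      vertexRank (G.contract e).rV (contractHalfRank (restRank hne s) ρ) z =
        toLex (G.rV v + 1, n) ∧
      vertexRank G.rV ρ (contractSymIncl e z) = toLex (G.rV v, n)) := by
  obtain ⟨_ | v, o⟩ := z
  · rcases o with _ | t
    · exact .inl ⟨rfl, rfl, rfl⟩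
    · have hz : (⟨none, some t⟩ : Σ w, Option ((G.contract e).H w)) ≠ ⟨G.newVertex e, none⟩ :=
        fun h => by cases h
      let γ := G.restEquiv e (G.att e false) (G.att e true) false rfl rfl hne
      have hr : ∀ x, restRank hne s (γ x) = s x := fun x => congrArg s (γ.symm_apply_apply x)
      obtain ⟨a | a, rfl⟩ := γ.surjective t
      · refine .inr (.inl ⟨hz, s (.inl a), hs₀ a, ?_, ?_⟩)
        · exact congrArg (fun n => toLex (0, n + 1)) (hr (.inl a))
        · change toLex (G.rV (G.att e false).1, ρ (G.att e false).1 a.1 + 1) = _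
          rw [hρ₀, endRank_of_ne]; rfl
      · refine .inr (.inr (.inl ⟨hz, s (.inr a), hs₁ a, ?_, ?_⟩))
        · exact congrArg (fun n => toLex (0, n + 1)) (hr (.inr a))
        · change toLex (G.rV (G.att e true).1, ρ (G.att e true).1 a.1 + 1) = _
          rw [hρ₁, endRank_of_ne]; rfl
  · exact .inr (.inr (.inr ⟨(fun h => by cases h), v.1, consRank (ρ v.1) o, v.2, rfl, rfl⟩))

theorem Rooting.sym_contractSym {e : G.E} (h : m.root = (G.att e false).1)
    (x : TreeSym I (G.contract e).E) :
    m.sym (contractSym e (.inr x)) = contractSymIncl e ((m.contract h).sym x) := by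
  rcases x with x | o
  · have e1 : (m.contract h).sym (.inl x) = ⟨((G.contract e).inc.symm x).1,
      some ((G.contract e).inc.symm x).2⟩ := rfl
    have e2 : m.sym (contractSym e (.inr (.inl x))) =
      ⟨(G.inc.symm (Sum.map id (Prod.map (G.edgeOfContract e) id) x)).1,
        some (G.inc.symm (Sum.map id (Prod.map (G.edgeOfContract e) id) x)).2⟩ := rfl
    rw [e1, e2, ← G.halfOfContract_inc_symm, contractSymIncl_half]
  · rcases o with _ | e'
    · change (⟨m.root, none⟩ : Σ v, Option (G.H v)) = _
      rw [h]; rfl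
    · have e1 : (m.contract h).sym (.inr (some e')) =
        ⟨((G.contract e).att e' (m.dir (G.edgeOfContract e e'))).1, none⟩ := rfl
      rw [e1, G.fst_eq_toContract (congrArg Sigma.fst (G.halfOfContract_att e e' _))
        (m.not_isEnd h (G.edgeOfContract_ne e e'))]
      rfl

theorem Rooting.sym_contractSym_inl {e : G.E} (h : m.root = (G.att e false).1) (t : Option Bool) :
    m.sym (contractSym e (.inl t)) =
      t.elim ⟨(G.att e true).1, none⟩ fun b => ⟨(G.att e b).1, some (G.att e b).2⟩ := by
  rcases t with _ | b
  · change (⟨(G.att e (m.dir e)).1, none⟩ : Σ v, Option (G.H v)) = _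
    rw [m.dir_eq_true h]; rfl
  · rfl

/-- Split off the three symbols of `e`: the vertex at its second end and the two halves. Moving them
to the front costs `-1` in the order of the vertices and `(-1)^(|I|+1)` in the order of the edges.
Their internal orders differ by one transposition, which costs another `-1`. What is left is the
sign of the contracted tree, rooted at the new vertex. -/
theorem Rooting.sign_contract [Finite I] {e : G.E} (h : m.root = (G.att e false).1)
    (he : G.EdgeFirst e) (hne : (G.att e false).1 ≠ (G.att e true).1)
    (r : I ↪ ℕ) (ρ : ∀ v, G.H v ↪ ℕ)
    (s : {a // a ≠ (G.att e false).2} ⊕ {a // a ≠ (G.att e true).2} ↪ ℕ) {N : ℕ}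
    (hs₀ : ∀ a, s (.inl a) < N) (hs₁ : ∀ a, N ≤ s (.inr a))
    (hρ₀ : ρ (G.att e false).1 = endRank (G.att e false).2 (Embedding.inl.trans s))
    (hρ₁ : ρ (G.att e true).1 = endRank (G.att e true).2 (Embedding.inr.trans s)) :
    m.sign r ρ = (Nat.card I + 1 : ℤ).negOnePow *
      (m.contract h).sign r (contractHalfRank (restRank hne s) ρ) := by
  classical
  have hcases := vertexRank_contract_cases hne ρ s hs₀ hs₁ hρ₀ hρ₁
  have hlt := he.ends
  have hv₀ : ∀ v, ¬ G.IsEnd e v → G.rV (G.att e false).1 < G.rV v := fun v hv =>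
    he.vertex _ _ ⟨false, rfl⟩ hv
  have hv₁ : ∀ v, ¬ G.IsEnd e v → G.rV (G.att e true).1 < G.rV v := fun v hv =>
    he.vertex _ _ ⟨true, rfl⟩ hv
  -- The remaining symbols are listed in the same order in both graphs: the new vertex takes the
  -- place of the first end, followed by the half-edges left at the first end and then those left at
  -- the second.
  have hA : ∀ z z', vertexRank (G.contract e).rV (contractHalfRank (restRank hne s) ρ) z <
      vertexRank (G.contract e).rV (contractHalfRank (restRank hne s) ρ) z' →
      vertexRank G.rV ρ (contractSymIncl e z) < vertexRank G.rV ρ (contractSymIncl e z') := by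
    intro z z'
    rcases hcases z with ⟨-, h1, h2⟩ | ⟨-, n, hn, h1, h2⟩ | ⟨-, n, hn, h1, h2⟩ |
      ⟨-, v, n, hv, h1, h2⟩ <;>
    rcases hcases z' with ⟨-, h1', h2'⟩ | ⟨-, n', hn', h1', h2'⟩ | ⟨-, n', hn', h1', h2'⟩ |
      ⟨-, v', n', hv', h1', h2'⟩ <;>
    rw [h1, h1', h2, h2', Prod.Lex.toLex_lt_toLex, Prod.Lex.toLex_lt_toLex] <;>
    (try have a1 := hv₀ _ hv) <;> (try have a2 := hv₀ _ hv') <;>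
    (try have a3 := hv₁ _ hv) <;> (try have a4 := hv₁ _ hv') <;> dsimp only <;> omega
  have b1 : vertexRank G.rV ρ ⟨(G.att e true).1, none⟩ = toLex (G.rV (G.att e true).1, 0) := rfl
  have b2 : ∀ b, vertexRank G.rV ρ ⟨(G.att e b).1, some (G.att e b).2⟩ =
      toLex (G.rV (G.att e b).1, 1) := by
    have : ∀ b, ρ (G.att e b).1 (G.att e b).2 = 0 := by
      rintro (_ | _)
      · rw [hρ₀, endRank_self]
      · rw [hρ₁, endRank_self]
    intro b
    exact congrArg (fun n => toLex (G.rV (G.att e b).1, n + 1)) (this b)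
  -- Each remaining symbol is passed by an even number of the three symbols of `e`, except the
  -- symbol of the first end, which is passed by all three. A half-edge left at the first end
  -- precedes two of them; one left at the second end and all symbols of other vertices precede
  -- none.
  have hAT : ∀ z : Σ w, Option ((G.contract e).H w),
      ((if vertexRank G.rV ρ (contractSymIncl e z) < vertexRank G.rV ρ ⟨(G.att e true).1, none⟩
          then (-1 : ℤˣ) else 1) *
        ((if vertexRank G.rV ρ (contractSymIncl e z) <
          vertexRank G.rV ρ ⟨(G.att e true).1, some (G.att e true).2⟩ then (-1 : ℤˣ) else 1) *
        (if vertexRank G.rV ρ (contractSymIncl e z) <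
          vertexRank G.rV ρ ⟨(G.att e false).1, some (G.att e false).2⟩ then (-1 : ℤˣ) else 1))) =
      if z = ⟨G.newVertex e, none⟩ then -1 else 1 := by
    intro z
    rw [b1, b2, b2]
    rcases hcases z with ⟨hz, -, h2⟩ | ⟨hz, n, hn, -, h2⟩ | ⟨hz, n, hn, -, h2⟩ |
      ⟨hz, v, n, hv, -, h2⟩ <;> rw [h2]
    · rw [if_pos hz]
      simp [Prod.Lex.toLex_lt_toLex, hlt]
    · rw [if_neg hz]
      simp [Prod.Lex.toLex_lt_toLex, hlt]
    · rw [if_neg hz]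
      simp [Prod.Lex.toLex_lt_toLex, hlt.not_gt, hlt.ne']
    · rw [if_neg hz]
      simp [Prod.Lex.toLex_lt_toLex, (hv₀ v hv).not_gt, (hv₁ v hv).not_gt, (hv₀ v hv).ne',
        (hv₁ v hv).ne']
  have hfin := Fintype.ofFinite I
  have h1 : crossing ((vertexRank G.rV ρ ∘ m.sym) ∘ contractSym e) = -1 := by
    unfold crossing
    rw [finprod_eq_prod_of_fintype, Fintype.prod_prod_type, Finset.prod_comm]
    simp only [Fintype.prod_option, Fintype.prod_bool, comp_apply, m.sym_contractSym h,
      m.sym_contractSym_inl h]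
    refine (Finset.prod_congr rfl fun x _ => hAT ((m.contract h).sym x)).trans ?_
    rw [Fintype.prod_eq_single (.inr none)]
    · exact if_pos rfl
    · intro x hx
      refine if_neg fun h' => hx ((m.contract h).sym.injective (h'.trans rfl))
  have h2 : crossing (edgeRank r G.rE m.dir ∘ contractSym e) = (Nat.card I + 1 : ℤ).negOnePow :=
    crossing_edgeRank_removeEdge e r G.rE m.dir he.edge
  -- By vertices the three symbols read: first half, second end, second half. By edges they read:
  -- second end, first half, second half.
  have h3 : reorder (((vertexRank G.rV ρ ∘ m.sym) ∘ contractSym e) ∘ Sum.inl)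
      ((edgeRank r G.rE m.dir ∘ contractSym e) ∘ Sum.inl) = -1 := by
    unfold reorder
    rw [finprod_eq_prod_of_fintype, Fintype.prod_prod_type]
    have c1 : contractSym (I := I) e (.inl none) = .inr (some e) := rfl
    have c2 : ∀ b, contractSym (I := I) e (.inl (some b)) = .inl (.inr (e, b)) := fun _ => rfl
    simp only [comp_apply, m.sym_contractSym_inl h, Fintype.prod_option, Fintype.prod_bool,
      Option.elim, b1, b2, c1, c2]
    simp [edgeRank, Prod.Lex.toLex_lt_toLex, m.dir_eq_true h, hlt, hlt.not_gt, hlt.ne']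
  have h4 : reorder (((vertexRank G.rV ρ ∘ m.sym) ∘ contractSym e) ∘ Sum.inr)
      ((edgeRank r G.rE m.dir ∘ contractSym e) ∘ Sum.inr) =
      (m.contract h).sign r (contractHalfRank (restRank hne s) ρ) := by
    refine reorder_congr (fun x y => ?_) (fun x y => ?_)
    · simp only [comp_apply, m.sym_contractSym h]
      exact (lt_iff_lt_of_imp (vertexRank_injective _ _) hA _ _).symm
    · rcases x with (i | ⟨e', b⟩) | _ | e' <;> rcases y with (i' | ⟨e'', b'⟩) | _ | e'' <;> rfl
  refine (reorder_comp_equiv (contractSym e) _ _).symm.trans ?_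
  rw [reorder_sum ((m.vertexRank_sym_injective ρ).comp (contractSym e).injective)
    ((edgeRank_injective r G.rE m.dir).comp (contractSym e).injective),
    h1, h2, h3, h4, neg_one_mul, neg_mul, neg_mul, mul_neg, mul_one, neg_mul, neg_neg]

end contract

end Graph

end CycFeyn

/-! ### Cutting a tree along an edge -/

namespace CycFeyn

open Function

/-- The symbols of a tree without the leg `none`. -/
def someLegs {K E : Type} : TreeSym K E → TreeSym (Option K) E :=
  Sum.map (Sum.map some id) id

theorem someLegs_injective {K E : Type} : Injective (someLegs (K := K) (E := E)) :=
  Injective.sumMap (Injective.sumMap (Option.some_injective K) injective_id) injective_id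

/-- The symbols of a tree, with the leg `none` apart. -/
def noneLegs {K E : Type} : Unit ⊕ TreeSym K E ≃ TreeSym (Option K) E where
  toFun
    | .inl _ => .inl (.inl none)
    | .inr x => someLegs x
  invFun
    | .inl (.inl none) => .inl ()
    | .inl (.inl (some i)) => .inr (.inl (.inl i))
    | .inl (.inr x) => .inr (.inl (.inr x))
    | .inr o => .inr (.inr o)
  left_inv := by rintro (_ | (i | x) | o) <;> rfl
  right_inv := by rintro (((_ | i) | x) | o) <;> rfl

/-- The sign of moving the leg `none` behind the other legs and the root. -/
theorem reorder_noneLegs {K E L : Type} [Finite K] [Finite E] [LinearOrder L] (r : K ↪ ℕ)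
    (rE : E ↪ ℕ) (dir : E → Bool) {b : TreeSym (Option K) E → L} (hb : Injective b)
    (h : ∀ x y, edgeRank r rE dir x < edgeRank r rE dir y → b (someLegs x) < b (someLegs y))
    (hroot : b (.inr none) < b (.inl (.inl none)))
    (hedge : ∀ e, b (.inl (.inl none)) < b (.inr (some e))) :
    reorder (edgeRank (consRank r) rE dir) b = (Nat.card K + 1 : ℤ).negOnePow := by
  classical
  have := Fintype.ofFinite K
  have := Fintype.ofFinite E
  have hleg : ∀ i, b (.inl (.inl (some i))) < b (.inl (.inl none)) := fun i =>
    (h (.inl (.inl i)) (.inr none) (Prod.Lex.toLex_lt_toLex.2 (.inl Nat.zero_lt_one))).trans hroot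
  have hhalf : ∀ x, b (.inl (.inl none)) < b (.inl (.inr x)) := fun x =>
    (hedge x.1).trans (h (.inr (some x.1)) (.inl (.inr x)) (by
      refine Prod.Lex.toLex_lt_toLex.2 (.inr ⟨rfl, ?_⟩)
      dsimp only
      split_ifs <;> omega))
  have h1 : crossing (edgeRank (consRank r) rE dir ∘ noneLegs) = 1 := by
    refine finprod_eq_one_of_forall_eq_one fun ⟨_, x⟩ => if_neg ?_
    rcases x with (i | ⟨e, c⟩) | _ | e <;>
      simp [noneLegs, someLegs, edgeRank, Prod.Lex.toLex_lt_toLex]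
  have h2 : crossing (b ∘ noneLegs) = (Nat.card K + 1 : ℤ).negOnePow := by
    unfold crossing
    rw [finprod_eq_prod_of_fintype, Fintype.prod_prod_type]
    simp only [Int.negOnePow_add, Int.negOnePow_one]
    simp [noneLegs, someLegs, Fintype.prod_sum_type, Fintype.prod_option, hleg, hroot,
      (hedge _).not_gt, (hhalf _).not_gt, Int.negOnePow_def]
  have h3 : ∀ x y, edgeRank (consRank r) rE dir (someLegs x) <
      edgeRank (consRank r) rE dir (someLegs y) → b (someLegs x) < b (someLegs y) := by
    intro x y hxy
    refine h x y ?_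
    rcases x with (i | ⟨e, c⟩) | _ | e <;> rcases y with (i' | ⟨e', c'⟩) | _ | e' <;>
      simp [someLegs, edgeRank, Prod.Lex.toLex_lt_toLex] at hxy ⊢ <;> exact hxy
  rw [← reorder_comp_equiv noneLegs, reorder_sum ((edgeRank_injective _ _ _).comp
    noneLegs.injective) (hb.comp noneLegs.injective), h1, h2, one_mul]
  have h4 : reorder ((edgeRank (consRank r) rE dir ∘ noneLegs) ∘ Sum.inl)
      ((b ∘ noneLegs) ∘ Sum.inl) = 1 :=
    finprod_eq_one_of_forall_eq_one fun _ => if_neg fun h => h.1.false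
  have h5 : reorder ((edgeRank (consRank r) rE dir ∘ noneLegs) ∘ Sum.inr)
      ((b ∘ noneLegs) ∘ Sum.inr) = 1 := by
    refine (reorder_congr (fun x y => ?_) fun x y => Iff.rfl).trans (reorder_self _)
    exact lt_iff_lt_of_imp ((edgeRank_injective (consRank r) rE dir).comp someLegs_injective) h3 x y
  rw [h4, h5, mul_one, mul_one]

namespace Graph

variable {I J L K : Type}

section side

variable (G : Graph L) {U : G.V → Prop} {j : K → L} {e : G.E} {c : Bool} (h : G.Cut U j e c)

/-- The vertices of a part of a graph, as vertices of the graph. -/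
def sideVertex (v : (G.side h).V) : G.V := Subtype.val (p := U) v

/-- The edges of a part of a graph, as edges of the graph. -/
def sideEdge (e' : (G.side h).E) : G.E := (e' : G.SideE U e).1.1

/-- The half-edges of a part of a graph, as half-edges of the graph. -/
def sideHalf (s : Σ v, (G.side h).H v) : Σ v, G.H v := G.sideIncl U s

/-- The legs and half-edges of edges of a part of a graph, in the graph. -/
def sideEnds (x : Option K ⊕ (G.side h).E × Bool) : L ⊕ G.E × Bool := G.sideLegs U j e c x

theorem sideHalf_inc_symm (x : Option K ⊕ (G.side h).E × Bool) :
    G.sideHalf h ((G.side h).inc.symm x) = G.inc.symm (G.sideEnds h x) := by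
  rw [Equiv.eq_symm_apply]
  exact (G.side_inc h _).symm.trans (congrArg (G.sideLegs U j e c) (Equiv.apply_symm_apply _ x))

theorem sideHalf_att (e' : (G.side h).E) (b : Bool) :
    G.sideHalf h ((G.side h).att e' b) = G.att (G.sideEdge h e') b :=
  G.sideHalf_inc_symm h _

theorem sideVertex_att (e' : (G.side h).E) (b : Bool) :
    G.sideVertex h ((G.side h).att e' b).1 = (G.att (G.sideEdge h e') b).1 :=
  congrArg Sigma.fst (G.sideHalf_att h e' b)

theorem sideEdge_ne (e' : (G.side h).E) : G.sideEdge h e' ≠ e := (e' : G.SideE U e).1.2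

theorem sideEdge_mem (e' : (G.side h).E) (b : Bool) : U (G.att (G.sideEdge h e') b).1 := by
  have h1 : U (G.att (G.sideEdge h e') false).1 := (e' : G.SideE U e).2
  cases b
  · exact h1
  · exact (h.other _ (G.sideEdge_ne h e')).1 h1

/-- The symbols of a part of a tree, as symbols of the tree; the root of the part is the vertex that
belongs to `o`. -/
def sideSym (o : Option G.E) : TreeSym (Option K) (G.side h).E → TreeSym L G.E
  | .inl x => .inl (G.sideEnds h x)
  | .inr none => .inr o
  | .inr (some e') => .inr (some (G.sideEdge h e'))

/-- The vertices and half-edges of a part of a graph, in the graph. -/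
def sideSymIncl (z : Σ v, Option ((G.side h).H v)) : Σ v, Option (G.H v) :=
  ⟨G.sideVertex h z.1, z.2⟩

/-- The order of the half-edges at the vertices of a part of a graph. -/
def sideHalfRank (ρ : ∀ v, G.H v ↪ ℕ) (v : (G.side h).V) : (G.side h).H v ↪ ℕ :=
  ρ (G.sideVertex h v)

variable {G}

theorem Rooting.sym_sideSym {m : Rooting G} {m' : Rooting (G.side h)} {o : Option G.E}
    (hroot : m.equiv o = G.sideVertex h m'.root) (hdir : ∀ e', m.dir (G.sideEdge h e') = m'.dir e')
    (x : TreeSym (Option K) (G.side h).E) :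
    m.sym (G.sideSym h o x) = G.sideSymIncl h (m'.sym x) := by
  rcases x with x | _ | e'
  · have h1 := G.sideHalf_inc_symm h x
    change (⟨(G.inc.symm (G.sideEnds h x)).1, some (G.inc.symm (G.sideEnds h x)).2⟩ :
      Σ v, Option (G.H v)) = _
    rw [← h1]; rfl
  · exact congrArg (fun v => (⟨v, none⟩ : Σ v, Option (G.H v))) hroot
  · refine congrArg (fun v => (⟨v, none⟩ : Σ v, Option (G.H v))) ?_
    change (G.att _ (m.dir (G.sideEdge h e'))).1 = _
    rw [hdir, ← sideVertex_att]; rfl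

/-- In a part of the tree the cut half-edge is the leg `none`, listed before all other legs; in the
whole tree it belongs to the block of `e`, behind the other legs and the root of the part. Moving it
there passes `|K| + 1` odd symbols. The parameter `o` says which symbol of the whole tree is the
root of the part: the root itself or the vertex belonging to `e`. -/
theorem Rooting.reorder_sideSym [Finite K] {m : Rooting G} {m' : Rooting (G.side h)}
    {o : Option G.E} (hroot : m.equiv o = G.sideVertex h m'.root)
    (hdir : ∀ e', m.dir (G.sideEdge h e') = m'.dir e')
    (he : ∀ e', e' ≠ e → G.rE e < G.rE e') (ho : o = none ∨ o = some e)
    (r : L ↪ ℕ) (ρ : ∀ v, G.H v ↪ ℕ) :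
    reorder ((vertexRank G.rV ρ ∘ m.sym) ∘ G.sideSym h o)
      (edgeRank r G.rE m.dir ∘ G.sideSym h o) = (Nat.card K + 1 : ℤ).negOnePow *
      m'.sign (consRank ((⟨j, h.inj⟩ : K ↪ L).trans r)) (G.sideHalfRank h ρ) := by
  have hA : (vertexRank G.rV ρ ∘ m.sym) ∘ G.sideSym h o =
      vertexRank (G.side h).rV (G.sideHalfRank h ρ) ∘ m'.sym := by
    funext x
    exact (congrArg (vertexRank G.rV ρ) (sym_sideSym h hroot hdir x)).trans rfl
  have hinj : Injective (G.sideSym h o) := fun x y hxy => by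
    have h1 := congrArg m.sym hxy
    rw [sym_sideSym h hroot hdir, sym_sideSym h hroot hdir] at h1
    refine m'.sym.injective ?_
    generalize m'.sym x = z at h1
    generalize m'.sym y = z' at h1
    obtain ⟨⟨v, hv⟩, z⟩ := z
    obtain ⟨⟨v', hv'⟩, z'⟩ := z'
    obtain rfl : v = v' := congrArg Sigma.fst h1
    cases h1
    rfl
  have hB := (edgeRank_injective r G.rE m.dir).comp hinj
  rw [hA, ← reorder_trans (b := edgeRank (consRank ((⟨j, h.inj⟩ : K ↪ L).trans r)) (G.side h).rE
    m'.dir) (m'.vertexRank_sym_injective _) (edgeRank_injective _ _ _) hB, mul_comm]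
  -- The first coordinate `b` of the root of the part is 1 if this is the root of the tree, and the
  -- block of `e` otherwise. In both cases it lies after the legs and not after the block of `e`.
  obtain ⟨b, hb, hb₀, hb₁⟩ : ∃ b : ℕ, edgeRank r G.rE m.dir (.inr o) = toLex (b, 0) ∧ 0 < b ∧
      b ≤ G.rE e + 1 + 1 := by
    rcases ho with rfl | rfl
    exacts [⟨1, rfl, by omega, by omega⟩, ⟨_, rfl, by omega, le_rfl⟩]
  have he' := fun e' => he _ (G.sideEdge_ne h e')
  have hnone : (edgeRank r G.rE m.dir ∘ G.sideSym h o) (.inl (.inl none)) =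
    toLex (G.rE e + 1 + 1, if c = m.dir e then 2 else 1) := rfl
  have hroot' : (edgeRank r G.rE m.dir ∘ G.sideSym h o) (.inr none) = toLex (b, 0) := hb
  have hedge : ∀ e', (edgeRank r G.rE m.dir ∘ G.sideSym h o) (.inr (some e')) =
    toLex (G.rE (G.sideEdge h e') + 1 + 1, 0) := fun _ => rfl
  refine congrArg (· * _) (reorder_noneLegs _ _ _ hB ?_ ?_ fun e' => ?_)
  · have hcases : ∀ x : TreeSym K (G.side h).E,
        (∃ n, edgeRank ((⟨j, h.inj⟩ : K ↪ L).trans r) (G.side h).rE m'.dir x = toLex (0, n) ∧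
          (edgeRank r G.rE m.dir ∘ G.sideSym h o) (someLegs x) = toLex (0, n)) ∨
        (edgeRank ((⟨j, h.inj⟩ : K ↪ L).trans r) (G.side h).rE m'.dir x = toLex (1, 0) ∧
          (edgeRank r G.rE m.dir ∘ G.sideSym h o) (someLegs x) = toLex (b, 0)) ∨
        (∃ n i, G.rE e + 1 + 1 < n ∧
          edgeRank ((⟨j, h.inj⟩ : K ↪ L).trans r) (G.side h).rE m'.dir x = toLex (n, i) ∧
          (edgeRank r G.rE m.dir ∘ G.sideSym h o) (someLegs x) = toLex (n, i)) := by
      rintro ((i | ⟨e', b⟩) | _ | e')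
      · exact .inl ⟨_, rfl, rfl⟩
      · refine .inr (.inr ⟨_, _, ?_, rfl, ?_⟩)
        · exact Nat.add_lt_add_right (Nat.add_lt_add_right (he' e') 1) 1
        · rw [← hdir]; rfl
      · exact .inr (.inl ⟨rfl, hroot'⟩)
      · exact .inr (.inr ⟨_, _, Nat.add_lt_add_right (Nat.add_lt_add_right (he' e') 1) 1, rfl, rfl⟩)
    intro x y hxy
    rcases hcases x with ⟨n, h1, h2⟩ | ⟨h1, h2⟩ | ⟨n, i, hn, h1, h2⟩ <;>
      rcases hcases y with ⟨n', h1', h2'⟩ | ⟨h1', h2'⟩ | ⟨n', i', hn', h1', h2'⟩ <;>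
      rw [h1, h1', Prod.Lex.toLex_lt_toLex] at hxy <;>
      rw [h2, h2', Prod.Lex.toLex_lt_toLex] <;> dsimp only at hxy ⊢ <;> omega
  · rw [hnone, hroot', Prod.Lex.toLex_lt_toLex]
    dsimp only
    split_ifs <;> omega
  · rw [hnone, hedge, Prod.Lex.toLex_lt_toLex]
    exact .inl (by have := he' e'; omega)

end side

/-- The edge `e` comes first, and what belongs to `U` comes before what does not. -/
structure CutFirst (G : Graph L) (U : G.V → Prop) (e : G.E) : Prop where
  edge : ∀ e', e' ≠ e → G.rE e < G.rE e'
  edges : ∀ e' e'', e' ≠ e → e'' ≠ e → U (G.att e' false).1 → ¬ U (G.att e'' false).1 →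
    G.rE e' < G.rE e''
  vertex : ∀ v w, U v → ¬ U w → G.rV v < G.rV w

section cut

variable {G : Graph (I ⊕ J)} {U : G.V → Prop} {e : G.E} {c : Bool}
  (h₁ : G.Cut U (Sum.inl : I → I ⊕ J) e c) (h₂ : G.Cut (fun v => ¬ U v) (Sum.inr : J → I ⊕ J) e (!c))

theorem exists_sideEdge {e' : G.E} (h : e' ≠ e) :
    (∃ e'', G.sideEdge h₁ e'' = e') ∨ ∃ e'', G.sideEdge h₂ e'' = e' := by
  by_cases hu : U (G.att e' false).1
  · exact .inl ⟨(⟨⟨e', h⟩, hu⟩ : G.SideE U e), rfl⟩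
  · exact .inr ⟨(⟨⟨e', h⟩, hu⟩ : G.SideE (fun v => ¬ U v) e), rfl⟩

/-- The direction of the edges of a tree that is cut into two rooted parts. -/
noncomputable def cutDir (m₁ : Rooting (G.side h₁)) (m₂ : Rooting (G.side h₂)) (e' : G.E) : Bool :=
  open Classical in
  if he : e' = e then !c
  else if hu : U (G.att e' false).1 then m₁.dir (⟨⟨e', he⟩, hu⟩ : G.SideE U e)
  else m₂.dir (⟨⟨e', he⟩, hu⟩ : G.SideE (fun v => ¬ U v) e)

variable (m₁ : Rooting (G.side h₁)) (m₂ : Rooting (G.side h₂))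

theorem cutDir_self : cutDir h₁ h₂ m₁ m₂ e = !c := dif_pos rfl

theorem cutDir_left (e' : (G.side h₁).E) :
    cutDir h₁ h₂ m₁ m₂ (G.sideEdge h₁ e') = m₁.dir e' := by
  unfold cutDir
  rw [dif_neg (G.sideEdge_ne h₁ e'), dif_pos (G.sideEdge_mem h₁ e' false)]
  rfl

theorem cutDir_right (e' : (G.side h₂).E) :
    cutDir h₁ h₂ m₁ m₂ (G.sideEdge h₂ e') = m₂.dir e' := by
  unfold cutDir
  rw [dif_neg (G.sideEdge_ne h₂ e'), dif_neg (G.sideEdge_mem h₂ e' false)]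
  rfl

variable {m₁ m₂} in
/-- The rooting of a tree that is cut into two rooted parts. -/
noncomputable def Rooting.cut (hr₁ : G.sideVertex h₁ m₁.root = (G.att e c).1)
    (hr₂ : G.sideVertex h₂ m₂.root = (G.att e (!c)).1) : Rooting G where
  root := (G.att e c).1
  dir := cutDir h₁ h₂ m₁ m₂
  bij := by
    classical
    -- The root of the first part becomes the root of the tree, and the root of the second part
    -- becomes the vertex that belongs to the cut edge.
    let F : Option (G.side h₁).E ⊕ Option (G.side h₂).E → Option G.E :=
      Sum.elim (fun o => o.map (G.sideEdge h₁)) (fun o => some (o.elim e (G.sideEdge h₂)))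
    have hF : (fun o : Option G.E => o.elim (G.att e c).1
        fun e => (G.att e (cutDir h₁ h₂ m₁ m₂ e)).1) ∘ F =
        Equiv.sumCompl U ∘ Sum.map m₁.equiv m₂.equiv := by
      funext x
      rcases x with (_ | e') | _ | e'
      · exact hr₁.symm
      · change (G.att _ (cutDir h₁ h₂ m₁ m₂ _)).1 = _
        rw [cutDir_left, ← sideVertex_att]; rfl
      · change (G.att _ (cutDir h₁ h₂ m₁ m₂ e)).1 = _
        rw [cutDir_self]; exact hr₂.symm
      · change (G.att (G.sideEdge h₂ e') (cutDir h₁ h₂ m₁ m₂ (G.sideEdge h₂ e'))).1 = _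
        rw [cutDir_right, ← sideVertex_att]; rfl
    have hb : Bijective (Equiv.sumCompl U ∘ Sum.map m₁.equiv m₂.equiv) :=
      (Equiv.sumCompl U).bijective.comp (Equiv.sumCongr m₁.equiv m₂.equiv).bijective
    rw [← hF] at hb
    refine (Bijective.of_comp_iff _ ⟨hb.1.of_comp, ?_⟩).1 hb
    rintro (_ | e')
    · exact ⟨.inl none, rfl⟩
    · by_cases he : e' = e
      · exact ⟨.inr none, by rw [he]; rfl⟩
      · rcases exists_sideEdge h₁ h₂ he with ⟨e'', rfl⟩ | ⟨e'', rfl⟩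
        exacts [⟨.inl (some e''), rfl⟩, ⟨.inr (some e''), rfl⟩]

/-- Count the pairs in which a symbol of the second part precedes one of the first. Legs against
legs give the block sign. The legs `J` also precede the root and the cut half-edge of the first
part, which cancel, and the three symbols of each edge in `E₁`, which give `|J| |E₁|`. The root of
the second part precedes the cut half-edge of the first, which gives the 1. Finally that root and
the cut half-edge of the second part both precede all symbols of `E₁`, and cancel. -/
theorem _root_.CycFeyn.crossing_cut {E₁ E₂ : Type} [Finite I] [Finite J] [Finite E₁] [Finite E₂]
    {B : TreeSym (Option I) E₁ ⊕ TreeSym (Option J) E₂ → ℕ ×ₗ ℕ} (r : I ⊕ J ↪ ℕ) {n : ℕ}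
    {r₁ : E₁ → ℕ} {r₂ : E₂ → ℕ} {p₁ : E₁ × Bool → ℕ} {p₂ : E₂ × Bool → ℕ} (hn : 1 < n)
    (h₁ : ∀ e, n < r₁ e) (h₂ : ∀ e e', r₁ e < r₂ e') (h₃ : ∀ e, n < r₂ e)
    (a₁ : ∀ i, B (.inl (.inl (.inl (some i)))) = toLex (0, r (.inl i)))
    (a₂ : B (.inl (.inl (.inl none))) = toLex (n, 1))
    (a₃ : ∀ x, B (.inl (.inl (.inr x))) = toLex (r₁ x.1, p₁ x))
    (a₄ : B (.inl (.inr none)) = toLex (1, 0))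
    (a₅ : ∀ e, B (.inl (.inr (some e))) = toLex (r₁ e, 0))
    (b₁ : ∀ i, B (.inr (.inl (.inl (some i)))) = toLex (0, r (.inr i)))
    (b₂ : B (.inr (.inl (.inl none))) = toLex (n, 2))
    (b₃ : ∀ x, B (.inr (.inl (.inr x))) = toLex (r₂ x.1, p₂ x))
    (b₄ : B (.inr (.inr none)) = toLex (n, 0))
    (b₅ : ∀ e, B (.inr (.inr (some e))) = toLex (r₂ e, 0)) :
    crossing B = CyclicData.blockSign r * (1 + Nat.card J * Nat.card E₁ : ℤ).negOnePow := by
  classical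
  have := Fintype.ofFinite I
  have := Fintype.ofFinite J
  have := Fintype.ofFinite E₁
  have := Fintype.ofFinite E₂
  have h₀ : ∀ e, 0 < r₁ e := fun e => by have := h₁ e; omega
  have h₀' : ∀ e, 0 < r₂ e := fun e => by have := h₃ e; omega
  have h₄ : ∀ e, 1 < r₂ e := fun e => by have := h₃ e; omega
  have hn0 : 0 < n := by omega
  simp only [crossing, CyclicData.blockSign, finprod_eq_prod_of_fintype, Fintype.prod_prod_type,
    Fintype.prod_sum_type, Fintype.prod_option, a₁, a₂, a₃, a₄, a₅, b₁, b₂, b₃, b₄, b₅,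
    Prod.Lex.toLex_lt_toLex, (h₂ _ _).not_gt, (h₂ _ _).ne', (h₃ _).not_gt, (h₃ _).ne',
    h₁, (h₄ _).not_gt, (h₄ _).ne', h₀, (h₀' _).ne', hn.not_gt, hn.ne', hn0, Int.negOnePow_add]
  simp [Int.negOnePow_def, zpow_mul, mul_comm, hn0.ne']
  have h := Int.units_mul_self ((-1 : ℤˣ) ^ Fintype.card J)
  generalize ((-1 : ℤˣ) ^ Fintype.card J) = a at *
  rw [mul_comm a, mul_assoc, ← mul_assoc a, h, one_mul]

/-- The symbols of the tree are those of its two parts, the two halves of `e` being the new legs.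
Listed by vertices the first part precedes the second, so nothing crosses there; listed by edges the
crossing is `crossing_cut`. Inside each part, `reorder_sideSym` applies. -/
theorem Rooting.sign_cut [Finite I] [Finite J] (he : G.CutFirst U e)
    (hr₁ : G.sideVertex h₁ m₁.root = (G.att e c).1)
    (hr₂ : G.sideVertex h₂ m₂.root = (G.att e (!c)).1) (r : I ⊕ J ↪ ℕ) (ρ : ∀ v, G.H v ↪ ℕ) :
    (Rooting.cut h₁ h₂ hr₁ hr₂).sign r ρ = CyclicData.blockSign r *
      (1 + Nat.card J * Nat.card (G.side h₁).E : ℤ).negOnePow *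
      ((Nat.card I + 1 : ℤ).negOnePow *
        m₁.sign (consRank (Embedding.inl.trans r)) (G.sideHalfRank h₁ ρ)) *
      ((Nat.card J + 1 : ℤ).negOnePow *
        m₂.sign (consRank (Embedding.inr.trans r)) (G.sideHalfRank h₂ ρ)) := by
  set m := Rooting.cut h₁ h₂ hr₁ hr₂ with hm
  have hroot₁ : m.equiv none = G.sideVertex h₁ m₁.root := hr₁.symm
  have hroot₂ : m.equiv (some e) = G.sideVertex h₂ m₂.root := by
    rw [hr₂]
    exact congrArg (fun b => (G.att e b).1) (cutDir_self h₁ h₂ m₁ m₂)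
  have hdir₁ : ∀ e', m.dir (G.sideEdge h₁ e') = m₁.dir e' := cutDir_left h₁ h₂ m₁ m₂
  have hdir₂ : ∀ e', m.dir (G.sideEdge h₂ e') = m₂.dir e' := cutDir_right h₁ h₂ m₁ m₂
  have hs₁ := Rooting.sym_sideSym h₁ hroot₁ hdir₁
  have hs₂ := Rooting.sym_sideSym h₂ hroot₂ hdir₂
  let F : TreeSym (Option I) (G.side h₁).E ⊕ TreeSym (Option J) (G.side h₂).E →
      TreeSym (I ⊕ J) G.E := Sum.elim (G.sideSym h₁ none) (G.sideSym h₂ (some e))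
  have hF : Bijective F := by
    have h : m.sym ∘ F = Sum.elim (G.sideSymIncl h₁) (G.sideSymIncl h₂) ∘
        Equiv.sumCongr m₁.sym m₂.sym := by
      funext x
      rcases x with x | x
      exacts [hs₁ x, hs₂ x]
    rw [← Bijective.of_comp_iff' m.sym.bijective, h]
    refine Bijective.comp ⟨?_, ?_⟩ (Equiv.bijective _)
    · rintro (⟨v, z⟩ | ⟨v, z⟩) (⟨v', z'⟩ | ⟨v', z'⟩) hz
      · obtain rfl : v = v' := Subtype.ext (congrArg Sigma.fst hz)
        cases hz; rfl
      · have hv : v.1 = v'.1 := congrArg Sigma.fst hz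
        exact absurd (hv ▸ v.2) v'.2
      · have hv : v.1 = v'.1 := congrArg Sigma.fst hz
        exact absurd (hv ▸ v'.2) v.2
      · obtain rfl : v = v' := Subtype.ext (congrArg Sigma.fst hz)
        cases hz; rfl
    · rintro ⟨v, z⟩
      by_cases hv : U v
      exacts [⟨.inl ⟨⟨v, hv⟩, z⟩, rfl⟩, ⟨.inr ⟨⟨v, hv⟩, z⟩, rfl⟩]
  let σ := Equiv.ofBijective F hF
  have c1 : crossing ((vertexRank G.rV ρ ∘ m.sym) ∘ σ) = 1 := by
    refine finprod_eq_one_of_forall_eq_one fun ⟨x, y⟩ => if_neg (not_lt_of_gt ?_)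
    change vertexRank G.rV ρ (m.sym (G.sideSym h₁ none x)) <
      vertexRank G.rV ρ (m.sym (G.sideSym h₂ (some e) y))
    rw [hs₁, hs₂]
    exact Prod.Lex.toLex_lt_toLex.2 (.inl (he.vertex _ _ (m₁.sym x).1.2 (m₂.sym y).1.2))
  have c2 : crossing (edgeRank r G.rE m.dir ∘ σ) = CyclicData.blockSign r *
      (1 + Nat.card J * Nat.card (G.side h₁).E : ℤ).negOnePow := by
    have k₁ := fun e' => he.edge _ (G.sideEdge_ne h₁ e')
    have k₂ := fun e' => he.edge _ (G.sideEdge_ne h₂ e')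
    have hd : m.dir e = !c := cutDir_self h₁ h₂ m₁ m₂
    have hc : (if c = m.dir e then 2 else 1) = 1 := by rw [hd]; cases c <;> rfl
    have hc' : (if (!c) = m.dir e then 2 else 1) = 2 := by rw [hd, if_pos rfl]
    refine crossing_cut (n := G.rE e + 1 + 1) (r₁ := fun e' => G.rE (G.sideEdge h₁ e') + 1 + 1)
      (r₂ := fun e' => G.rE (G.sideEdge h₂ e') + 1 + 1) r (by omega)
      (fun e' => by have := k₁ e'; omega) (fun e' e'' => ?_) (fun e' => by have := k₂ e'; omega)
      (fun _ => rfl) ?_ (fun _ => rfl) rfl (fun _ => rfl)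
      (fun _ => rfl) ?_ (fun _ => rfl) rfl (fun _ => rfl)
    · have := he.edges _ _ (G.sideEdge_ne h₁ e') (G.sideEdge_ne h₂ e'')
        (G.sideEdge_mem h₁ e' false) (G.sideEdge_mem h₂ e'' false)
      omega
    · change toLex (G.rE e + 1 + 1, if c = m.dir e then 2 else 1) = _
      rw [hc]
    · change toLex (G.rE e + 1 + 1, if (!c) = m.dir e then 2 else 1) = _
      rw [hc']
  have r1 := Rooting.reorder_sideSym h₁ hroot₁ hdir₁ he.edge (.inl rfl) r ρ
  have r2 := Rooting.reorder_sideSym h₂ hroot₂ hdir₂ he.edge (.inr rfl) r ρ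
  refine (reorder_comp_equiv σ _ _).symm.trans ?_
  rw [reorder_sum ((m.vertexRank_sym_injective ρ).comp σ.injective)
    ((edgeRank_injective r G.rE m.dir).comp σ.injective), c1, c2, one_mul]
  exact congrArg₂ (· * ·) (congrArg (_ * ·) r1) r2

end cut

end Graph

end CycFeyn

namespace CycFeyn

open Function

/-! ### The sign relating the two orders of decorations and shifts -/

section crossSign

variable {X Y : Type}

/-- The sign of reordering pairs of symbols of degrees `p` and `l` into first the symbols of
degrees `l`, and then those of degrees `p`. -/
noncomputable def crossSign (r : X → ℕ) (p l : X → ℤ) : ℤˣ :=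
  ∏ᶠ x : X × X, if r x.1 < r x.2 then (p x.1 * l x.2).negOnePow else 1

theorem crossSign_equiv (e : X ≃ Y) (r : Y → ℕ) (p l : Y → ℤ) :
    crossSign (r ∘ e) (p ∘ e) (l ∘ e) = crossSign r p l :=
  finprod_eq_of_bijective _ (e.prodCongr e).bijective fun _ => rfl

/-- Two ways to permute the pairs of symbols and separate the shifts from the decorations give the
same sign. Concretely, expand `(p x + l x)(p y + l y)` for an inverted pair: the mixed terms are
exactly the change of `crossSign`. -/
theorem crossSign_koszul [Finite X] {r r' : X → ℕ} (hr : Injective r) (hr' : Injective r')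
    (p l : X → ℤ) : crossSign r' p l * (koszul r r' l * koszul r r' p) =
      koszul r r' (fun x => p x + l x) * crossSign r p l := by
  classical
  have := Fintype.ofFinite X
  have h : crossSign r' p l =
      (∏ x : X × X, if r' x.1 < r' x.2 ∧ r x.1 < r x.2 then (p x.1 * l x.2).negOnePow else 1) *
      ∏ x : X × X, if r x.1 < r x.2 ∧ r' x.2 < r' x.1 then (p x.2 * l x.1).negOnePow else 1 := by
    rw [Fintype.prod_equiv (Equiv.prodComm X X)
      (fun x => if r x.1 < r x.2 ∧ r' x.2 < r' x.1 then (p x.2 * l x.1).negOnePow else 1)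
      (fun x => if r x.2 < r x.1 ∧ r' x.1 < r' x.2 then (p x.1 * l x.2).negOnePow else 1)
      fun x => rfl, crossSign, finprod_eq_prod_of_fintype, ← Finset.prod_mul_distrib]
    refine Finset.prod_congr rfl fun x _ => ?_
    rcases eq_or_ne x.1 x.2 with hx | hx
    · simp [hx]
    · rcases lt_or_gt_of_ne (hr.ne hx) with h1 | h1 <;>
        rcases lt_or_gt_of_ne (hr'.ne hx) with h2 | h2 <;>
        simp [h1, h2, h1.not_gt, h2.not_gt]
  rw [h]
  simp only [crossSign, koszul, finprod_eq_prod_of_fintype, ← Finset.prod_mul_distrib]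
  refine Finset.prod_congr rfl fun x _ => ?_
  rcases eq_or_ne x.1 x.2 with hx | hx
  · simp [hx]
  · rcases lt_or_gt_of_ne (hr.ne hx) with h1 | h1 <;>
      rcases lt_or_gt_of_ne (hr'.ne hx) with h2 | h2 <;>
      simp only [h1, h2, h1.not_gt, h2.not_gt, and_true, and_false, if_true, if_false, one_mul,
        mul_one, ← Int.negOnePow_add]
    rw [Int.negOnePow_eq_iff]
    exact ⟨- (p x.1 * l x.2), by ring⟩

/-- The decoration of `v` is passed by the shifts of the later vertices, so lowering its degree by
one changes the sign once for each unit of these shifts. -/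
theorem crossSign_lowerDeg [Fintype X] (r : X → ℕ) (p l : X → ℤ) (v : X) :
    crossSign r p l = crossSign r (ModularData.lowerDeg p v) l *
      (∑ w with r v < r w, l w).negOnePow := by
  classical
  simp only [crossSign, finprod_eq_prod_of_fintype, Fintype.prod_prod_type]
  rw [← Finset.mul_prod_erase _ _ (Finset.mem_univ v),
    ← Finset.mul_prod_erase _ (fun x => ∏ y, if r x < r y then
      (ModularData.lowerDeg p v x * l y).negOnePow else 1) (Finset.mem_univ v), mul_right_comm]
  congr 1
  · rw [negOnePow_prod, Finset.prod_filter, ← Finset.prod_mul_distrib]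
    refine Finset.prod_congr rfl fun w _ => ?_
    split_ifs
    · rw [← Int.negOnePow_add, ← ModularData.lowerDeg_self p v]
      congr 1
      ring
    · rw [one_mul]
  · refine Finset.prod_congr rfl fun x hx => ?_
    rw [ModularData.lowerDeg_ne p (Finset.ne_of_mem_erase hx)]

/-- All of `X` precedes all of `Y`, so every shift in `Y` passes every decoration in `X`. -/
theorem crossSign_sum [Fintype X] [Fintype Y] (r : X ⊕ Y → ℕ) (h : ∀ x y, r (.inl x) < r (.inr y))
    (p l : X ⊕ Y → ℤ) : crossSign r p l = crossSign (r ∘ Sum.inl) (p ∘ Sum.inl) (l ∘ Sum.inl) *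
      crossSign (r ∘ Sum.inr) (p ∘ Sum.inr) (l ∘ Sum.inr) *
      ((∑ x, p (.inl x)) * ∑ y, l (.inr y)).negOnePow := by
  classical
  simp only [crossSign, finprod_eq_prod_of_fintype, Fintype.prod_prod_type, Fintype.prod_sum_type,
    h, (h _ _).not_gt, if_true, if_false, comp_apply, Finset.prod_mul_distrib,
    Finset.prod_const_one, Finset.sum_mul_sum, negOnePow_prod]
  exact (congrArg₂ (· * ·) (mul_one _) (mul_comm _ _)).trans (mul_assoc _ _ _).symm

theorem crossSign_consRank [Fintype X] (r : X ↪ ℕ) (p l : Option X → ℤ) :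
    crossSign (consRank r) p l = crossSign r (fun x => p (some x)) (fun x => l (some x)) *
      (p none * ∑ x, l (some x)).negOnePow := by
  classical
  simp only [crossSign, finprod_eq_prod_of_fintype, Fintype.prod_prod_type, Fintype.prod_option,
    consRank_none, consRank_some, Finset.mul_sum, negOnePow_prod]
  simp [mul_comm]

theorem crossSign_bool (r : Bool → ℕ) (h : r false < r true) (p l : Bool → ℤ) :
    crossSign r p l = (p false * l true).negOnePow := by
  simp [crossSign, finprod_eq_prod_of_fintype, Fintype.prod_prod_type, h, h.not_gt]

/-- Merging the first two symbols. -/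
theorem crossSign_merge [Fintype X] (r : Bool ⊕ X → ℕ) (r' : X ↪ ℕ) (hr : ∀ x, r (.inr x) = r' x)
    (h₀ : r (.inl false) < r (.inl true)) (h : ∀ b x, r (.inl b) < r (.inr x))
    (p l : Bool ⊕ X → ℤ) (p' l' : Option X → ℤ) (hp : ∀ x, p' (some x) = p (.inr x))
    (hl : ∀ x, l' (some x) = l (.inr x)) (hp₀ : p' none = p (.inl false) + p (.inl true)) :
    crossSign r p l = (p (.inl false) * l (.inl true)).negOnePow *
      crossSign (consRank r') p' l' := by
  -- The merged symbol is the first one, so its own shift passes nothing and its value is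
  -- irrelevant; the later shifts pass the sum of the two merged degrees.
  rw [crossSign_sum r h, crossSign_bool _ h₀, crossSign_consRank, mul_assoc]
  simp only [hp, hl, hp₀, Fintype.sum_bool, add_comm (p (.inl true))]
  have : r ∘ Sum.inr = r' := funext hr
  rw [this]
  rfl

end crossSign

/-! ### The total sign of a rooted tree -/

/-- A sign that depends only on the number of legs. -/
def legSign : ℕ → ℤˣ
  | 0 => -1
  | n + 1 => legSign n * (n + 1 : ℤ).negOnePow

/-- This equation is the reason for `legSign`: grafting trees with `a + 1` and `b + 1` legs leaves
`a + b` legs and an unwanted sign `(-1)^((a+1)(b+1))`, which the correction absorbs. The value `-1`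
at 0 is forced by the case `a = b = 0`. -/
theorem legSign_add (a b : ℕ) : legSign (a + b) =
    legSign (a + 1) * legSign (b + 1) * ((a + 1 : ℤ) * (b + 1)).negOnePow := by
  induction b with
  | zero =>
    have h := Int.units_mul_self (a + 1 : ℤ).negOnePow
    simp only [legSign, Nat.cast_zero, zero_add, mul_one, Int.negOnePow_one, add_zero]
    rw [mul_comm (-1 : ℤˣ) (-1), Int.units_mul_self, mul_one, mul_assoc, h, mul_one]
  | succ b ih =>
    rw [← add_assoc, legSign, ih, legSign.eq_2 (b + 1), mul_assoc, ← mul_assoc (legSign (a + 1)),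
      mul_assoc (legSign (a + 1) * _), ← Int.negOnePow_add, ← Int.negOnePow_add]
    congr 1
    rw [Int.negOnePow_eq_iff]
    push_cast
    exact ⟨-1, by ring⟩

namespace Graph

variable {I J K L : Type}

/-- The degree of the shift of the decoration of a vertex. -/
noncomputable def shift (G : Graph I) (v : G.V) : ℤ := 3 - Nat.card (G.H v)

theorem sum_card (G : Graph I) [Finite I] :
    ∑ v, Nat.card (G.H v) = Nat.card I + 2 * Fintype.card G.E := by
  rw [← Nat.card_sigma, Nat.card_congr G.inc, Nat.card_sum, Nat.card_prod]
  simp [mul_comm]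

/-- The numerical shadow of the isomorphism: the shifts at the vertices add up to one unit for each
edge plus the shift `3 - |I|` of the suspension. This holds since `|V| = |E| + 1` and the half-edges
number `|I| + 2|E|`. -/
theorem IsStable.sum_shift {G : Graph I} [Finite I] (hG : G.IsStable 0) :
    ∑ v, G.shift v = Fintype.card G.E + 3 - Nat.card I := by
  have h1 := G.sum_card
  have h2 := hG.card_eq
  simp only [shift, Finset.sum_sub_distrib, Finset.sum_const, Finset.card_univ, ← h2]
  zify at h1
  rw [h1, nsmul_eq_mul]
  push_cast
  ring

namespace Rooting

variable {G G' : Graph I}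

/-- The sign relating forms on decorations by an operad and forms on decorations by its
suspension. -/
noncomputable def totalSign (m : Rooting G) (p : G.V → ℤ) (r : I ↪ ℕ) (ρ : ∀ v, G.H v ↪ ℕ) : ℤˣ :=
  legSign (Nat.card I) * crossSign G.rV p G.shift * m.sign r ρ

theorem totalSign_relabel (m : Rooting G) (f : I ≃ J) (p : G.V → ℤ) (r : J ↪ ℕ)
    (ρ : ∀ v, G.H v ↪ ℕ) :
    (m.relabel f).totalSign p r ρ = m.totalSign p (f.toEmbedding.trans r) ρ :=
  congrArg₂ (fun n s => legSign n * crossSign G.rV p G.shift * s) (Nat.card_congr f).symm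
    (m.sign_relabel f r ρ)

variable [Finite I]

theorem totalSign_rank (m : Rooting G) (p : G.V → ℤ) (r r' : I ↪ ℕ) (ρ : ∀ v, G.H v ↪ ℕ) :
    m.totalSign p r' ρ = koszul r r' (fun _ => 1) * m.totalSign p r ρ := by
  rw [totalSign, m.sign_rank r r', totalSign, mul_left_comm]

/-- New orders of the half-edges only move symbols inside the vertex blocks. -/
theorem totalSign_halfRank (m : Rooting G) (p : G.V → ℤ) (r : I ↪ ℕ) (ρ ρ' : ∀ v, G.H v ↪ ℕ) :
    m.totalSign p r ρ' = (∏ v, koszul (ρ v) (ρ' v) (fun _ => 1)) * m.totalSign p r ρ := by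
  have h := reorder_trans (b := vertexRank G.rV ρ ∘ m.sym) (m.vertexRank_sym_injective ρ')
    (m.vertexRank_sym_injective ρ) (edgeRank_injective r G.rE m.dir)
  have h3 : koszul G.rV G.rV (fun v => Nat.card (G.H v) + 1) = 1 := koszul_self _ _
  rw [reorder_symm, reorder_comp_equiv m.sym, reorder_vertexRank, h3, mul_one,
    finprod_eq_prod_of_fintype] at h
  rw [totalSign, sign, ← h, totalSign, mul_left_comm]
  rfl

/-- The total sign converts one naturality rule into the other. The Koszul sign of the edges in
`sign_map` cancels that of `Det(E)`, and the sign of permuting the vertex blocks combines with that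
of the decorations, through `crossSign_koszul`, to the Koszul sign of the suspended degrees. -/
theorem totalSign_map (m : Rooting G) (f : Iso G G') {p : G.V → ℤ} {p' : G'.V → ℤ}
    (hp : ∀ u, p u = p' (f.v u)) (r : I ↪ ℕ) (ρ : ∀ v, G'.H v ↪ ℕ) :
    (m.map f).totalSign p' r ρ *
      (koszul G.rE (G'.rE ∘ f.e) (fun _ => 1) * koszul G.rV (G'.rV ∘ f.v) p) =
      koszul G.rV (G'.rV ∘ f.v) (fun v => p v + G.shift v) *
        m.totalSign p r (fun u => (f.h u).toEmbedding.trans (ρ (f.v u))) := by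
  have hl : G.shift = G'.shift ∘ f.v := funext fun u => by
    simp only [shift, comp_apply, Nat.card_congr (f.h u)]
  have h1 : crossSign G'.rV p' G'.shift = crossSign (G'.rV ∘ f.v) p G.shift := by
    rw [← crossSign_equiv f.v, hl, show p = p' ∘ f.v from funext hp]
  have h2 := crossSign_koszul G.rV.injective (G'.rV.injective.comp f.v.injective) p G.shift
  have h3 := m.sign_map f r (fun u => (f.h u).toEmbedding.trans (ρ (f.v u))) ρ
  have h4 : (∏ᶠ v, koszul ((f.h v).toEmbedding.trans (ρ (f.v v))) (ρ (f.v v) ∘ f.h v)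
      (fun _ => 1)) = 1 := finprod_eq_one_of_forall_eq_one fun v => koszul_self _ _
  -- `|H| + 1` and `3 - |H|` have the same parity.
  have h5 : koszul G.rV (G'.rV ∘ f.v) (fun v => Nat.card (G.H v) + 1) =
      koszul G.rV (G'.rV ∘ f.v) G.shift := by
    refine finprod_congr fun x => if_congr Iff.rfl ?_ rfl
    rw [Int.negOnePow_eq_iff]
    exact ⟨2 * Nat.card (G.H x.1) + 2 * Nat.card (G.H x.2) - 4, by simp only [shift]; ring⟩
  rw [h4, one_mul, h5] at h3
  rw [totalSign, totalSign, h1, h3]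
  rw [← h3, mul_comm (koszul _ _ (fun v => p v + G.shift v)), mul_assoc _ (m.sign _ _),
    mul_comm (m.sign _ _)]
  generalize koszul G.rV (G'.rV ∘ f.v) (fun v => p v + G.shift v) = a at *
  rw [h3]
  have h6 := Int.units_mul_self (koszul G.rE (G'.rE ∘ f.e) (fun _ => 1))
  generalize koszul G.rE (G'.rE ∘ f.e) (fun _ => 1) = b at *
  generalize koszul G.rV (G'.rV ∘ f.v) p = d at *
  generalize koszul G.rV (G'.rV ∘ f.v) G.shift = d' at *
  generalize crossSign (G'.rV ∘ f.v) p G.shift = x at *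
  generalize crossSign G.rV p G.shift = x' at *
  generalize m.sign _ _ = s at *
  calc _ = legSign (Nat.card I) * (x * (d' * d)) * (b * b) * s := by ac_rfl
    _ = _ := by rw [h2, h6, mul_one]; ac_rfl

/-- On the left the differential passes the edges and the earlier decorations, and lowering the
degree produces the shifts of the later vertices. As all the shifts add up to `|E| + 3 - |I|`, the
later ones and the edges can be traded for `3 - |I|`, the earlier shifts and the shift of `v`
itself, which are the signs in the suspension. -/
theorem totalSign_lowerDeg (m : Rooting G) (hG : G.IsStable 0) (p : G.V → ℤ) (v : G.V)
    (r : I ↪ ℕ) (ρ : ∀ v, G.H v ↪ ℕ) :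
    m.totalSign p r ρ * (Fintype.card G.E + ∑ u with G.rV u < G.rV v, p u : ℤ).negOnePow =
      (3 - Nat.card I + ∑ u with G.rV u < G.rV v, (p u + G.shift u) + G.shift v : ℤ).negOnePow *
        m.totalSign (ModularData.lowerDeg p v) r ρ := by
  classical
  have h : ∑ u, G.shift u = ∑ u with G.rV u < G.rV v, G.shift u + G.shift v +
      ∑ u with G.rV v < G.rV u, G.shift u := by
    rw [← Finset.sum_filter_add_sum_filter_not Finset.univ (fun u => G.rV u < G.rV v), add_assoc]
    congr 1
    rw [← Finset.sum_filter_add_sum_filter_not (Finset.univ.filter fun u => ¬ G.rV u < G.rV v)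
      (fun u => u = v), Finset.filter_filter, Finset.filter_filter]
    have e1 : (Finset.univ.filter fun u => ¬ G.rV u < G.rV v ∧ u = v) = {v} := by
      ext u
      simp only [Finset.mem_filter, Finset.mem_univ, true_and, Finset.mem_singleton]
      exact ⟨fun h => h.2, by rintro rfl; exact ⟨lt_irrefl _, rfl⟩⟩
    have e2 : (Finset.univ.filter fun u => ¬ G.rV u < G.rV v ∧ ¬ u = v) =
        Finset.univ.filter fun u => G.rV v < G.rV u := by
      ext u
      simp only [Finset.mem_filter, Finset.mem_univ, true_and, not_lt]
      exact ⟨fun h => lt_of_le_of_ne h.1 fun h' => h.2 (G.rV.injective h').symm,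
        fun h => ⟨h.le, by rintro rfl; exact h.false⟩⟩
    rw [e1, e2, Finset.sum_singleton]
  rw [hG.sum_shift] at h
  rw [totalSign, totalSign, crossSign_lowerDeg G.rV p G.shift v, Finset.sum_add_distrib]
  generalize ∑ u with G.rV u < G.rV v, p u = a at *
  generalize ∑ u with G.rV u < G.rV v, G.shift u = b at *
  generalize ∑ u with G.rV v < G.rV u, G.shift u = d at *
  have h' : d.negOnePow * (Fintype.card G.E + a : ℤ).negOnePow =
      (3 - Nat.card I + (a + b) + G.shift v : ℤ).negOnePow := by
    rw [← Int.negOnePow_add, Int.negOnePow_eq_iff]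
    exact ⟨Fintype.card G.E - b - G.shift v, by linear_combination -h⟩
  rw [← h']
  ac_rfl

/-- Contraction merges the first two vertices. Besides the change of the tree sign in
`sign_contract`, `crossSign_merge` leaves one factor: the shift at the second end passing the
decoration of the first. The composition of the suspension has the same factor. -/
theorem totalSign_contract (m : Rooting G) {e : G.E} (h : m.root = (G.att e false).1)
    (he : G.EdgeFirst e) (hne : (G.att e false).1 ≠ (G.att e true).1)
    {p : G.V → ℤ} {p' : (G.contract e).V → ℤ} (hp : ∀ v hv, p' (G.toContract (v := v) hv) = p v)
    (hp₀ : p' (G.newVertex e) = p (G.att e false).1 + p (G.att e true).1)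
    (r : I ↪ ℕ) (ρ : ∀ v, G.H v ↪ ℕ)
    (s : {a // a ≠ (G.att e false).2} ⊕ {a // a ≠ (G.att e true).2} ↪ ℕ) {N : ℕ}
    (hs₀ : ∀ a, s (.inl a) < N) (hs₁ : ∀ a, N ≤ s (.inr a))
    (hρ₀ : ρ (G.att e false).1 = endRank (G.att e false).2 (Embedding.inl.trans s))
    (hρ₁ : ρ (G.att e true).1 = endRank (G.att e true).2 (Embedding.inr.trans s)) :
    m.totalSign p r ρ = (Nat.card I + 1 : ℤ).negOnePow *
      (p (G.att e false).1 * G.shift (G.att e true).1).negOnePow *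
      (m.contract h).totalSign p' r (contractHalfRank (restRank hne s) ρ) := by
  classical
  let ι : Bool ⊕ {v // ¬ G.IsEnd e v} ≃ G.V := Equiv.ofBijective
    (Sum.elim (fun b => (G.att e b).1) Subtype.val) (by
      constructor
      · rintro (b | v) (b' | v') hv
        · cases b <;> cases b'
          exacts [rfl, absurd hv hne, absurd hv.symm hne, rfl]
        · exact absurd ⟨b, hv⟩ v'.2
        · exact absurd ⟨b', hv.symm⟩ v.2
        · exact congrArg Sum.inr (Subtype.ext hv)
      · intro v
        by_cases hv : G.IsEnd e v
        · obtain ⟨b, rfl⟩ := hv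
          exact ⟨.inl b, rfl⟩
        · exact ⟨.inr ⟨v, hv⟩, rfl⟩)
  have h1 : crossSign G.rV p G.shift =
      (p (G.att e false).1 * G.shift (G.att e true).1).negOnePow *
      crossSign (G.contract e).rV p' (G.contract e).shift := by
    rw [← crossSign_equiv ι]
    exact crossSign_merge (X := {v // ¬ G.IsEnd e v}) _ ((Embedding.subtype _).trans G.rV)
      (fun _ => rfl) he.ends (fun b x => he.vertex _ _ ⟨b, rfl⟩ x.2) _ _ p' (G.contract e).shift
      (fun v => hp v.1 v.2) (fun _ => rfl) hp₀
  rw [totalSign, totalSign, m.sign_contract h he hne r ρ s hs₀ hs₁ hρ₀ hρ₁, h1]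
  ac_rfl

end Rooting

section cut

variable [Finite I] [Finite J] {G : Graph (I ⊕ J)} {U : G.V → Prop} {e : G.E} {c : Bool}
  (h₁ : G.Cut U (Sum.inl : I → I ⊕ J) e c) (h₂ : G.Cut (fun v => ¬ U v) (Sum.inr : J → I ⊕ J) e (!c))
  {m₁ : Rooting (G.side h₁)} {m₂ : Rooting (G.side h₂)}

/-- Here `sign_cut`, `crossSign_sum` and `legSign_add` meet. What remains is a congruence modulo 2
between quadratic exponents in the numbers of legs and edges and the total degree of the first part.
-/
theorem Rooting.totalSign_cut (he : G.CutFirst U e)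
    (hr₁ : G.sideVertex h₁ m₁.root = (G.att e c).1)
    (hr₂ : G.sideVertex h₂ m₂.root = (G.att e (!c)).1) (hG : (G.side h₂).IsStable 0)
    (p : G.V → ℤ) {n : ℤ}
    (hn : n + Fintype.card (G.side h₁).E + ∑ v, p (G.sideVertex h₁ v) = 0)
    (r : I ⊕ J ↪ ℕ) (ρ : ∀ v, G.H v ↪ ℕ) :
    (Rooting.cut h₁ h₂ hr₁ hr₂).totalSign p r ρ *
      (Fintype.card (G.side h₂).E * ∑ v, p (G.sideVertex h₁ v)).negOnePow =
      CyclicData.blockSign r * ((n + Nat.card I - 2) * (2 - Nat.card J)).negOnePow *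
      (m₁.totalSign (fun v => p (G.sideVertex h₁ v)) (consRank (Embedding.inl.trans r))
        (G.sideHalfRank h₁ ρ) *
      m₂.totalSign (fun v => p (G.sideVertex h₂ v)) (consRank (Embedding.inr.trans r))
        (G.sideHalfRank h₂ ρ)) := by
  classical
  have h1 : crossSign G.rV p G.shift =
      crossSign (G.side h₁).rV (fun v => p (G.sideVertex h₁ v)) (G.side h₁).shift *
      crossSign (G.side h₂).rV (fun v => p (G.sideVertex h₂ v)) (G.side h₂).shift *
      ((∑ v, p (G.sideVertex h₁ v)) * ∑ v, (G.side h₂).shift v).negOnePow := by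
    rw [← crossSign_equiv (Equiv.sumCompl U)]
    exact (@crossSign_sum _ _ (G.side h₁).finV (G.side h₂).finV (G.rV ∘ Equiv.sumCompl U)
      (fun x y => he.vertex _ _ x.2 y.2) (p ∘ Equiv.sumCompl U) (G.shift ∘ Equiv.sumCompl U))
  rw [hG.sum_shift] at h1
  rw [totalSign, totalSign, totalSign, sign_cut h₁ h₂ m₁ m₂ he, h1, Nat.card_sum, legSign_add,
    Finite.card_option, Finite.card_option, Nat.card_eq_fintype_card (α := (G.side h₁).E)]
  generalize ∑ v, p (G.sideVertex h₁ v) = a at *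
  push_cast
  generalize (Nat.card I : ℤ) = i at *
  generalize (Nat.card J : ℤ) = j at *
  generalize (Fintype.card (G.side h₁).E : ℤ) = e₁ at *
  generalize (Fintype.card (G.side h₂).E : ℤ) = e₂ at *
  have key : ((i + 1) * (j + 1)).negOnePow * (a * (e₂ + 3 - (j + 1))).negOnePow *
      (1 + j * e₁).negOnePow * (i + 1).negOnePow * (j + 1).negOnePow * (e₂ * a).negOnePow =
      ((n + i - 2) * (2 - j)).negOnePow := by
    simp only [← Int.negOnePow_add]
    rw [Int.negOnePow_eq_iff]
    -- The congruence needs the degree condition, which expresses the degree of the first form by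
    -- its edges and decorations.
    obtain rfl : n = - e₁ - a := by linarith
    exact ⟨i * j + 4 + a * e₂ + 2 * a - a * j + e₁, by ring⟩
  rw [← key]
  generalize legSign _ = x1
  generalize legSign _ = x2
  ac_rfl

end cut

end Graph

end CycFeyn

/-! ### The isomorphism of graded vector spaces -/

namespace CycFeyn

open Function ModularData

namespace Graph

variable {I : Type}

/-- The degrees of the decorations by an operad that correspond to decorations of degrees `q` by its
suspension. -/
noncomputable def lower (G : Graph I) (q : G.V → ℤ) : G.V → ℤ := fun v => q v + Nat.card (G.H v) - 3

theorem lower_add_shift (G : Graph I) (q : G.V → ℤ) (v : G.V) :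
    G.lower q v + G.shift v = q v := by
  simp only [lower, shift]; ring

theorem lower_raise (G : Graph I) (p : G.V → ℤ) : G.lower (fun v => p v + G.shift v) = p := by
  funext v
  simp only [lower, shift]; ring

theorem lower_injective (G : Graph I) : Injective G.lower := fun q q' h => by
  funext v
  rw [← G.lower_add_shift q, h, lower_add_shift]

/-- Orders of the half-edges at the vertices. -/
noncomputable def halfRank (G : Graph I) (v : G.V) : G.H v ↪ ℕ :=
  (Finite.equivFin (G.H v)).toEmbedding.trans Fin.valEmbedding

/-- The sign relating forms on decorations of a tree by an operad and forms on decorations by its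
suspension. -/
noncomputable def treeSign (G : Graph I) (p : G.V → ℤ) (r : I ↪ ℕ) (ρ : ∀ v, G.H v ↪ ℕ) : ℤˣ :=
  open Classical in if h : Nonempty (Rooting G) then h.some.totalSign p r ρ else 1

/-- The arbitrary choice of a rooting in `treeSign` is harmless by `IsStable.sign_eq`, so in each
computation the most convenient rooting may be used. -/
theorem IsStable.treeSign_eq [Finite I] {G : Graph I} (hG : G.IsStable 0) (m : Rooting G)
    (p : G.V → ℤ) (r : I ↪ ℕ) (ρ : ∀ v, G.H v ↪ ℕ) : G.treeSign p r ρ = m.totalSign p r ρ := by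
  have h : Nonempty (Rooting G) := ⟨m⟩
  rw [treeSign, dif_pos h, Rooting.totalSign, hG.sign_eq _ m]
  rfl

end Graph

theorem sgn_mul_self {k : Type u} [Field k] (s : ℤˣ) : sgn k s * sgn k s = 1 := by
  rw [← sgn_mul, Int.units_mul_self]
  simp [sgn]

theorem sgn_prod {k : Type u} [Field k] {X : Type} (s : Finset X) (f : X → ℤˣ) :
    sgn k (∏ x ∈ s, f x) = ∏ x ∈ s, sgn k (f x) := by
  simp [sgn]

namespace CyclicOperad

variable {k : Type u} [Field k] (A : CyclicOperad.{u, w} k) {I J : Type}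

/-- The suspension of a cyclic operad, as decorations of the vertices of graphs. -/
noncomputable abbrev susp : ModularData.{u, w} k 1 :=
  A.suspension.toDecoration (CyclicData.suspension_equivariant A.equivariant)

/-- A cyclic operad, as decorations of the vertices of graphs. -/
abbrev ext : ModularData.{u, w} k 0 := A.toModular.toModularData

/-- The map of `A(I)` to `Ã(g, I)`. -/
def toExt (g : ℕ) {n : ℤ} : A.obj I n →ₗ[k] A.ext.obj g I n := A.incl g

/-- The projection of `Ã(g, I)` to `A(I)`. -/
def ofExt (g : ℕ) {n : ℤ} : A.ext.obj g I n →ₗ[k] A.obj I n := A.proj g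

theorem toExt_ofExt {g : ℕ} {n : ℤ} (x : A.ext.obj g I n) : A.toExt g (A.ofExt g x) = x :=
  A.incl_proj x

theorem ofExt_toExt {g : ℕ} (hg : g = 0) {n : ℤ} (x : A.obj I n) : A.ofExt g (A.toExt g x) = x :=
  A.proj_incl hg x

theorem cast_toExt {g g' : ℕ} {n n' : ℤ} (hg : g = g') (hn : n = n') (f : I ≃ J) (x : A.obj I n) :
    A.ext.cast hg hn f (A.toExt g x) = A.toExt g' (A.mapCast hn f x) := by
  subst hg hn
  cases g <;> rfl

theorem ofExt_cast {g g' : ℕ} {n n' : ℤ} (hg : g = g') (hn : n = n') (f : I ≃ J)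
    (x : A.ext.obj g I n) : A.ofExt g' (A.ext.cast hg hn f x) = A.mapCast hn f (A.ofExt g x) := by
  subst hg hn
  cases g
  · rfl
  · exact (map_zero (A.map f)).symm

section alternating

variable {M : Type w} [AddCommGroup M] [Module k M]

variable (k M) in
/-- The value of an alternating function. -/
def valueAt (r : I ↪ ℕ) : CyclicData.alternating k I M →ₗ[k] M :=
  LinearMap.proj r ∘ₗ Submodule.subtype _

variable (k M) in
/-- The alternating function with a given value. -/
noncomputable def withValueAt [Finite I] (r : I ↪ ℕ) : M →ₗ[k] CyclicData.alternating k I M where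
  toFun x := ⟨fun r' => koszul r r' (fun _ => 1) • x, fun r' r'' => by
    have h := reorder_trans r.injective r'.injective r''.injective
    dsimp only
    rw [smul_smul, koszul_one, koszul_one, koszul_one, ← h, mul_comm]⟩
  map_add' x y := by ext r; simp
  map_smul' c x := by ext r; simp [smul_comm c]

theorem valueAt_withValueAt [Finite I] (r : I ↪ ℕ) (x : M) :
    valueAt k M r (withValueAt k M r x) = x := by
  change koszul r r (fun _ => 1) • x = x
  rw [koszul_self, one_smul]

theorem withValueAt_valueAt [Finite I] (r : I ↪ ℕ) (y : CyclicData.alternating k I M) :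
    withValueAt k M r (valueAt k M r y) = y :=
  Subtype.ext (funext fun r' => (y.2 r r').symm)

theorem valueAt_rank (r r' : I ↪ ℕ) (y : CyclicData.alternating k I M) :
    valueAt k M r' y = sgn k (koszul r r' (fun _ => 1)) • valueAt k M r y := by
  rw [← units_smul_eq]
  exact y.2 r r'

end alternating

theorem susp_cast_apply {g g' : ℕ} {n n' : ℤ} (hg : g = g') (hn : n = n') (f : I ≃ J)
    (x : A.susp.obj g I n) (r : J ↪ ℕ) : valueAt k _ r (A.susp.cast hg hn f x) =
      A.mapCast (by rw [hn, Nat.card_congr f]) f (valueAt k _ (f.toEmbedding.trans r) x) := by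
  subst hg hn
  rfl

/-- The value of a decoration by the suspension at orders of the half-edges. -/
noncomputable def evalAt (G : Graph I) (q : G.V → ℤ) (ρ : ∀ v, G.H v ↪ ℕ) (v : G.V) :
    A.susp.obj (G.genus v) (G.H v) (q v) →ₗ[k] A.ext.obj (G.genus v) (G.H v) (G.lower q v) :=
  A.toExt (G.genus v) ∘ₗ valueAt k (A.obj (G.H v) (G.lower q v)) (ρ v)

/-- The decoration by the suspension with given values at orders of the half-edges. -/
noncomputable def liftAt (G : Graph I) (q : G.V → ℤ) (ρ : ∀ v, G.H v ↪ ℕ) (v : G.V) :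
    A.ext.obj (G.genus v) (G.H v) (G.lower q v) →ₗ[k] A.susp.obj (G.genus v) (G.H v) (q v) :=
  withValueAt k (A.obj (G.H v) (G.lower q v)) (ρ v) ∘ₗ A.ofExt (G.genus v)

theorem evalAt_liftAt (G : Graph I) (q : G.V → ℤ) (ρ : ∀ v, G.H v ↪ ℕ) (v : G.V)
    (x : A.ext.obj (G.genus v) (G.H v) (G.lower q v)) :
    A.evalAt G q ρ v (A.liftAt G q ρ v x) = x :=
  (congrArg (A.toExt _) (valueAt_withValueAt (k := k) (ρ v) (A.ofExt _ x))).trans (A.toExt_ofExt x)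

/-- The suspension as a decoration ignores the genus label, whereas `toExt` kills positive genus; so
genus 0 is needed for this composite, but not for the opposite one. -/
theorem liftAt_evalAt (G : Graph I) (q : G.V → ℤ) (ρ : ∀ v, G.H v ↪ ℕ) (v : G.V)
    (hv : G.genus v = 0) (y : A.susp.obj (G.genus v) (G.H v) (q v)) :
    A.liftAt G q ρ v (A.evalAt G q ρ v y) = y :=
  (congrArg (withValueAt k _ (ρ v)) (A.ofExt_toExt hv _)).trans
    (withValueAt_valueAt (ρ v) (y : CyclicData.alternating k (G.H v) (A.obj (G.H v) (G.lower q v))))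

theorem evalAt_rank (G : Graph I) (q : G.V → ℤ) (ρ ρ' : ∀ v, G.H v ↪ ℕ) (v : G.V)
    (y : A.susp.obj (G.genus v) (G.H v) (q v)) : A.evalAt G q ρ' v y =
      sgn k (koszul (ρ v) (ρ' v) (fun _ => 1)) • A.evalAt G q ρ v y :=
  (congrArg (A.toExt _) (valueAt_rank (ρ v) (ρ' v)
    (y : CyclicData.alternating k (G.H v) (A.obj (G.H v) (G.lower q v))))).trans (map_smul _ _ _)

/-- Evaluation at orders of half-edges is natural only if these orders are transported along the
isomorphism. -/
theorem decRel_evalAt {G G' : Graph I} (f : Graph.Iso G G') {q : G.V → ℤ} {q' : G'.V → ℤ}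
    (hq : ∀ u, q u = q' (f.v u)) (hp : ∀ u, G.lower q u = G'.lower q' (f.v u))
    (ρ : ∀ v, G'.H v ↪ ℕ) {y : A.susp.Dec G q} {y' : A.susp.Dec G' q'}
    (hy : A.susp.DecRel f hq y y') :
    A.ext.DecRel f hp
      (fun v => A.evalAt G q (fun u => (f.h u).toEmbedding.trans (ρ (f.v u))) v (y v))
      (fun v => A.evalAt G' q' ρ v (y' v)) := fun u => by
  have h := A.susp_cast_apply (f.genus u) (hq u) (f.h u) (y u) (ρ (f.v u))
  rw [← hy u] at h
  exact (congrArg (A.toExt _) h).trans (A.cast_toExt (f.genus u) (hp u) (f.h u) _).symm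

theorem decRel_liftAt {G G' : Graph I} (f : Graph.Iso G G') {q : G.V → ℤ} {q' : G'.V → ℤ}
    (hq : ∀ u, q u = q' (f.v u)) (hp : ∀ u, G.lower q u = G'.lower q' (f.v u))
    (ρ : ∀ v, G'.H v ↪ ℕ) {x : A.ext.Dec G (G.lower q)} {x' : A.ext.Dec G' (G'.lower q')}
    (hx : A.ext.DecRel f hp x x') :
    A.susp.DecRel f hq
      (fun v => A.liftAt G q (fun u => (f.h u).toEmbedding.trans (ρ (f.v u))) v (x v))
      (fun v => A.liftAt G' q' ρ v (x' v)) := fun u => Subtype.ext (funext fun r => by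
  refine Eq.trans ?_ (A.susp_cast_apply (f.genus u) (hq u) (f.h u) _ r).symm
  have h : koszul ((f.h u).toEmbedding.trans (ρ (f.v u))) ((f.h u).toEmbedding.trans r)
      (fun _ => 1) = koszul (ρ (f.v u)) r (fun _ => 1) := koszul_equiv (f.h u) _ _ fun _ => 1
  change koszul (ρ (f.v u)) r (fun _ => 1) • A.ofExt _ (x' (f.v u)) =
    A.mapCast (hp u) (f.h u) (koszul ((f.h u).toEmbedding.trans (ρ (f.v u)))
      ((f.h u).toEmbedding.trans r) (fun _ => 1) • A.ofExt _ (x u))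
  rw [hx u, A.ofExt_cast, h]
  generalize koszul (ρ (f.v u)) r (fun _ => 1) = s
  rw [Units.smul_def, Units.smul_def, map_zsmul])

/-- Forms on decorations by an operad, as forms on decorations by its suspension. -/
noncomputable def toSusp (φ : A.ext.RawForms I) (r : I ↪ ℕ) : A.susp.RawForms I := fun G q =>
  sgn k (G.treeSign (G.lower q) r G.halfRank) •
    (φ G (G.lower q)).compLinearMap (A.evalAt G q G.halfRank)

/-- Both the total sign and the evaluated decoration change by the product over the vertices of the
signs of the reorderings of half-edges, and these two changes cancel. -/
theorem totalSign_mul_evalAt [Finite I] {G : Graph I} (m : Graph.Rooting G) (r : I ↪ ℕ)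
    (ρ ρ' : ∀ v, G.H v ↪ ℕ) (q : G.V → ℤ) (y : A.susp.Dec G q)
    (F : MultilinearMap k (fun v => A.ext.obj (G.genus v) (G.H v) (G.lower q v)) k) :
    sgn k (m.totalSign (G.lower q) r ρ') * F (fun v => A.evalAt G q ρ' v (y v)) =
      sgn k (m.totalSign (G.lower q) r ρ) * F fun v => A.evalAt G q ρ v (y v) := by
  simp only [A.evalAt_rank G q ρ ρ']
  rw [MultilinearMap.map_smul_univ, m.totalSign_halfRank _ r ρ ρ', sgn_mul, sgn_prod,
    smul_eq_mul]
  have h : (∏ v, sgn k (koszul (ρ v) (ρ' v) fun _ => 1)) *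
      (∏ v, sgn k (koszul (ρ v) (ρ' v) fun _ => 1)) = 1 := by
    rw [← sgn_prod, sgn_mul_self]
  linear_combination (sgn k (m.totalSign (G.lower q) r ρ) *
    F fun v => A.evalAt G q ρ v (y v)) * h

/-- Any rooting and any orders of the half-edges compute the same value. Every compatibility below
starts by choosing them suitably. -/
theorem toSusp_apply [Finite I] (φ : A.ext.RawForms I) {G : Graph I} (hG : G.IsStable 0)
    (m : Graph.Rooting G) (r : I ↪ ℕ) (ρ : ∀ v, G.H v ↪ ℕ) (q : G.V → ℤ) (y : A.susp.Dec G q) :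
    A.toSusp φ r G q y = sgn k (m.totalSign (G.lower q) r ρ) *
      φ G (G.lower q) fun v => A.evalAt G q ρ v (y v) := by
  change sgn k _ * φ G (G.lower q) (fun v => A.evalAt G q G.halfRank v (y v)) = _
  rw [hG.treeSign_eq m]
  exact A.totalSign_mul_evalAt m r ρ G.halfRank q y (φ G (G.lower q))

theorem toSusp_eq_zero (φ : A.ext.RawForms I) (r : I ↪ ℕ) {G : Graph I} {q : G.V → ℤ}
    (h : φ G (G.lower q) = 0) : A.toSusp φ r G q = 0 := by
  ext y
  change sgn k _ * φ G (G.lower q) _ = 0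
  rw [h]
  exact mul_zero _

theorem toSusp_rank [Finite I] {φ : A.ext.RawForms I} (hφ : ∀ G, ¬ G.IsStable 0 → φ G = 0)
    (r r' : I ↪ ℕ) :
    A.toSusp φ r' = sgn k (koszul r r' (fun _ => 1)) • A.toSusp φ r := by
  funext G q
  ext y
  change _ = sgn k _ * A.toSusp φ r G q y
  by_cases hG : G.IsStable 0
  · obtain ⟨m⟩ := hG.nonempty_rooting
    rw [A.toSusp_apply φ hG m r' G.halfRank, A.toSusp_apply φ hG m r G.halfRank,
      m.totalSign_rank _ r r', sgn_mul, mul_assoc]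
  · rw [A.toSusp_eq_zero φ r' (congrFun (hφ G hG) _), A.toSusp_eq_zero φ r (congrFun (hφ G hG) _)]
    simp

/-- The values of `ofSusp` in degrees of the form `G.lower q`. -/
noncomputable def ofSuspAux (ω : A.susp.RawForms I) (r : I ↪ ℕ) (G : Graph I) (q : G.V → ℤ) :
    MultilinearMap k (fun v => A.ext.obj (G.genus v) (G.H v) (G.lower q v)) k :=
  sgn k (G.treeSign (G.lower q) r G.halfRank) •
    (ω G q).compLinearMap (A.liftAt G q G.halfRank)

/-- Forms on decorations by the suspension of an operad, as forms on decorations by the operad. -/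
noncomputable def ofSusp (ω : A.susp.RawForms I) (r : I ↪ ℕ) : A.ext.RawForms I := fun G p =>
  cast (congrArg (fun p => MultilinearMap k (fun v => A.ext.obj (G.genus v) (G.H v) (p v)) k)
    (G.lower_raise p)) (A.ofSuspAux ω r G fun v => p v + G.shift v)

/-- Each degree function is `G.lower` of a unique one, so the transport in the definition of
`ofSusp` disappears on degrees written in this form. -/
theorem ofSusp_lower (ω : A.susp.RawForms I) (r : I ↪ ℕ) (G : Graph I) (q : G.V → ℤ) :
    A.ofSusp ω r G (G.lower q) = A.ofSuspAux ω r G q := by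
  have key : ∀ q' (h : G.lower q' = G.lower q),
      cast (congrArg (fun p => MultilinearMap k (fun v => A.ext.obj (G.genus v) (G.H v) (p v)) k) h)
        (A.ofSuspAux ω r G q') = A.ofSuspAux ω r G q := fun q' h => by
    obtain rfl := G.lower_injective h
    rfl
  exact key _ (G.lower_raise _)

theorem ofSusp_lower_apply (ω : A.susp.RawForms I) (r : I ↪ ℕ) (G : Graph I) (q : G.V → ℤ)
    (x : A.ext.Dec G (G.lower q)) : A.ofSusp ω r G (G.lower q) x =
      sgn k (G.treeSign (G.lower q) r G.halfRank) *
        ω G q fun v => A.liftAt G q G.halfRank v (x v) := by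
  rw [ofSusp_lower]; rfl

theorem ofSusp_eq_zero {ω : A.susp.RawForms I} (r : I ↪ ℕ) {G : Graph I} {q : G.V → ℤ}
    (h : ω G q = 0) : A.ofSusp ω r G (G.lower q) = 0 := by
  ext x
  rw [ofSusp_lower_apply, h]
  exact mul_zero _

/-- The two tree signs are equal and square to 1. Stability provides the vanishing genus labels that
`liftAt_evalAt` requires. -/
theorem toSusp_ofSusp {ω : A.susp.RawForms I} (r : I ↪ ℕ) {G : Graph I}
    (hG : G.IsStable 0) : A.toSusp (A.ofSusp ω r) r G = ω G := by
  funext q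
  ext y
  change sgn k _ * A.ofSusp ω r G (G.lower q) _ = _
  rw [ofSusp_lower_apply, ← mul_assoc, sgn_mul_self, one_mul]
  congr 1
  funext v
  exact A.liftAt_evalAt G q G.halfRank v (hG.genus_eq_zero v) (y v)

theorem ofSusp_toSusp (φ : A.ext.RawForms I) (r : I ↪ ℕ) : A.ofSusp (A.toSusp φ r) r = φ := by
  funext G p
  obtain ⟨q, rfl⟩ : ∃ q, G.lower q = p := ⟨_, G.lower_raise p⟩
  ext x
  rw [ofSusp_lower_apply]
  change sgn k _ * (sgn k _ * φ G (G.lower q) _) = _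
  rw [← mul_assoc, sgn_mul_self, one_mul]
  congr 1
  funext v
  exact A.evalAt_liftAt G q G.halfRank v (x v)

theorem _root_.CycFeyn.Graph.IsStable.sum_lower [Finite I] {G : Graph I} (hG : G.IsStable 0)
    (q : G.V → ℤ) : ∑ v, G.lower q v = ∑ v, q v + Nat.card I - 3 - Fintype.card G.E := by
  have h : ∑ v, q v = ∑ v, G.lower q v + ∑ v, G.shift v := by
    rw [← Finset.sum_add_distrib]
    exact Finset.sum_congr rfl fun v _ => (G.lower_add_shift q v).symm
  rw [h, hG.sum_shift]
  ring

theorem sgn_mul_cancel {s t a : ℤˣ} (h : s * a = t) {x y : k} (hx : x = sgn k a * y) :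
    sgn k s * x = sgn k t * y := by
  rw [hx, ← h, sgn_mul, mul_assoc]

variable [Finite I]

/-- By `totalSign_map` the total sign absorbs the Koszul sign of the edges, so that forms with edges
of degree `-1` become forms with edges of degree 0. On graphs that are not stable both sides vanish.
-/
theorem toSusp_natural {φ : A.ext.RawForms I} (hφ : ∀ G, ¬ G.IsStable 0 → φ G = 0)
    (hn : IsNatural 1 φ) (r : I ↪ ℕ) : IsNatural 0 (A.toSusp φ r) := by
  intro G G' f q q' hq y y' hy
  by_cases hG : G.IsStable 0
  · have hG' := (f.isStable 0).1 hG
    obtain ⟨m⟩ := hG.nonempty_rooting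
    have hp : ∀ u, G.lower q u = G'.lower q' (f.v u) := fun u => by
      simp only [Graph.lower, hq, Nat.card_congr (f.h u)]
    rw [A.toSusp_apply φ hG' (m.map f) r G'.halfRank, A.toSusp_apply φ hG m r
      (fun u => (f.h u).toEmbedding.trans (G'.halfRank (f.v u))), ← mul_assoc, ← sgn_mul]
    refine sgn_mul_cancel ?_ (hn _ _ f _ _ hp _ _ (A.decRel_evalAt f hq hp G'.halfRank hy))
    rw [m.totalSign_map f hp]
    congr 1
    have h0 : koszul G.rE (G'.rE ∘ f.e) (fun _ => 0) = 1 :=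
      finprod_eq_one_of_forall_eq_one fun _ => by simp
    rw [h0, one_mul]
    exact koszul_congr_deg _ _ _ _ (G.lower_add_shift q)
  · have hG' := fun h => hG ((f.isStable 0).2 h)
    rw [A.toSusp_eq_zero φ r (congrFun (hφ G hG) _), A.toSusp_eq_zero φ r (congrFun (hφ G' hG') _)]
    simp

/-- A form on the suspension is `toSusp` of its `ofSusp` on every stable graph, so the computation
for `toSusp` can be read backwards, the total signs being invertible. -/
theorem ofSusp_natural {ω : A.susp.RawForms I} (hω : ∀ G, ¬ G.IsStable 0 → ω G = 0)
    (hn : IsNatural 0 ω) (r : I ↪ ℕ) : IsNatural 1 (A.ofSusp ω r) := by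
  intro G G' f p p' hp x x' hx
  obtain ⟨q, rfl⟩ : ∃ q, G.lower q = p := ⟨_, G.lower_raise p⟩
  obtain ⟨q', rfl⟩ : ∃ q, G'.lower q = p' := ⟨_, G'.lower_raise p'⟩
  by_cases hG : G.IsStable 0
  · have hG' := (f.isStable 0).1 hG
    obtain ⟨m⟩ := hG.nonempty_rooting
    have hq : ∀ u, q u = q' (f.v u) := fun u => by
      have := hp u
      simp only [Graph.lower, Nat.card_congr (f.h u)] at this
      linarith
    have h := hn _ _ f _ _ hq _ _ (A.decRel_liftAt f hq hp G'.halfRank hx)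
    rw [← A.toSusp_ofSusp (ω := ω) r hG, ← A.toSusp_ofSusp (ω := ω) r hG',
      A.toSusp_apply _ hG' (m.map f) r G'.halfRank, A.toSusp_apply _ hG m r
      (fun u => (f.h u).toEmbedding.trans (G'.halfRank (f.v u)))] at h
    simp only [A.evalAt_liftAt] at h
    have h0 : koszul G.rE (G'.rE ∘ f.e) (fun _ => 0) = 1 :=
      finprod_eq_one_of_forall_eq_one fun _ => by simp
    have h1 := m.totalSign_map f hp r G'.halfRank
    rw [koszul_congr_deg _ _ _ _ (G.lower_add_shift q)] at h1
    rw [h0, one_mul, ← mul_assoc, ← sgn_mul, ← h1, sgn_mul, mul_assoc] at h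
    refine mul_left_cancel₀ (left_ne_zero_of_mul_eq_one (sgn_mul_self _)) h
  · have hG' := fun h => hG ((f.isStable 0).2 h)
    rw [A.ofSusp_eq_zero r (congrFun (hω G hG) _), A.ofSusp_eq_zero r (congrFun (hω G' hG') _)]
    simp

/-- By `IsStable.sum_lower` the passage to the suspended degrees removes the term `|E|` from the
degree condition and adds `|I| - 3` to the degree of the form. -/
theorem toSusp_mem {n : ℤ} {φ : A.ext.RawForms I} (hφ : φ ∈ A.ext.Forms 1 0 I n) (r : I ↪ ℕ) :
    A.toSusp φ r ∈ A.susp.Forms 0 0 I (n + Nat.card I - 3) := by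
  refine ⟨fun G hG => funext fun q => A.toSusp_eq_zero φ r (congrFun (hφ.1 G hG) _),
    fun G q hq => ?_, A.toSusp_natural hφ.1 hφ.2.2 r⟩
  refine A.toSusp_eq_zero φ r ?_
  by_cases hG : G.IsStable 0
  · refine hφ.2.1 G _ fun h => hq ?_
    rw [hG.sum_lower] at h
    linarith
  · exact congrFun (hφ.1 G hG) _

theorem ofSusp_mem {n : ℤ} {ω : A.susp.RawForms I}
    (hω : ω ∈ A.susp.Forms 0 0 I (n + Nat.card I - 3)) (r : I ↪ ℕ) :
    A.ofSusp ω r ∈ A.ext.Forms 1 0 I n := by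
  have h0 : ∀ G, ¬ G.IsStable 0 → A.ofSusp ω r G = 0 := fun G hG => funext fun p => by
    obtain ⟨q, rfl⟩ : ∃ q, G.lower q = p := ⟨_, G.lower_raise p⟩
    exact A.ofSusp_eq_zero r (congrFun (hω.1 G hG) _)
  refine ⟨h0, fun G p hp => ?_, A.ofSusp_natural hω.1 hω.2.2 r⟩
  by_cases hG : G.IsStable 0
  · obtain ⟨q, rfl⟩ : ∃ q, G.lower q = p := ⟨_, G.lower_raise p⟩
    refine A.ofSusp_eq_zero r (hω.2.1 G _ fun h => hp ?_)
    rw [hG.sum_lower]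
    linarith
  · exact congrFun (h0 G hG) _

variable (I) in
/-- The isomorphism of graded vector spaces. -/
noncomputable def suspEquiv (n : ℤ) :
    A.ext.Forms 1 0 I n ≃ₗ[k]
      CyclicData.alternating k I (A.susp.Forms 0 0 I (n + Nat.card I - 3)) where
  toFun φ := ⟨fun r => ⟨A.toSusp φ.1 r, A.toSusp_mem φ.2 r⟩, fun r r' => Subtype.ext (by
    rw [units_smul_eq (k := k)]
    exact A.toSusp_rank φ.2.1 r r')⟩
  map_add' φ ψ := Subtype.ext (funext fun r => A.susp.forms_ext fun G hG q y => mul_add _ _ _)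
  map_smul' a φ := Subtype.ext (funext fun r => A.susp.forms_ext fun G hG q y =>
    mul_left_comm _ _ _)
  -- An alternating function is determined by its value at one order of the legs; an arbitrary
  -- enumeration of `I` serves.
  invFun ω := ⟨A.ofSusp (ω.1 ((Finite.equivFin I).toEmbedding.trans Fin.valEmbedding)).1
    ((Finite.equivFin I).toEmbedding.trans Fin.valEmbedding), A.ofSusp_mem (ω.1 _).2 _⟩
  left_inv φ := Subtype.ext (A.ofSusp_toSusp φ.1 _)
  right_inv ω := Subtype.ext (funext fun r => A.susp.forms_ext fun G hG q y => by
    change A.toSusp _ r G q y = _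
    -- Both sides are alternating in the order of the legs, so it suffices to compare them at the
    -- chosen enumeration.
    rw [A.toSusp_rank (A.ofSusp_mem (ω.1 _).2 _).1
      ((Finite.equivFin I).toEmbedding.trans Fin.valEmbedding) r,
      ω.2 ((Finite.equivFin I).toEmbedding.trans Fin.valEmbedding) r, units_smul_eq (k := k)]
    change sgn k _ * A.toSusp _ _ G q y = sgn k _ * _
    rw [A.toSusp_ofSusp _ hG])

end CyclicOperad

end CycFeyn

/-! ### Relabelling and composition -/

namespace CycFeyn

open Function ModularData

theorem shuffle_eq_one {X : Type} {U : X → Prop} {r : X → ℕ} (p : X → ℤ)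
    (h : ∀ a b, U a → ¬ U b → r a < r b) : shuffle U r p = 1 :=
  finprod_eq_one_of_forall_eq_one fun x => if_neg (h _ _ x.1.2 x.2.2).not_gt

namespace Graph

variable {I J : Type}

/-- A graph with other orders of the vertices and edges. -/
def rerank (G : Graph I) (rV : G.V ↪ ℕ) (rE : G.E ↪ ℕ) : Graph I where
  V := G.V
  E := G.E
  H := G.H
  genus := G.genus
  inc := G.inc
  rV := rV
  rE := rE

/-- The identity, as an isomorphism to a graph with other orders. -/
def rerankIso (G : Graph I) (rV : G.V ↪ ℕ) (rE : G.E ↪ ℕ) : Iso G (G.rerank rV rE) where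
  v := Equiv.refl _
  e := Equiv.refl _
  h _ := Equiv.refl _
  flip _ := false
  genus _ := rfl
  inc s := by
    change G.inc s = _
    rcases G.inc s with i | ⟨e, b⟩
    · rfl
    · exact congrArg (fun b => Sum.inr (e, b)) (Bool.false_xor b).symm

theorem IsStable.totalSign_eq [Finite I] {G : Graph I} (hG : G.IsStable 0) (m m' : Rooting G)
    (p : G.V → ℤ) (r : I ↪ ℕ) (ρ : ∀ v, G.H v ↪ ℕ) : m.totalSign p r ρ = m'.totalSign p r ρ := by
  rw [← hG.treeSign_eq m, hG.treeSign_eq m']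

theorem exists_rank_lt {X : Type} [Finite X] (r : X ↪ ℕ) : ∃ N, ∀ x, r x < N := by
  obtain ⟨N, hN⟩ := (Set.finite_range r).bddAbove
  exact ⟨N + 1, fun x => Nat.lt_succ_of_le (hN ⟨x, rfl⟩)⟩

theorem exists_rank_blocks {X : Type} [Finite X] (U : X → Prop) (r : X ↪ ℕ) :
    ∃ r' : X ↪ ℕ, ∀ x y, U x → ¬ U y → r' x < r' y := by
  classical
  obtain ⟨N, hN⟩ := exists_rank_lt r
  -- Adding a strict upper bound of all ranks to those outside `U` moves them behind `U`.
  refine ⟨⟨fun x => if U x then r x else r x + N, fun x y h => ?_⟩, fun x y hx hy => ?_⟩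
  · have hx := hN x
    have hy := hN y
    refine r.injective ?_
    dsimp only at h
    split_ifs at h <;> omega
  · have := hN x
    change (if U x then r x else r x + N) < if U y then r y else r y + N
    rw [if_pos hx, if_neg hy]
    omega

/-- Changing the orders gives an isomorphic graph, so by naturality the sign of a cut may be
computed when the orders are adapted to it. -/
theorem exists_cutFirst (G : Graph I) (U : G.V → Prop) (e : G.E) :
    ∃ rV rE, (G.rerank rV rE).CutFirst U e := by
  classical
  obtain ⟨rV, hV⟩ := exists_rank_blocks U G.rV
  obtain ⟨r, hr⟩ := exists_rank_blocks (fun e' => U (G.att e' false).1) G.rE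
  refine ⟨rV, ⟨fun e' => if e' = e then 0 else r e' + 1, fun x y h => ?_⟩,
    fun e' he => ?_, fun e' e'' h h' hu hu' => ?_, hV⟩
  · dsimp only at h
    split_ifs at h with h1 h2 h2
    · exact h1.trans h2.symm
    · exact r.injective (by omega)
  · change (if e = e then 0 else r e + 1) < if e' = e then 0 else r e' + 1
    rw [if_pos rfl, if_neg he]
    omega
  · change (if e' = e then 0 else r e' + 1) < if e'' = e then 0 else r e'' + 1
    rw [if_neg h, if_neg h']
    exact Nat.succ_lt_succ (hr e' e'' hu hu')

/-- The analogue for a contraction: the edge comes first, its first end before its second, and both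
before the other vertices. -/
theorem exists_edgeFirst (G : Graph I) (e : G.E) (hne : (G.att e false).1 ≠ (G.att e true).1) :
    ∃ rV rE, (G.rerank rV rE).EdgeFirst e := by
  classical
  obtain ⟨rV, hV⟩ := exists_rank_blocks (G.IsEnd e) G.rV
  refine ⟨⟨fun v => if v = (G.att e false).1 then 0 else rV v + 1, fun x y h => ?_⟩,
    ⟨fun e' => if e' = e then 0 else G.rE e' + 1, fun x y h => ?_⟩,
    fun e' he => ?_, ?_, fun v w hv hw => ?_⟩
  · dsimp only at h
    split_ifs at h with h1 h2 h2
    · exact h1.trans h2.symm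
    · exact rV.injective (by omega)
  · dsimp only at h
    split_ifs at h with h1 h2 h2
    · exact h1.trans h2.symm
    · exact G.rE.injective (by omega)
  · change (if e = e then 0 else G.rE e + 1) < if e' = e then 0 else G.rE e' + 1
    rw [if_pos rfl, if_neg he]
    omega
  · change (if (G.att e false).1 = (G.att e false).1 then 0 else _) <
      if (G.att e true).1 = (G.att e false).1 then 0 else rV (G.att e true).1 + 1
    rw [if_pos rfl, if_neg hne.symm]
    omega
  · change (if v = (G.att e false).1 then 0 else rV v + 1) <
      if w = (G.att e false).1 then 0 else rV w + 1
    rw [if_neg (show w ≠ (G.att e false).1 from fun h => hw ⟨false, h.symm⟩)]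
    have := hV v w hv hw
    split_ifs <;> omega

/-- With adapted orders all the shuffles are trivial. Only the edges of the second part passing the
decorations of the first still contribute. -/
theorem CutFirst.cutSign {L : Type} {G : Graph L} {U : G.V → Prop} {e : G.E} (h : G.CutFirst U e)
    (δ : ℤ) (p : G.V → ℤ) {K K' : Type} {j : K → L} {j' : K' → L} {c c' : Bool} (h₁ : G.Cut U j e c)
    (h₂ : G.Cut (fun v => ¬ U v) j' e c') : ModularData.cutSign δ G U e p =
      (δ * (Fintype.card (G.side h₂).E * ∑ v, p (G.sideVertex h₁ v))).negOnePow := by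
  rw [ModularData.cutSign, shuffle_eq_one, shuffle_eq_one, shuffle_eq_one _ h.vertex, one_mul,
    one_mul, one_mul]
  · refine congrArg Int.negOnePow ((mul_assoc _ _ _).trans (congrArg (δ * ·) (congrArg₂ (· * ·)
      (congrArg Nat.cast ?_) ?_)))
    · exact (@Nat.card_eq_fintype_card _ (_)).symm.trans (@Nat.card_eq_fintype_card _ (_))
    · exact sum_inst _ _ _
  · exact fun a b => h.edges a.1 b.1 a.2 b.2
  · rintro a b rfl hb
    exact h.edge b hb

end Graph

/-- Carries an identity from a reordered graph back to the original one: both forms change by signs,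
and the total sign changes by the quotient of these. -/
theorem sgn_mul_descend {k : Type u} [Field k] {s s' a b : ℤˣ} (h : s' * a = b * s)
    {x x' y y' t : k} (hx : x' = sgn k a * x) (hy : y' = sgn k b * y)
    (h' : sgn k s' * x' = t * y') : sgn k s * x = t * y := by
  have h1 := congrArg (sgn k) h
  rw [sgn_mul, sgn_mul] at h1
  rw [hx, hy] at h'
  refine mul_left_cancel₀ (left_ne_zero_of_mul_eq_one (sgn_mul_self (k := k) b)) ?_
  linear_combination h' - x * h1

namespace CyclicOperad

variable {k : Type u} [Field k] (A : CyclicOperad.{u, w} k) {I J : Type}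

theorem decRel_rerank {ε : ℤ} (P : ModularData.{u, w} k ε) (G : Graph I) (rV : G.V ↪ ℕ)
    (rE : G.E ↪ ℕ) {p : G.V → ℤ} (x : P.Dec G p) :
    P.DecRel (G.rerankIso rV rE) (p' := p) (fun _ => rfl) x x := fun u =>
  (P.cast_refl rfl rfl (x u)).symm

theorem mapCast_dgDual {n n' : ℤ} (h : n = n') (f : I ≃ J) (ω : A.dgDual.obj I n) :
    (A.dgDual.mapCast h f ω).1 = A.susp.mapRaw f ω.1 := by
  subst h
  rfl

/-- A rooting of a graph is also one of the relabelled graph, with the same vertex and edge symbols;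
relabelling the legs and transporting their order back cancel. -/
theorem suspEquiv_map [Finite I] [Finite J] {n : ℤ} (f : I ≃ J) (φ : A.cycFeynman.obj I n) :
    A.suspEquiv J n (A.cycFeynman.map f φ) = A.dgDual.suspension.map f (A.suspEquiv I n φ) := by
  refine Subtype.ext (funext fun r => A.susp.forms_ext fun G hG q y => ?_)
  obtain ⟨m⟩ := hG.nonempty_rooting
  have h1 : ((A.dgDual.suspension.map f (A.suspEquiv I n φ)).1 r).1 G q y =
      A.toSusp φ.1 (f.toEmbedding.trans r) (G.relabel f.symm) q y :=
    congrArg (fun ω : A.susp.RawForms J => ω G q y)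
      (A.mapCast_dgDual (by rw [Nat.card_congr f]) f ((A.suspEquiv I n φ).1 (f.toEmbedding.trans r)))
  have h2 := A.toSusp_apply φ.1 ((G.relabel_isStable f.symm 0).2 hG) (m.relabel f.symm)
    (f.toEmbedding.trans r) G.halfRank q y
  have h3 := m.totalSign_relabel f.symm (G.lower q) (f.toEmbedding.trans r) G.halfRank
  have h4 : f.symm.toEmbedding.trans (f.toEmbedding.trans r) = r := by
    ext j; simp
  rw [h4] at h3
  refine (A.toSusp_apply _ hG m r G.halfRank q y).trans (Eq.trans ?_ (h1.trans h2).symm)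
  exact congrArg (fun t => sgn k t * φ.1 (G.relabel f.symm) (G.lower q)
    fun v => A.evalAt G q G.halfRank v (y v)) h3.symm

/-- Composition, on one way of cutting a tree. -/
theorem cutTerm_toSusp_of_cutFirst [Finite I] [Finite J] {n n' : ℤ}
    {φ : A.ext.RawForms (Option I)} {ψ : A.ext.RawForms (Option J)}
    (hφ : φ ∈ A.ext.Forms 1 0 (Option I) n) (hψ : ψ ∈ A.ext.Forms 1 0 (Option J) n')
    {G : Graph (I ⊕ J)} (hG : G.IsStable 0) (m : Graph.Rooting G) (s : I ⊕ J ↪ ℕ)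
    (q : G.V → ℤ) (y : A.susp.Dec G q) (U : Set G.V) (e : G.E) (c : Bool)
    (he : G.CutFirst (· ∈ U) e) :
    sgn k (m.totalSign (G.lower q) s G.halfRank) * A.ext.cutTerm 1 φ ψ G (G.lower q) U e c
        (fun v => A.evalAt G q G.halfRank v (y v)) =
      sgn k (CyclicData.blockSign s * ((n + Nat.card I - 2) * (2 - Nat.card J)).negOnePow) *
        A.susp.cutTerm 0 (A.toSusp φ (consRank (Embedding.inl.trans s)))
          (A.toSusp ψ (consRank (Embedding.inr.trans s))) G q U e c y := by
  by_cases h : G.Cut (· ∈ U) Sum.inl e c ∧ G.Cut (fun v => ¬ v ∈ U) Sum.inr e (!c)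
  swap
  · rw [A.ext.cutTerm_neg 1 _ _ G _ U e c h, A.susp.cutTerm_neg 0 _ _ G _ U e c h]
    simp
  obtain ⟨h₁, h₂⟩ := h
  rw [A.ext.cutTerm_pos 1 _ _ G _ U e c h₁ h₂, A.susp.cutTerm_pos 0 _ _ G _ U e c h₁ h₂,
    he.cutSign 1 _ h₁ h₂, he.cutSign 0 _ h₁ h₂, zero_mul, Int.negOnePow_zero, one_mul]
  -- If a form vanishes on its part, both sides are zero. Otherwise the part is stable and its
  -- degree condition holds, which `totalSign_cut` needs.
  by_cases z₁ : φ (G.side h₁) ((G.side h₁).lower fun v => q v.1) = 0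
  · have t₁ := A.toSusp_eq_zero φ (consRank (Embedding.inl.trans s)) z₁
    have a₁ : φ (G.side h₁) (fun v => G.lower q v.1)
        (fun v => A.evalAt G q G.halfRank v.1 (y v.1)) = 0 := DFunLike.congr_fun z₁ _
    have a₂ : A.toSusp φ (consRank (Embedding.inl.trans s)) (G.side h₁) (fun v => q v.1)
        (fun v => y v.1) = 0 := DFunLike.congr_fun t₁ _
    rw [a₁, a₂]
    simp
  by_cases z₂ : ψ (G.side h₂) ((G.side h₂).lower fun v => q v.1) = 0
  · have t₁ := A.toSusp_eq_zero ψ (consRank (Embedding.inr.trans s)) z₂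
    have a₁ : ψ (G.side h₂) (fun v => G.lower q v.1)
        (fun v => A.evalAt G q G.halfRank v.1 (y v.1)) = 0 := DFunLike.congr_fun z₂ _
    have a₂ : A.toSusp ψ (consRank (Embedding.inr.trans s)) (G.side h₂) (fun v => q v.1)
        (fun v => y v.1) = 0 := DFunLike.congr_fun t₁ _
    rw [a₁, a₂]
    simp
  have hG₁ : (G.side h₁).IsStable 0 := by
    by_contra hn
    exact z₁ (congrFun (hφ.1 _ hn) _)
  have hG₂ : (G.side h₂).IsStable 0 := by
    by_contra hn
    exact z₂ (congrFun (hψ.1 _ hn) _)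
  have hn : n + Fintype.card (G.side h₁).E + ∑ v, G.lower q (G.sideVertex h₁ v) = 0 := by
    by_contra hn
    refine z₁ (hφ.2.1 _ _ ?_)
    rw [one_mul]
    exact hn
  -- Each part is rooted at its end of the cut edge, so that the two rootings fit together to one of
  -- the whole tree.
  obtain ⟨m₁, hm₁, -⟩ := hG₁.existsUnique_rooting (⟨_, h₁.fst⟩ : {v // v ∈ U})
  obtain ⟨m₂, hm₂, -⟩ := hG₂.existsUnique_rooting (⟨_, h₂.fst⟩ : {v // ¬ v ∈ U})
  have hr₁ : G.sideVertex h₁ m₁.root = (G.att e c).1 := congrArg Subtype.val hm₁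
  have hr₂ : G.sideVertex h₂ m₂.root = (G.att e (!c)).1 := congrArg Subtype.val hm₂
  have key := Graph.Rooting.totalSign_cut h₁ h₂ he hr₁ hr₂ hG₂ (G.lower q) hn s G.halfRank
  have e₁ : A.toSusp φ (consRank (Embedding.inl.trans s)) (G.side h₁) (fun v => q v.1)
      (fun v => y v.1) = sgn k (m₁.totalSign (fun v => G.lower q (G.sideVertex h₁ v))
        (consRank (Embedding.inl.trans s)) (G.sideHalfRank h₁ G.halfRank)) *
      φ (G.side h₁) (fun v => G.lower q v.1) fun v => A.evalAt G q G.halfRank v.1 (y v.1) :=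
    A.toSusp_apply φ hG₁ m₁ _ (G.sideHalfRank h₁ G.halfRank) _ _
  have e₂ : A.toSusp ψ (consRank (Embedding.inr.trans s)) (G.side h₂) (fun v => q v.1)
      (fun v => y v.1) = sgn k (m₂.totalSign (fun v => G.lower q (G.sideVertex h₂ v))
        (consRank (Embedding.inr.trans s)) (G.sideHalfRank h₂ G.halfRank)) *
      ψ (G.side h₂) (fun v => G.lower q v.1) fun v => A.evalAt G q G.halfRank v.1 (y v.1) :=
    A.toSusp_apply ψ hG₂ m₂ _ (G.sideHalfRank h₂ G.halfRank) _ _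
  rw [e₁, e₂, hG.totalSign_eq m (Graph.Rooting.cut h₁ h₂ hr₁ hr₂)]
  have key' := congrArg (sgn k) key
  have h1 : sgn k 1 = 1 := by simp [sgn]
  rw [h1]
  rw [sgn_mul, sgn_mul (_ * _) (_ * _), sgn_mul (m₁.totalSign _ _ _)] at key'
  generalize φ (G.side h₁) (fun v => G.lower q v.1)
    (fun v => A.evalAt G q G.halfRank v.1 (y v.1)) = X
  generalize ψ (G.side h₂) (fun v => G.lower q v.1)
    (fun v => A.evalAt G q G.halfRank v.1 (y v.1)) = Y
  linear_combination (X * Y) * key'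

/-- Reduced to adapted orders: `exists_cutFirst` provides them, and `cutTerm_iso` on both sides with
`totalSign_map` brings the identity back. -/
theorem cutTerm_toSusp [Finite I] [Finite J] {n n' : ℤ}
    {φ : A.ext.RawForms (Option I)} {ψ : A.ext.RawForms (Option J)}
    (hφ : φ ∈ A.ext.Forms 1 0 (Option I) n) (hψ : ψ ∈ A.ext.Forms 1 0 (Option J) n')
    {G : Graph (I ⊕ J)} (hG : G.IsStable 0) (m : Graph.Rooting G) (s : I ⊕ J ↪ ℕ)
    (q : G.V → ℤ) (y : A.susp.Dec G q) (U : Set G.V) (e : G.E) (c : Bool) :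
    sgn k (m.totalSign (G.lower q) s G.halfRank) * A.ext.cutTerm 1 φ ψ G (G.lower q) U e c
        (fun v => A.evalAt G q G.halfRank v (y v)) =
      sgn k (CyclicData.blockSign s * ((n + Nat.card I - 2) * (2 - Nat.card J)).negOnePow) *
        A.susp.cutTerm 0 (A.toSusp φ (consRank (Embedding.inl.trans s)))
          (A.toSusp ψ (consRank (Embedding.inr.trans s))) G q U e c y := by
  obtain ⟨rV, rE, he⟩ := G.exists_cutFirst (· ∈ U) e
  let f := G.rerankIso rV rE
  have hG' := (f.isStable 0).1 hG
  have h := A.cutTerm_toSusp_of_cutFirst hφ hψ hG' (m.map f) s q y U e c he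
  have hc : xor (f.flip e) c = c := Bool.false_xor c
  have h1 := A.ext.cutTerm_iso hφ.2.2 hψ.2.2 f (p := G.lower q) (p' := G.lower q) (fun _ => rfl)
    (decRel_rerank A.ext G rV rE fun v => A.evalAt G q G.halfRank v (y v)) U U
    (fun _ => Iff.rfl) e c
  have h2 := A.susp.cutTerm_iso (A.toSusp_natural hφ.1 hφ.2.2 (consRank (Embedding.inl.trans s)))
    (A.toSusp_natural hψ.1 hψ.2.2 (consRank (Embedding.inr.trans s))) f (p := q) (p' := q)
    (fun _ => rfl) (decRel_rerank A.susp G rV rE y) U U (fun _ => Iff.rfl) e c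
  rw [hc] at h1 h2
  have h0 : koszul G.rE ((G.rerank rV rE).rE ∘ f.e) (fun _ => 0) = 1 :=
    finprod_eq_one_of_forall_eq_one fun _ => by simp
  rw [h0, one_mul] at h2
  have h3 := m.totalSign_map f (p := G.lower q) (p' := G.lower q) (fun _ => rfl) s G.halfRank
  rw [koszul_congr_deg _ _ _ _ (G.lower_add_shift q)] at h3
  exact sgn_mul_descend h3 h1 h2 h

/-- Both compositions are sums over the same cuts, and the sign in the composition of the suspension
is common to all of them, so the comparison is made cut by cut. -/
theorem suspEquiv_comp [Finite I] [Finite J] {n n' l : ℤ} (h : l + 1 = n + n')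
    (φ : A.cycFeynman.obj (Option I) n) (ψ : A.cycFeynman.obj (Option J) n') :
    A.suspEquiv (I ⊕ J) l (A.cycFeynman.comp h φ ψ) =
      A.dgDual.suspension.comp h (A.suspEquiv (Option I) n φ) (A.suspEquiv (Option J) n' ψ) := by
  refine Subtype.ext (funext fun s => A.susp.forms_ext fun G hG q y => ?_)
  obtain ⟨m⟩ := hG.nonempty_rooting
  refine (A.toSusp_apply _ hG m s G.halfRank q y).trans ?_
  have h1 : ((A.dgDual.suspension.comp h (A.suspEquiv (Option I) n φ)
      (A.suspEquiv (Option J) n' ψ)).1 s).1 G q y =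
      sgn k (CyclicData.blockSign s * ((n + Nat.card I - 2) * (2 - Nat.card J)).negOnePow) *
        A.susp.compRaw 0 0 (A.toSusp φ.1 (consRank (Embedding.inl.trans s)))
          (A.toSusp ψ.1 (consRank (Embedding.inr.trans s))) G q y := by
    change ((CyclicData.blockSign s * ((n + Nat.card I - 2) * (2 - Nat.card J)).negOnePow) •
      A.dgDual.comp _ ((A.suspEquiv (Option I) n φ).1 (consRank (Embedding.inl.trans s)))
        ((A.suspEquiv (Option J) n' ψ).1 (consRank (Embedding.inr.trans s)))).1 G q y = _
    rw [units_smul_eq (k := k)]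
    rfl
  have h2 : ∀ x, (A.cycFeynman.comp h φ ψ).1 G (G.lower q) x =
    A.ext.compRaw 1 0 φ.1 ψ.1 G (G.lower q) x := fun _ => rfl
  rw [h1, h2, compRaw_apply _ _ _ _ hG, compRaw_apply _ _ _ _ hG]
  simp only [Finset.mul_sum, A.cutTerm_toSusp φ.2 ψ.2 hG m s q y]

end CyclicOperad

end CycFeyn

/-! ### The internal differential, and gluing in the suspension -/

namespace CycFeyn

open Function ModularData

namespace ModularData

variable {k : Type u} [Field k] {ε : ℤ} (P : ModularData.{u, w} k ε) {I : Type}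

/-- Degrees computed in two ways are equal but not definitionally so; this moves a form and its
argument between them. -/
theorem form_congr (φ : P.RawForms I) {G : Graph I} {p p' : G.V → ℤ} (h : p = p') {x : P.Dec G p}
    {x' : P.Dec G p'} (hx : ∀ u, x' u = P.cast rfl (congrFun h u) (Equiv.refl _) (x u)) :
    φ G p' x' = φ G p x := by
  subst h
  congr 1
  funext u
  rw [hx, P.cast_refl]

theorem dAt_self (G : Graph I) (p : G.V → ℤ) (v : G.V) :
    P.dAt G p v v = P.d (lowerDeg_self p v) := dif_pos rfl

theorem dAt_ne (G : Graph I) (p : G.V → ℤ) {u v : G.V} (h : u ≠ v) :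
    P.dAt G p v u = P.cast rfl (lowerDeg_ne p h) (Equiv.refl _) := dif_neg h

end ModularData

theorem Graph.lower_lowerDeg {I : Type} (G : Graph I) (q : G.V → ℤ) (v : G.V) :
    G.lower (lowerDeg q v) = lowerDeg (G.lower q) v := by
  funext u
  by_cases h : u = v
  · simp only [lower, lowerDeg, h, if_true]
    ring
  · simp only [lower, lowerDeg, h, if_false]

namespace CyclicOperad

variable {k : Type u} [Field k] (A : CyclicOperad.{u, w} k) {I J : Type}

theorem toExt_valueAt_cast {H : Type} {g : ℕ} {n n' : ℤ} (hn : n = n')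
    (hn' : n + Nat.card H - 3 = n' + Nat.card H - 3) (r : H ↪ ℕ) (z : A.susp.obj g H n) :
    A.toExt g (valueAt k (A.obj H (n' + Nat.card H - 3)) r
      (A.susp.cast (rfl : g = g) hn (Equiv.refl H) z)) =
      A.ext.cast rfl hn' (Equiv.refl H) (A.toExt g (valueAt k (A.obj H (n + Nat.card H - 3)) r z)) := by
  subst hn
  rw [A.ext.cast_refl, A.susp.cast_refl]

theorem mapCast_refl_d {n m m' : ℤ} (h : m + 1 = n) (h' : m' + 1 = n) (hm : m' = m)
    (x : A.obj I n) : A.mapCast hm (Equiv.refl I) (A.d h' x) = A.d h x := by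
  subst hm
  exact A.equivariant.map_refl _

/-- The sign is the one in the differential of the suspension at a vertex, where `d` passes the
shift symbol of degree `3 - |H|`. -/
theorem toExt_valueAt_d {H : Type} {g : ℕ} (hg : g = 0) {n m : ℤ} (h : m + 1 = n) {m' : ℤ}
    (h' : m' + 1 = n + Nat.card H - 3) (hm : m' = m + Nat.card H - 3) (r : H ↪ ℕ)
    (z : A.susp.obj g H n) :
    A.toExt g (valueAt k (A.obj H (m + Nat.card H - 3)) r (A.susp.d h z)) =
      sgn k (3 - Nat.card H : ℤ).negOnePow •
        A.ext.cast (rfl : g = g) hm (Equiv.refl H) (A.ext.d (g := g) h'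
          (A.toExt g (valueAt k (A.obj H (n + Nat.card H - 3)) r z))) := by
  have e1 : A.ext.d (g := g) h' (A.toExt g (valueAt k (A.obj H (n + Nat.card H - 3)) r z)) =
      A.toExt g (A.d h' (valueAt k (A.obj H (n + Nat.card H - 3)) r z)) :=
    congrArg (fun x => A.toExt g (A.d h' x)) (A.ofExt_toExt hg _)
  rw [e1, A.cast_toExt, A.mapCast_refl_d (by omega) h' hm]
  refine Eq.trans ?_ (map_smul _ _ _)
  rw [← units_smul_eq (k := k)]
  rfl

/-- The internal differential. -/
theorem dAt_toSusp [Finite I] (φ : A.ext.RawForms I) {G : Graph I} (hG : G.IsStable 0)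
    (m : Graph.Rooting G) (r : I ↪ ℕ) (ρ : ∀ v, G.H v ↪ ℕ) (q : G.V → ℤ) (y : A.susp.Dec G q)
    (v : G.V) :
    sgn k (m.totalSign (G.lower q) r ρ) * (sgn k (1 * Fintype.card G.E : ℤ).negOnePow *
        (sgn k (∑ u with G.rV u < G.rV v, G.lower q u).negOnePow *
          φ G (lowerDeg (G.lower q) v)
            fun u => A.ext.dAt G (G.lower q) v u (A.evalAt G q ρ u (y u)))) =
      sgn k (3 - Nat.card I : ℤ).negOnePow * (sgn k (0 * Fintype.card G.E : ℤ).negOnePow *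
        (sgn k (∑ u with G.rV u < G.rV v, q u).negOnePow *
          A.toSusp φ r G (lowerDeg q v) fun u => A.susp.dAt G q v u (y u))) := by
  classical
  have hl := G.lower_lowerDeg q v
  -- Lowering a degree and unshifting commute, but only up to an equality of degree functions; `X`
  -- is the differentiated decoration transported along it.
  let X : A.ext.Dec G (G.lower (lowerDeg q v)) := fun u => A.ext.cast rfl (congrFun hl u).symm
    (Equiv.refl _) (A.ext.dAt G (G.lower q) v u (A.evalAt G q ρ u (y u)))
  have h1 : φ G (G.lower (lowerDeg q v)) X = φ G (lowerDeg (G.lower q) v)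
      fun u => A.ext.dAt G (G.lower q) v u (A.evalAt G q ρ u (y u)) :=
    A.ext.form_congr φ hl.symm fun u => rfl
  -- Only the vertex `v` carries a sign. Giving the others the exponent 0 lets multilinearity
  -- collect all the signs at once.
  have h2 : ∀ u, A.evalAt G (lowerDeg q v) ρ u (A.susp.dAt G q v u (y u)) =
      sgn k (if u = v then G.shift v else 0).negOnePow • X u := by
    intro u
    by_cases hu : u = v
    · subst hu
      rw [if_pos rfl]
      simp only [X, dAt_self]
      exact A.toExt_valueAt_d (hG.genus_eq_zero u) (lowerDeg_self q u)
        (lowerDeg_self (G.lower q) u) (congrFun hl u).symm (ρ u) (y u)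
    · rw [if_neg hu]
      have h3 : sgn k (0 : ℤ).negOnePow = 1 := by simp [sgn]
      rw [h3, one_smul]
      simp only [X, dAt_ne _ _ _ hu]
      rw [A.ext.cast_trans]
      exact A.toExt_valueAt_cast (lowerDeg_ne q hu) _ (ρ u) (y u)
  rw [A.toSusp_apply φ hG m r ρ]
  simp only [h2]
  rw [MultilinearMap.map_smul_univ, ← sgn_prod, ← negOnePow_prod, Finset.sum_ite_eq', h1,
    if_pos (Finset.mem_univ v), hl]
  have h4 := congrArg (sgn k) (m.totalSign_lowerDeg hG (G.lower q) v r ρ)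
  simp only [G.lower_add_shift] at h4
  rw [Int.negOnePow_add, Int.negOnePow_add, Int.negOnePow_add, sgn_mul, sgn_mul, sgn_mul, sgn_mul,
    sgn_mul] at h4
  rw [one_mul, zero_mul]
  have h5 : sgn k (0 : ℤ).negOnePow = 1 := by simp [sgn]
  rw [h5, smul_eq_mul]
  generalize φ G (lowerDeg (G.lower q) v) _ = X
  linear_combination X * h4

theorem glue_toExt {g₁ g₂ g : ℕ} {H₀ H₁ X Y M : Type} [Finite X] [Finite Y] {p q r : ℤ}
    (h₁ : g₁ = 0) (h₂ : g₂ = 0) (hg : g₁ + g₂ = g) (h : r + 0 = p + q) (α : Option X ≃ H₀)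
    (β : Option Y ≃ H₁) (γ : X ⊕ Y ≃ M) (x : A.obj H₀ p) (y : A.obj H₁ q) :
    A.ext.glue hg h α β γ (A.toExt g₁ x) (A.toExt g₂ y) =
      A.toExt g (A.map γ (A.comp h (A.map α.symm x) (A.map β.symm y))) := by
  subst h₁ h₂ hg
  rfl

theorem mapCast_comp {H₀ H₁ X Y M : Type} [Finite X] [Finite Y] {p q p' q' r r' t : ℤ}
    (hp : p = p') (hq : q = q') (h : r + 0 = p + q) (h' : r' + 0 = p' + q') (hr : r = t)
    (hr' : r' = t) (α : H₀ ≃ Option X) (β : H₁ ≃ Option Y) (γ : X ⊕ Y ≃ M) (x : A.obj H₀ p)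
    (y : A.obj H₁ q) :
    A.mapCast hr' γ (A.comp h' (A.mapCast hp α x) (A.mapCast hq β y)) =
      A.mapCast hr (Equiv.refl M) (A.map γ (A.comp h (A.map α x) (A.map β y))) := by
  subst hp hq hr'
  subst hr
  exact (A.equivariant.map_refl _).symm

/-- The orders `t₀` and `t₁` start with the glued half-edge, as the composition of the suspension
demands, and `s` is assumed to have trivial block sign. What remains is the sign of the second shift
passing the first decoration. -/
theorem toExt_valueAt_glue {g₁ g₂ g : ℕ} {H₀ H₁ X Y M : Type} [Finite X] [Finite Y] {p q r r' : ℤ}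
    (h₁ : g₁ = 0) (h₂ : g₂ = 0) (hg : g₁ + g₂ = g) (h : r + 1 = p + q) (α : Option X ≃ H₀)
    (β : Option Y ≃ H₁) (γ : X ⊕ Y ≃ M)
    (h' : r' + 0 = (p + Nat.card H₀ - 3) + (q + Nat.card H₁ - 3)) (hr : r' = r + Nat.card M - 3)
    {t : M ↪ ℕ} {s : X ⊕ Y ↪ ℕ} {t₀ : H₀ ↪ ℕ} {t₁ : H₁ ↪ ℕ} (hs : γ.toEmbedding.trans t = s)
    (hb : CyclicData.blockSign s = 1)
    (h₀ : t₀ = α.symm.toEmbedding.trans (consRank (Embedding.inl.trans s)))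
    (h₁' : t₁ = β.symm.toEmbedding.trans (consRank (Embedding.inr.trans s)))
    (x : A.susp.obj g₁ H₀ p) (y : A.susp.obj g₂ H₁ q) :
    A.toExt g (valueAt k (A.obj M (r + Nat.card M - 3)) t (A.susp.glue hg h α β γ x y)) =
      sgn k ((p + Nat.card H₀ - 3) * (3 - Nat.card H₁)).negOnePow •
      A.ext.cast (rfl : g = g) hr (Equiv.refl M) (A.ext.glue hg h' α β γ
        (A.toExt g₁ (valueAt k (A.obj H₀ (p + Nat.card H₀ - 3)) t₀ x))
        (A.toExt g₂ (valueAt k (A.obj H₁ (q + Nat.card H₁ - 3)) t₁ y))) := by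
  subst hs h₀ h₁'
  have c₀ : (Nat.card H₀ : ℤ) = Nat.card X + 1 := by
    rw [← Nat.card_congr α, Finite.card_option, Nat.cast_add, Nat.cast_one]
  have c₁ : (Nat.card H₁ : ℤ) = Nat.card Y + 1 := by
    rw [← Nat.card_congr β, Finite.card_option, Nat.cast_add, Nat.cast_one]
  have hsgn : ((p + Nat.card H₀ - 3) * (3 - Nat.card H₁)).negOnePow =
      CyclicData.blockSign (γ.toEmbedding.trans t) *
        ((p + Nat.card X - 2) * (2 - Nat.card Y)).negOnePow := by
    rw [hb, one_mul, c₀, c₁]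
    congr 1
    ring
  rw [hsgn, A.glue_toExt h₁ h₂, A.cast_toExt, ← A.mapCast_comp (r' := r + Nat.card (X ⊕ Y) - 3)
    (p' := p + Nat.card (Option X) - 3) (q' := q + Nat.card (Option Y) - 3)
    (by rw [Nat.card_congr α]) (by rw [Nat.card_congr β]) h' (by
      simp only [Nat.card_sum, Finite.card_option, Nat.cast_add, Nat.cast_one]
      omega) hr (by rw [Nat.card_congr γ])]
  refine Eq.trans ?_ (map_smul (A.toExt g) _ _)
  refine congrArg (A.toExt g) ?_
  rw [← map_smul, ← units_smul_eq (k := k)]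
  rfl

end CyclicOperad

theorem Graph.EdgeFirst.contractSign {I : Type} {G : Graph I} {e : G.E} (he : G.EdgeFirst e) (δ : ℤ)
    (p : G.V → ℤ) : ModularData.contractSign δ G e false p = 1 := by
  rw [ModularData.contractSign, shuffle_eq_one, shuffle_eq_one _ he.vertex, one_mul, one_mul]
  · exact if_neg he.ends.not_gt
  · rintro a b rfl hb
    exact he.edge b hb

theorem Graph.EdgeFirst.contractTerm {k : Type u} [Field k] {ε : ℤ} (P : ModularData.{u, w} k ε)
    {I : Type} {G : Graph I} {e : G.E} (he : G.EdgeFirst e) (δ : ℤ) (φ : P.RawForms I)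
    (p : G.V → ℤ) (x : P.Dec G p) : P.contractTerm δ φ G e false p x =
      φ (G.contract e) (G.contractDeg ε e p) (P.contractDec G e false x) := by
  change sgn k (ModularData.contractSign δ G e false p) * _ = _
  rw [he.contractSign]
  have h1 : sgn k 1 = 1 := by simp [sgn]
  rw [h1, one_mul]
  rfl

theorem Graph.card_rest {I : Type} {G : Graph I} {e : G.E}
    (hne : (G.att e false).1 ≠ (G.att e true).1) : (Nat.card (G.Rest e) : ℤ) + 2 =
      Nat.card (G.H (G.att e false).1) + Nat.card (G.H (G.att e true).1) := by
  classical
  have h1 := Nat.card_congr (G.restEquiv e _ _ false rfl rfl hne)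
  have h2 := Nat.card_congr (Equiv.optionSubtypeNe (G.att e false).2)
  have h3 := Nat.card_congr (Equiv.optionSubtypeNe (G.att e true).2)
  rw [Nat.card_sum] at h1
  rw [Finite.card_option] at h2 h3
  have h4 : Nat.card {b // b ≠ (G.att e !false).2} = Nat.card {b // b ≠ (G.att e true).2} := rfl
  omega

/-- Gluing has degree `-1` in the suspension and degree 0 in `A`. The difference is made up by the
shifts: two vertices merge into one, and two half-edges disappear. -/
theorem Graph.lower_contractDeg {I : Type} {G : Graph I} {e : G.E}
    (hne : (G.att e false).1 ≠ (G.att e true).1) (q : G.V → ℤ) :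
    (G.contract e).lower (G.contractDeg 1 e q) = G.contractDeg 0 e (G.lower q) := by
  funext v
  obtain _ | v := v
  · change G.contractDeg 1 e q none + Nat.card (G.Rest e) - 3 = G.contractDeg 0 e (G.lower q) none
    have h0 := G.deg_glue 0 e _ _ false rfl rfl hne (G.lower q)
    have h1 := G.deg_glue 1 e _ _ false rfl rfl hne q
    have h2 := card_rest hne
    have h3 : G.lower q (G.att e false).1 = q (G.att e false).1 +
      Nat.card (G.H (G.att e false).1) - 3 := rfl
    have h4 : G.lower q (G.att e !false).1 = q (G.att e !false).1 +
      Nat.card (G.H (G.att e true).1) - 3 := rfl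
    omega
  · rfl

end CycFeyn

/-! ### The part of the differential that contracts edges -/

namespace CycFeyn

open Function ModularData

theorem blockSign_eq_one {X Y : Type} {s : X ⊕ Y ↪ ℕ} (h : ∀ x y, s (.inl x) < s (.inr y)) :
    CyclicData.blockSign s = 1 :=
  finprod_eq_one_of_forall_eq_one fun _ => if_neg (h _ _).not_gt

namespace CyclicOperad

variable {k : Type u} [Field k] (A : CyclicOperad.{u, w} k) {I J : Type}

/-- `toExt_valueAt_glue` for the two ends of `e`: the orders start with the half-edges of `e`, and
those left at the first end precede those left at the second, so the block sign is 1. -/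
theorem evalAt_merge {G : Graph I} (hG : ∀ v, G.genus v = 0) {e : G.E}
    (hne : (G.att e false).1 ≠ (G.att e true).1) (q : G.V → ℤ) (y : A.susp.Dec G q)
    (ρ : ∀ v, G.H v ↪ ℕ) (s : {a // a ≠ (G.att e false).2} ⊕ {a // a ≠ (G.att e true).2} ↪ ℕ)
    (hs : ∀ a b, s (.inl a) < s (.inr b))
    (hρ₀ : ρ (G.att e false).1 = Graph.endRank (G.att e false).2 (Embedding.inl.trans s))
    (hρ₁ : ρ (G.att e true).1 = Graph.endRank (G.att e true).2 (Embedding.inr.trans s))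
    (hl : G.contractDeg 0 e (G.lower q) none = G.contractDeg 1 e q none + Nat.card (G.Rest e) - 3) :
    A.toExt (G.contractGenus e none)
        (valueAt k (A.obj (G.Rest e) (G.contractDeg 1 e q none + Nat.card (G.Rest e) - 3))
          (Graph.restRank hne s)
          (A.susp.merge G e (G.att e false) (G.att e true) false rfl rfl y)) =
      sgn k (G.lower q (G.att e false).1 * G.shift (G.att e true).1).negOnePow •
        A.ext.cast (rfl : G.contractGenus e none = G.contractGenus e none) hl (Equiv.refl _)
          (A.ext.merge G e (G.att e false) (G.att e true) false rfl rfl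
            fun v => A.evalAt G q ρ v (y v)) := by
  classical
  have m1 : ∀ {ε : ℤ} (P : ModularData.{u, w} k ε) {p : G.V → ℤ} (x : P.Dec G p),
      P.merge G e (G.att e false) (G.att e true) false rfl rfl x = _ := fun P p x => dif_neg hne
  refine (congrArg (fun z => A.toExt (G.contractGenus e none) (valueAt k
    (A.obj (G.Rest e) (G.contractDeg 1 e q none + Nat.card (G.Rest e) - 3))
    (Graph.restRank hne s) z)) (m1 A.susp y)).trans ?_
  refine (A.toExt_valueAt_glue (hG _) (hG _) _ _ _ _ _
    (G.deg_glue 0 e _ _ false rfl rfl hne (G.lower q)) hl ?_ (blockSign_eq_one hs) hρ₀ hρ₁ _ _).trans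
    ?_
  · ext x
    exact congrArg s ((G.restEquiv e _ _ false rfl rfl hne).symm_apply_apply x)
  · exact congrArg (fun z => sgn k (G.lower q (G.att e false).1 * G.shift (G.att e true).1).negOnePow •
      A.ext.cast (rfl : G.contractGenus e none = G.contractGenus e none) hl (Equiv.refl _) z)
        (m1 A.ext fun v => A.evalAt G q ρ v (y v)).symm

/-- The contribution of the first edge to the differential. -/
theorem contractTerm_toSusp_of_edgeFirst [Finite I] {φ : A.ext.RawForms I}
    (hφ : ∀ G, ¬ G.IsStable 0 → φ G = 0) {G : Graph I} (hG : G.IsStable 0) {e : G.E}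
    (hne : (G.att e false).1 ≠ (G.att e true).1) (he : G.EdgeFirst e)
    (m : Graph.Rooting G) (r : I ↪ ℕ) (ρ : ∀ v, G.H v ↪ ℕ) (q : G.V → ℤ) (y : A.susp.Dec G q) :
    sgn k (m.totalSign (G.lower q) r ρ) * A.ext.contractTerm 1 φ G e false (G.lower q)
        (fun v => A.evalAt G q ρ v (y v)) =
      sgn k (3 - Nat.card I : ℤ).negOnePow *
        A.susp.contractTerm 0 (A.toSusp φ r) G e false q y := by
  classical
  -- The root is placed at the first end of `e`, where `totalSign_contract` expects it.
  obtain ⟨m', h, -⟩ := hG.existsUnique_rooting (G.att e false).1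
  obtain ⟨s, hs⟩ := Graph.exists_rank_blocks (fun x : {a // a ≠ (G.att e false).2} ⊕
    {a // a ≠ (G.att e true).2} => x.isLeft = true)
    ((Finite.equivFin _).toEmbedding.trans Fin.valEmbedding)
  -- The orders of half-edges are changed only at the ends of `e`, to those required for evaluating
  -- the merged decoration; by `totalSign_mul_evalAt` this does not affect the left side.
  let ρ' : ∀ v, G.H v ↪ ℕ := update (update ρ (G.att e false).1
    (Graph.endRank (G.att e false).2 (Embedding.inl.trans s))) (G.att e true).1
    (Graph.endRank (G.att e true).2 (Embedding.inr.trans s))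
  have hρ₁ : ρ' (G.att e true).1 = Graph.endRank (G.att e true).2 (Embedding.inr.trans s) :=
    update_self ..
  have hρ₀ : ρ' (G.att e false).1 = Graph.endRank (G.att e false).2 (Embedding.inl.trans s) :=
    (update_of_ne hne _ _).trans (update_self ..)
  have hs' : ∀ a b, s (.inl a) < s (.inr b) := fun a b => hs _ _ rfl (by simp)
  -- The least strict upper bound of the ranks at the first end: every rank at the second end is
  -- itself such a bound, and so is at least `N`.
  obtain ⟨N, hs₀, hs₁⟩ : ∃ N, (∀ a, s (.inl a) < N) ∧ ∀ b, N ≤ s (.inr b) := by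
    obtain ⟨N, hN⟩ := Graph.exists_rank_lt (Embedding.inl.trans s)
    refine ⟨sInf {N | ∀ a, s (.inl a) < N}, fun a => Nat.sInf_mem (⟨N, hN⟩ : {N | ∀ a,
      s (.inl a) < N}.Nonempty) a, fun b => Nat.sInf_le fun a => hs' a b⟩
  rw [A.totalSign_mul_evalAt m r ρ' ρ q y, hG.totalSign_eq m m', he.contractTerm, he.contractTerm]
  have hl := Graph.lower_contractDeg hne q
  -- Forms vanish off stable graphs, so the stability of the contracted graph need not be proved.
  by_cases hG' : (G.contract e).IsStable 0
  swap
  · have z1 : φ (G.contract e) (G.contractDeg 0 e (G.lower q)) = 0 := congrFun (hφ _ hG') _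
    have z2 := A.toSusp_eq_zero φ r (G := G.contract e) (q := G.contractDeg 1 e q)
      (congrFun (hφ _ hG') _)
    have a1 : φ (G.contract e) (G.contractDeg 0 e (G.lower q)) (A.ext.contractDec G e false
      fun v => A.evalAt G q ρ' v (y v)) = 0 := DFunLike.congr_fun z1 _
    have a2 : A.toSusp φ r (G.contract e) (G.contractDeg 1 e q) (A.susp.contractDec G e false y) = 0 :=
      DFunLike.congr_fun z2 _
    rw [a1, a2, mul_zero, mul_zero]
  have key := m'.totalSign_contract h he hne (p := G.lower q) (p' := G.contractDeg 0 e (G.lower q))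
    (fun v hv => rfl) ((G.deg_glue 0 e _ _ false rfl rfl hne (G.lower q)).symm.trans
      (add_zero _)).symm r ρ' s hs₀ hs₁ hρ₀ hρ₁
  let X : A.ext.Dec (G.contract e) ((G.contract e).lower (G.contractDeg 1 e q)) := fun u =>
    A.ext.cast rfl (congrFun hl u).symm (Equiv.refl _)
      (A.ext.contractDec G e false (fun v => A.evalAt G q ρ' v (y v)) u)
  have h1 : φ (G.contract e) ((G.contract e).lower (G.contractDeg 1 e q)) X =
      φ (G.contract e) (G.contractDeg 0 e (G.lower q))
        (A.ext.contractDec G e false fun v => A.evalAt G q ρ' v (y v)) :=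
    A.ext.form_congr φ hl.symm fun u => rfl
  -- Only the new vertex carries a sign; the other decorations are untouched by the contraction.
  let σ : (G.contract e).V → ℤ := fun u => if u = G.newVertex e then
      G.lower q (G.att e false).1 * G.shift (G.att e true).1 else 0
  have h2 : ∀ u, A.evalAt (G.contract e) (G.contractDeg 1 e q)
      (Graph.contractHalfRank (Graph.restRank hne s) ρ') u (A.susp.contractDec G e false y u) =
      sgn k (σ u).negOnePow • X u := by
    rintro (_ | u)
    · have hσ : σ none = G.lower q (G.att e false).1 * G.shift (G.att e true).1 := if_pos rfl
      rw [hσ]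
      exact A.evalAt_merge hG.genus_eq_zero hne q y ρ' s hs' hρ₀ hρ₁ (congrFun hl none).symm
    · have hσ : σ (some u) = 0 := if_neg fun h => by cases h
      have h3 : sgn k (0 : ℤ).negOnePow = 1 := by simp [sgn]
      rw [hσ, h3]
      exact ((A.ext.cast_refl _ _ _).symm).trans (one_smul k _).symm
  have h3 : A.toSusp φ r (G.contract e) (G.contractDeg 1 e q) (A.susp.contractDec G e false y) =
      sgn k ((m'.contract h).totalSign ((G.contract e).lower (G.contractDeg 1 e q)) r
        (Graph.contractHalfRank (Graph.restRank hne s) ρ')) *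
      φ (G.contract e) ((G.contract e).lower (G.contractDeg 1 e q)) fun u =>
        sgn k (σ u).negOnePow • X u :=
    (A.toSusp_apply φ hG' (m'.contract h) r (Graph.contractHalfRank (Graph.restRank hne s) ρ')
      _ _).trans (congrArg (fun x => sgn k _ * φ (G.contract e)
        ((G.contract e).lower (G.contractDeg 1 e q)) x) (funext h2))
  rw [MultilinearMap.map_smul_univ, ← sgn_prod, ← negOnePow_prod, Finset.sum_ite_eq', h1,
    if_pos (Finset.mem_univ _), hl, smul_eq_mul] at h3
  refine Eq.trans ?_ (congrArg (fun x => sgn k (3 - Nat.card I : ℤ).negOnePow * x) h3.symm)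
  rw [key, sgn_mul, sgn_mul]
  -- The sign `(-1)^(|I|+1)` from the block of the contracted edge is precisely the sign of the
  -- suspended differential.
  have h4 : (3 - Nat.card I : ℤ).negOnePow = (Nat.card I + 1 : ℤ).negOnePow := by
    rw [Int.negOnePow_eq_iff]
    exact ⟨1 - Nat.card I, by ring⟩
  rw [h4]
  ring

/-- Reduced to the case where `e` and its ends come first, by naturality of both forms and
`totalSign_map`. -/
theorem contractTerm_toSusp [Finite I] {φ : A.ext.RawForms I}
    (hφ : ∀ G, ¬ G.IsStable 0 → φ G = 0) (hn : IsNatural 1 φ) {G : Graph I} (hG : G.IsStable 0)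
    (e : G.E) (m : Graph.Rooting G) (r : I ↪ ℕ) (ρ : ∀ v, G.H v ↪ ℕ) (q : G.V → ℤ)
    (y : A.susp.Dec G q) :
    sgn k (m.totalSign (G.lower q) r ρ) * A.ext.contractTerm 1 φ G e false (G.lower q)
        (fun v => A.evalAt G q ρ v (y v)) =
      sgn k (3 - Nat.card I : ℤ).negOnePow *
        A.susp.contractTerm 0 (A.toSusp φ r) G e false q y := by
  obtain ⟨m', hm, -⟩ := hG.existsUnique_rooting (G.att e false).1
  -- A tree has no loops: rooted at an end of `e`, it has the chosen end of `e` different from the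
  -- root.
  have hne : (G.att e false).1 ≠ (G.att e true).1 := fun h =>
    m'.att_ne_root e (by rw [m'.dir_eq_true hm, hm, h])
  obtain ⟨rV, rE, he⟩ := G.exists_edgeFirst e hne
  let f := G.rerankIso rV rE
  have h := A.contractTerm_toSusp_of_edgeFirst hφ ((f.isStable 0).1 hG) hne he (m.map f) r ρ q y
  have h1 := A.ext.contractTerm_iso 1 hn f e (p := G.lower q) (p' := G.lower q) (fun _ => rfl)
    (decRel_rerank A.ext G rV rE fun v => A.evalAt G q ρ v (y v)) false false
  have h2 := A.susp.contractTerm_iso 0 (A.toSusp_natural hφ hn r) f e (p := q) (p' := q)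
    (fun _ => rfl) (decRel_rerank A.susp G rV rE y) false false
  have h0 : koszul G.rE ((G.rerank rV rE).rE ∘ f.e) (fun _ => 0) = 1 :=
    finprod_eq_one_of_forall_eq_one fun _ => by simp
  rw [h0, one_mul] at h2
  have h3 := m.totalSign_map f (p := G.lower q) (p' := G.lower q) (fun _ => rfl) r ρ
  rw [koszul_congr_deg _ _ _ _ (G.lower_add_shift q)] at h3
  exact sgn_mul_descend h3 h1 h2 h

/-- Compared term by term: for every vertex the internal differential, for every edge its
contraction. The sign `(-1)^(3-|I|)` of the suspended differential is common to all terms. -/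
theorem suspEquiv_d [Finite I] {n l : ℤ} (h : l + 1 = n) (φ : A.cycFeynman.obj I n) :
    A.suspEquiv I l (A.cycFeynman.d h φ) = A.dgDual.suspension.d h (A.suspEquiv I n φ) := by
  refine Subtype.ext (funext fun r => A.susp.forms_ext fun G hG q y => ?_)
  obtain ⟨m⟩ := hG.nonempty_rooting
  refine (A.toSusp_apply _ hG m r G.halfRank q y).trans ?_
  have h1 : ((A.dgDual.suspension.d h (A.suspEquiv I n φ)).1 r).1 G q y =
      sgn k (3 - Nat.card I : ℤ).negOnePow * A.susp.dRaw 0 0 (A.toSusp φ.1 r) G q y := by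
    change ((3 - Nat.card I : ℤ).negOnePow • A.dgDual.d _ ((A.suspEquiv I n φ).1 r)).1 G q y = _
    rw [units_smul_eq (k := k)]
    rfl
  have h2 : ∀ x, (A.cycFeynman.d h φ).1 G (G.lower q) x =
    A.ext.dRaw 1 0 φ.1 G (G.lower q) x := fun _ => rfl
  rw [h1, h2, dRaw_apply _ _ _ hG, dRaw_apply _ _ _ hG]
  simp only [Finset.mul_sum, mul_add]
  exact congrArg₂ (· + ·) (Finset.sum_congr rfl fun v _ => A.dAt_toSusp φ.1 hG m r _ q y v)
    (Finset.sum_congr rfl fun e _ => A.contractTerm_toSusp φ.2.1 φ.2.2.2 hG e m r _ q y)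

end CyclicOperad

end CycFeyn

theorem mainTheorem2 {k : Type u} [Field k] [CharZero k] (A : CycFeyn.CyclicOperad.{u, w} k) :
    Nonempty (CycFeyn.CyclicData.Iso A.cycFeynman A.dgDual.suspension) :=
  ⟨{ equiv := fun I _ n => A.suspEquiv I n
     d := fun h φ => A.suspEquiv_d h φ
     map := fun f φ => A.suspEquiv_map f φ
     comp := fun h φ ψ => A.suspEquiv_comp h φ ψ }⟩
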